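/- **Setting.** Let $(\mathsf X,\mathcal X)$ be a measurable space, $G_n:\mathsf X\to[0,\infty)$ $(n\ge 0)$ bounded measurable functions and, for $s\in\{f,c\}$, $\eta_0^s$ a probability measure and $M_n^s$ $(n\ge1)$ Markov kernels on $\mathsf X$. Put $$\gamma_n^s(B)=\int \mathbb I_B(x_n)\Big(\prod_{p=0}^{n-1}G_p(x_p)\Big)\eta_0^s(dx_0)\prod_{p=1}^nM_p^s(x_{p-1},dx_p),\qquad \eta_n^s=\gamma_n^s/\gamma_n^s(1),$$ and assume $\gamma_n^s(1)>0$ for all $n$ and $s$. Let $\check\eta_0$ be a coupling of $(\eta_0^f,\eta_0^c)$ and let $\check M_n$ $(n\ge1)$ be Markov kernels on $\mathsf X\times\mathsf X$ such that $\check M_n((x,x'),\cdot)$ is a coupling of $(M_n^f(x,\cdot),M_n^c(x',\cdot))$ for all $(x,x')$. Let $Q_{p+1}^s(x,dy)=G_p(x)M_{p+1}^s(x,dy)$, let $Q_{p,n}^s=Q_{p+1}^s\cdots Q_n^s$ (the identity if $p=n$), and for $0\le p\le n$ put $$D_{p,n}^s(\varphi)=\frac{Q_{p,n}^s(\varphi-\eta_n^s(\varphi))}{\eta_p^s(Q_{p,n}^s(1))}.$$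 **Resampling operators.** For $n\ge1$ write $g=G_{n-1}$, and $a\wedge b=\min(a,b)$. * Independent: for a probability measure $\mu$ on $\mathsf X\times\mathsf X$, $\check\Phi_n^I(\mu)(B)=\mu([g\otimes g]\check M_n(B))/\mu(g\otimes g)$. Limit: $\check\eta_0^I=\check\eta_0$ and $\check\eta_n^I=\check\Phi_n^I(\eta_{n-1}^f\otimes\eta_{n-1}^c)$ for $n\ge 1$. * Maximally coupled resampling: for a probability measure $\mu$ on $\mathsf X\times\mathsf X$, let $F_f(x,y)=g(x)/\mu(g\otimes1)$, $F_c(x,y)=g(y)/\mu(1\otimes g)$ and $m=\mu(F_f\wedge F_c)$, let $\overline F_s=(F_s-F_f\wedge F_c)/(1-m)$, and $$\check\Phi_n^M(\mu)(B)=\mu\big((F_f\wedge F_c)\check M_n(B)\big)+(1-m)\iint\overline F_f(x,y)\,\overline F_c(u,v)\,\check M_n((x,v),B)\,\mu(d(x,y))\,\mu(d(u,v)),$$ the second term being $0$ if $m=1$. Limit: $\check\eta_0^M=\check\eta_0$ and $\check\eta_n^M=\check\Phi_n^M(\check\eta_{n-1}^M)$ for $n\ge 1$. * Maximal coupling: suppose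 that $\eta_0^s$ and $M_n^s(x,\cdot)$ have densities, written $\eta_0^s(y)$ and $M_n^s(x,y)$ (jointly measurable), with respect to a $\sigma$-finite measure $dy$. The maximal coupling of two probability densities $a,b$ is the law $$\int\delta_{(u,u)}\,a(u)\wedge b(u)\,du+\frac{(a-a\wedge b)(x)\,(b-a\wedge b)(y)\,dx\,dy}{1-\int a\wedge b},$$ the second term being $0$ if $\int a\wedge b=1$. For probability measures $\mu,\nu$ on $\mathsf X$, $\check\Phi_n^C(\mu,\nu)$ is the maximal coupling of the densities $\mu(gM_n^f(\cdot,x))/\mu(g)$ and $\nu(gM_n^c(\cdot,x))/\nu(g)$. Limit: $\check\eta_0^C$ is the maximal coupling of $(\eta_0^f,\eta_0^c)$ and $\check\eta_n^C=\check\Phi_n^C(\eta_{n-1}^f,\eta_{n-1}^c)$ for $n\ge 1$. **Algorithms.** For $t\in\{I,M,C\}$ the $N$ pairs $u_0^i=(x_0^{i,f},x_0^{i,c})$, $1\le i\le N$, are independent with law $\check\eta_0^t$. Given the particles up to time $p-1$, the pairs $u_p^1,\dots,u_p^N$ are independent with law $\check\Phi_p^I(\eta_{p-1}^{N,f}\otimes\eta_{p-1}^{N,c})$,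 $\check\Phi_p^M(\check\eta_{p-1}^{N,M})$ or $\check\Phi_p^C(\eta_{p-1}^{N,f},\eta_{p-1}^{N,c})$ respectively, where $\check\eta_p^{N,t}=\frac1N\sum_i\delta_{u_p^i}$ and $\eta_p^{N,s}=\frac1N\sum_i\delta_{x_p^{i,s}}$. If $\eta_{p-1}^{N,f}(G_{p-1})=0$ or $\eta_{p-1}^{N,c}(G_{p-1})=0$, the next configuration is instead drawn from an arbitrary fixed Markov kernel applied to the current configuration. **Theorem.** In each of the following cases the law of the particle system is a well-defined probability measure, and for every $n\ge0$ one has $\check\eta_n^t(\varphi\otimes1-1\otimes\varphi)=\eta_n^f(\varphi)-\eta_n^c(\varphi)$ and, as $N\to\infty$, $$\sqrt N\,[\check\eta_n^{N,t}-\check\eta_n^t](\varphi\otimes1-1\otimes\varphi)\Rightarrow\mathcal N\big(0,\sigma_n^{2,t}(\varphi)\big),\qquad \sigma_n^{2,t}(\varphi)=\sum_{p=0}^n\check\eta_p^t\Big(\{D_{p,n}^f(\varphi)\otimes1-1\otimes D_{p,n}^c(\varphi)\}^2\Big).$$ 1. $t=I$ and $\varphi:\mathsf X\to\mathbb R$ is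 bounded and measurable. 2. $t=M$; $\mathsf X$ carries a topology with Borel $\sigma$-algebra $\mathcal X$ such that $\mathsf X\times\mathsf X$ is metrizable, locally compact and separable; every $G_n$ is continuous; every $\check M_n$ $(n\ge1)$ is Feller, i.e. maps bounded continuous functions to continuous functions; and $\varphi$ is bounded and continuous. 3. $t=C$; the densities above exist and, for every $n\ge1$ and $s\in\{f,c\}$, the transition density $M_n^s(\cdot,\cdot)$ is bounded; and $\varphi$ is bounded and measurable. -/

import Mathlib

open MeasureTheory ProbabilityTheory Filter Topology
open scoped NNReal ENNReal BoundedContinuousFunction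

noncomputable section

namespace CoupledPF

variable {X S : Type*} [MeasurableSpace X] [MeasurableSpace S]

/-! ### Feynman-Kac models -/

/-- The unnormalized measure
`γ_n(B) = ∫ 1_B(x_n) (∏_{p<n} G_p(x_p)) η₀(dx_0) ∏_{p=1}^n M_p(x_{p-1}, dx_p)`,
with the iterated integral written out one time step after the other. -/
def gam (G : ℕ → X → ℝ≥0) (η₀ : Measure X) (M : ℕ → Kernel X X) : ℕ → Measure X
  | 0 => η₀
  | n + 1 => ((gam G η₀ M n).withDensity (fun x => (G n x : ℝ≥0∞))).bind (M (n + 1))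

/-- The predictor `η_n = γ_n / γ_n(1)`. -/
def eta (G : ℕ → X → ℝ≥0) (η₀ : Measure X) (M : ℕ → Kernel X X) (n : ℕ) : Measure X :=
  (gam G η₀ M n Set.univ)⁻¹ • gam G η₀ M n

/-- `Q_{p,p+k}(φ)(x)`, where `Q_{q+1}(x, dy) = G_q(x) M_{q+1}(x, dy)` and
`Q_{p,n} = Q_{p+1} ⋯ Q_n` (the identity if `p = n`). -/
def Qop (G : ℕ → X → ℝ≥0) (M : ℕ → Kernel X X) : ℕ → ℕ → (X → ℝ) → X → ℝ
  | _, 0, φ => φ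
  | p, k + 1, φ => fun x => (G p x : ℝ) * ∫ y, Qop G M (p + 1) k φ y ∂(M (p + 1) x)

/-- `D_{p,n}(φ) = Q_{p,n}(φ - η_n(φ)) / η_p(Q_{p,n}(1))`, for `p ≤ n`. -/
def Dop (G : ℕ → X → ℝ≥0) (η₀ : Measure X) (M : ℕ → Kernel X X) (p n : ℕ)
    (φ : X → ℝ) (x : X) : ℝ :=
  Qop G M p (n - p) (fun y => φ y - ∫ z, φ z ∂(eta G η₀ M n)) x /
    ∫ y, Qop G M p (n - p) (fun _ => 1) y ∂(eta G η₀ M p)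

/-- `μ` is a coupling of `μ₁` and `μ₂`. -/
def IsCoupling (μ : Measure (X × X)) (μ₁ μ₂ : Measure X) : Prop :=
  μ.map Prod.fst = μ₁ ∧ μ.map Prod.snd = μ₂

/-! ### Independent pair resampling -/

/-- `Φ^I(μ)(B) = μ((g ⊗ g) K(B)) / μ(g ⊗ g)`. -/
def PhiI (g : X → ℝ≥0) (K : Kernel (X × X) (X × X)) (μ : Measure (X × X)) : Measure (X × X) :=
  (∫⁻ u, (g u.1 : ℝ≥0∞) * g u.2 ∂μ)⁻¹ •
    (μ.withDensity (fun u => (g u.1 : ℝ≥0∞) * g u.2)).bind K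

/-- The limiting coupling of independent pair resampling: `η̌_0` at time `0` and
`Φ^I_n(η^f_{n-1} ⊗ η^c_{n-1})` at time `n ≥ 1`. -/
def limI (G : ℕ → X → ℝ≥0) (ηf ηc : Measure X) (Mf Mc : ℕ → Kernel X X)
    (η₀ : Measure (X × X)) (K : ℕ → Kernel (X × X) (X × X)) : ℕ → Measure (X × X)
  | 0 => η₀
  | n + 1 => PhiI (G n) (K (n + 1)) ((eta G ηf Mf n).prod (eta G ηc Mc n))

/-! ### Maximally coupled resampling -/

/-- `F_{μ,f}(x, y) = g(x) / μ(g ⊗ 1)`. -/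
def Ff (g : X → ℝ≥0) (μ : Measure (X × X)) (u : X × X) : ℝ≥0∞ :=
  g u.1 / ∫⁻ w, (g w.1 : ℝ≥0∞) ∂μ

/-- `F_{μ,c}(x, y) = g(y) / μ(1 ⊗ g)`. -/
def Fc (g : X → ℝ≥0) (μ : Measure (X × X)) (u : X × X) : ℝ≥0∞ :=
  g u.2 / ∫⁻ w, (g w.2 : ℝ≥0∞) ∂μ

/-- `F_{μ,f} ∧ F_{μ,c}`. -/
def Fmin (g : X → ℝ≥0) (μ : Measure (X × X)) (u : X × X) : ℝ≥0∞ :=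
  min (Ff g μ u) (Fc g μ u)

/-- The normalized residual `(F_{μ,f} - F_{μ,f} ∧ F_{μ,c}) / μ(F_{μ,f} - F_{μ,f} ∧ F_{μ,c})`. -/
def Fbarf (g : X → ℝ≥0) (μ : Measure (X × X)) (u : X × X) : ℝ≥0∞ :=
  (Ff g μ u - Fmin g μ u) / ∫⁻ w, (Ff g μ w - Fmin g μ w) ∂μ

/-- The normalized residual `(F_{μ,c} - F_{μ,f} ∧ F_{μ,c}) / μ(F_{μ,c} - F_{μ,f} ∧ F_{μ,c})`. -/
def Fbarc (g : X → ℝ≥0) (μ : Measure (X × X)) (u : X × X) : ℝ≥0∞ :=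
  (Fc g μ u - Fmin g μ u) / ∫⁻ w, (Fc g μ w - Fmin g μ w) ∂μ

/-- The kernel `((x, y), (u, v)) ↦ K((x, v), ·)`. -/
def barK (K : Kernel (X × X) (X × X)) : Kernel ((X × X) × (X × X)) (X × X) :=
  K.comap (fun w => (w.1.1, w.2.2)) (by fun_prop)

/-- `Φ^M(μ)(B) = μ((F_f ∧ F_c) K(B)) + (1 - μ(F_f ∧ F_c)) (μ ⊗ μ)((F̄_f ⊗ F̄_c) K̄(B))`. -/
def PhiM (g : X → ℝ≥0) (K : Kernel (X × X) (X × X)) (μ : Measure (X × X)) : Measure (X × X) :=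
  (μ.withDensity (Fmin g μ)).bind K +
    (1 - ∫⁻ u, Fmin g μ u ∂μ) •
      ((μ.prod μ).withDensity (fun w => Fbarf g μ w.1 * Fbarc g μ w.2)).bind (barK K)

/-- The limiting coupling of maximally coupled resampling: `η̌^M_0 = η̌_0`,
`η̌^M_n = Φ^M_n(η̌^M_{n-1})`. -/
def limM (G : ℕ → X → ℝ≥0) (η₀ : Measure (X × X)) (K : ℕ → Kernel (X × X) (X × X)) :
    ℕ → Measure (X × X)
  | 0 => η₀
  | n + 1 => PhiM (G n) (K (n + 1)) (limM G η₀ K n)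

/-! ### Maximal coupling -/

/-- The maximal coupling of the probability measures with densities `a` and `b` with respect
to `ν`: the common part `a ∧ b` is put on the diagonal, and the residuals are independent. The
second term is the zero measure if the two probability measures coincide. -/
def maxCoupling (ν : Measure X) (a b : X → ℝ≥0∞) : Measure (X × X) :=
  (ν.withDensity (fun x => min (a x) (b x))).map (fun x => (x, x)) +
    (1 - ∫⁻ x, min (a x) (b x) ∂ν)⁻¹ •
      (ν.withDensity (fun x => a x - min (a x) (b x))).prod
        (ν.withDensity (fun x => b x - min (a x) (b x)))

/-- `F_μ(x) = μ(g m(·, x)) / μ(g)`, for a transition density `m`. -/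
def Fdens (g : X → ℝ≥0) (m : X → X → ℝ≥0) (μ : Measure X) (x : X) : ℝ≥0∞ :=
  (∫⁻ z, (g z : ℝ≥0∞) * m z x ∂μ) / ∫⁻ z, (g z : ℝ≥0∞) ∂μ

/-- `Φ^C(μ₁, μ₂)`, for transition densities `mf`, `mc` with respect to `ν`. -/
def PhiC (ν : Measure X) (g : X → ℝ≥0) (mf mc : X → X → ℝ≥0) (μ₁ μ₂ : Measure X) :
    Measure (X × X) :=
  maxCoupling ν (Fdens g mf μ₁) (Fdens g mc μ₂)

/-- The limiting coupling of the maximal coupling filter: the maximal coupling of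
`(η^f_0, η^c_0)` (densities `df`, `dc`) at time `0`, and `Φ^C_n(η^f_{n-1}, η^c_{n-1})` at time
`n ≥ 1`. -/
def limC (ν : Measure X) (G : ℕ → X → ℝ≥0) (ηf ηc : Measure X) (Mf Mc : ℕ → Kernel X X)
    (df dc : X → ℝ≥0) (mf mc : ℕ → X → X → ℝ≥0) : ℕ → Measure (X × X)
  | 0 => maxCoupling ν (fun x => df x) (fun x => dc x)
  | n + 1 => PhiC ν (G n) (mf (n + 1)) (mc (n + 1)) (eta G ηf Mf n) (eta G ηc Mc n)

/-! ### Particle systems -/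

/-- The empirical measure `N⁻¹ ∑_i δ_{x_i}`. -/
def empirical {N : ℕ} (x : Fin N → S) : Measure S :=
  (N : ℝ≥0∞)⁻¹ • ∑ i, Measure.dirac (x i)

open Classical in
/-- One step of a coupled particle filter with `N` pairs, from a configuration `u`. If some
first component and some second component have positive weight, the `N` new pairs are
independent with law `Ψ u`. If all first components or all second components have weight zero
(extinction, where `Ψ u` involves a division by zero), the new configuration is drawn from
`R u`. -/
def stepLaw {N : ℕ} (g : X → ℝ≥0) (Ψ : (Fin N → X × X) → Measure (X × X))
    (R : Kernel (Fin N → X × X) (Fin N → X × X)) (u : Fin N → X × X) :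
    Measure (Fin N → X × X) :=
  if (∃ i, 0 < g (u i).1) ∧ (∃ i, 0 < g (u i).2) then Measure.pi (fun _ => Ψ u) else R u

/-- The joint law of `(u_0^{1:N}, …, u_n^{1:N})`: independent pairs with law `μ₀` at time `0`,
and then the transitions `stepLaw`; `Ψ p` governs the transition from time `p` to `p + 1`. -/
def particleLaw {N : ℕ} (G : ℕ → X → ℝ≥0) (μ₀ : Measure (X × X))
    (Ψ : ℕ → (Fin N → X × X) → Measure (X × X))
    (R : ℕ → Kernel (Fin N → X × X) (Fin N → X × X)) :
    (n : ℕ) → Measure (Fin (n + 1) → Fin N → X × X)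
  | 0 => (Measure.pi (fun _ : Fin N => μ₀)).map (fun u _ => u)
  | n + 1 => (particleLaw G μ₀ Ψ R n).bind (fun h =>
      (stepLaw (G n) (Ψ n) (R n) (h (Fin.last n))).map
        (fun v => Fin.snoc (α := fun _ => Fin N → X × X) h v))

/-- The law of the particle filter with independent pair resampling. -/
def lawI (G : ℕ → X → ℝ≥0) (η₀ : Measure (X × X)) (K : ℕ → Kernel (X × X) (X × X)) (N : ℕ)
    (R : ℕ → Kernel (Fin N → X × X) (Fin N → X × X)) (n : ℕ) :
    Measure (Fin (n + 1) → Fin N → X × X) :=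
  particleLaw G η₀ (fun p u => PhiI (G p) (K (p + 1))
    ((empirical (fun i => (u i).1)).prod (empirical (fun i => (u i).2)))) R n

/-- The law of the particle filter with maximally coupled resampling. -/
def lawM (G : ℕ → X → ℝ≥0) (η₀ : Measure (X × X)) (K : ℕ → Kernel (X × X) (X × X)) (N : ℕ)
    (R : ℕ → Kernel (Fin N → X × X) (Fin N → X × X)) (n : ℕ) :
    Measure (Fin (n + 1) → Fin N → X × X) :=
  particleLaw G η₀ (fun p u => PhiM (G p) (K (p + 1)) (empirical u)) R n

/-- The law of the maximal coupling particle filter. -/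
def lawC (ν : Measure X) (G : ℕ → X → ℝ≥0) (df dc : X → ℝ≥0) (mf mc : ℕ → X → X → ℝ≥0) (N : ℕ)
    (R : ℕ → Kernel (Fin N → X × X) (Fin N → X × X)) (n : ℕ) :
    Measure (Fin (n + 1) → Fin N → X × X) :=
  particleLaw G (maxCoupling ν (fun x => df x) (fun x => dc x))
    (fun p u => PhiC ν (G p) (mf (p + 1)) (mc (p + 1))
      (empirical (fun i => (u i).1)) (empirical (fun i => (u i).2))) R n

/-! ### The central limit theorem -/

/-- `√N [η̌_n^N - η̌](φ ⊗ 1 - 1 ⊗ φ)`, as a function of the trajectory of the particle system. -/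
def scaledError (n N : ℕ) (η : Measure (X × X)) (φ : X → ℝ)
    (h : Fin (n + 1) → Fin N → X × X) : ℝ :=
  √(N : ℝ) * (∫ u, (φ u.1 - φ u.2) ∂(empirical (h (Fin.last n))) - ∫ u, (φ u.1 - φ u.2) ∂η)

/-- `∑_{p=0}^n η̌_p((D^f_{p,n}(φ) ⊗ 1 - 1 ⊗ D^c_{p,n}(φ))²)`. -/
def asympVar (G : ℕ → X → ℝ≥0) (ηf ηc : Measure X) (Mf Mc : ℕ → Kernel X X)
    (η : ℕ → Measure (X × X)) (n : ℕ) (φ : X → ℝ) : ℝ :=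
  ∑ p ∈ Finset.range (n + 1),
    ∫ u, (Dop G ηf Mf p n φ u.1 - Dop G ηc Mc p n φ u.2) ^ 2 ∂(η p)

/-- The laws `law N` of the particle systems are probability measures, under which the scaled
errors converge in distribution to a centred Gaussian with variance `v ≥ 0`, as `N → ∞`. -/
def ErrorCLT (n : ℕ) (law : ∀ N : ℕ, Measure (Fin (n + 1) → Fin N → X × X))
    (η : Measure (X × X)) (φ : X → ℝ) (v : ℝ) : Prop :=
  ∃ _ : ∀ N, IsProbabilityMeasure (law N),
    TendstoInDistribution (fun N => scaledError n N η φ) atTop (id : ℝ → ℝ) law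
      (gaussianReal 0 v.toNNReal)

end CoupledPF

end

/-!
The proof works for any particle system whose pairs are drawn, given the past, from a coupling of
the two one-step marginal laws `PhiS` (`IsCoupledFilter`), and separates what depends on the
marginals alone from what depends on the coupling. Convergence in probability, on the different
probability spaces of the systems with `N` particles, is convergence along the filter `whp`.

*Marginals.* Whatever the coupling, each marginal empirical measure satisfies a law of large
numbers, even after multiplication by `N ^ (1/4)`, by induction over time from a conditional
Chebyshev inequality. Extinction has vanishing probability, so the rule for continuing
after it plays no role.

*Fluctuations.* Given the configuration at time `n`, the error at time `n + 1` is that of an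
i.i.d. sample. On the scale `√N` it is therefore close to a Gaussian, uniformly in the sampled law
(`norm_integral_exp_empirical_sub_le`), whose mean is the error at time `n` of the function pulled
back by one step (`backStep`), up to a product of two errors that are both `o(N ^ (-1/4))` in
probability. Its variance converges as soon as the integrals of products `ψ₁ ⊗ ψ₂` under the
resampling law do. Characteristic functions then pass from time `n` to time `n + 1`
(`tendsto_charFun_werr`), the variances add up to the asserted sum because `D_{p,n}` obeys the same
recursion (`Dop_succ`), and Lévy's continuity theorem gives the convergence in law (`errorCLT`).

*Mixed moments.* The convergence of the integrals of `ψ₁ ⊗ ψ₂` is all that has to be checked for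
each of the three algorithms.
* Independent resampling: the integral is a ratio of V-statistics, for which a second moment bound
  suffices (`tendsto_prod_empirical`).
* Maximally coupled resampling: the resampling map is weakly continuous
  (`tendsto_integral_PhiM`). The residual part is a product of two integrals divided by its mass;
  where the mass tends to zero, the numerator is of second order in the mass
  (`tendsto_inv_mul_of_abs_le_sq`).
* Maximal coupling: the densities of the resampling laws converge in `L¹` in probability, by
  pointwise convergence and Scheffé (`tendsto_L1_of_tendsto_whp`), and the maximal coupling
  is continuous in the densities for `L¹` (`tendsto_integral_maxCoupling`).
-/

noncomputable section

namespace CoupledPF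

/-! ### Convergence in probability as convergence along a filter -/

/-- The filter of events that hold with probability tending to one along the sequence `P` of
measures. For random variables `f N` on `Ω N`, convergence in probability to a constant `c` is
`Tendsto f (whp P) (𝓝 c)`, with `f` viewed as a function on `Σ N, Ω N`. -/
def whp {Ω : ℕ → Type*} [∀ N, MeasurableSpace (Ω N)] (P : ∀ N, Measure (Ω N)) :
    Filter (Σ N, Ω N) where
  sets := {S | Tendsto (fun N => P N {ω | (⟨N, ω⟩ : Σ N, Ω N) ∉ S}) atTop (𝓝 0)}
  univ_sets := by simp
  sets_of_superset := by
    intro S T hS hST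
    refine tendsto_of_tendsto_of_tendsto_of_le_of_le tendsto_const_nhds hS (fun _ => zero_le)
      (fun N => measure_mono fun ω hω h => hω (hST h))
  inter_sets := by
    intro S T hS hT
    have h := Tendsto.add (a := (0 : ℝ≥0∞)) (b := 0) hS hT
    rw [add_zero] at h
    refine tendsto_of_tendsto_of_tendsto_of_le_of_le tendsto_const_nhds h (fun _ => zero_le)
      (fun N => ?_)
    refine (measure_mono ?_).trans (measure_union_le _ _)
    intro ω hω
    by_cases h1 : (⟨N, ω⟩ : Σ N, Ω N) ∈ S
    · exact Or.inr fun h2 => hω ⟨h1, h2⟩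
    · exact Or.inl h1

section whp
variable {Ω : ℕ → Type*} [∀ N, MeasurableSpace (Ω N)] {P : ∀ N, Measure (Ω N)}

lemma eventually_whp_iff {q : (Σ N, Ω N) → Prop} :
    (∀ᶠ z in whp P, q z) ↔ Tendsto (fun N => P N {ω | ¬ q ⟨N, ω⟩}) atTop (𝓝 0) := Iff.rfl

lemma tendsto_fst_whp : Tendsto (fun z : Σ N, Ω N => z.1) (whp P) atTop := by
  refine tendsto_atTop.2 fun n => eventually_whp_iff.2 ?_
  refine tendsto_const_nhds.congr' ?_
  filter_upwards [eventually_ge_atTop n] with N hN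
  simp [hN]

/-- Bounded convergence: a bounded variable that is small with high probability has a small
mean. No measurability is needed for this direction. -/
lemma tendsto_lintegral_of_tendsto_whp [∀ N, IsProbabilityMeasure (P N)]
    {f : (Σ N, Ω N) → ℝ≥0∞} {C : ℝ≥0} (hC : ∀ z, f z ≤ C) (hf : Tendsto f (whp P) (𝓝 0)) :
    Tendsto (fun N => ∫⁻ ω, f ⟨N, ω⟩ ∂(P N)) atTop (𝓝 0) := by
  rw [ENNReal.tendsto_nhds_zero]
  intro ε hε
  obtain ⟨δ, hδ, hδε⟩ : ∃ δ : ℝ≥0∞, 0 < δ ∧ δ + δ ≤ ε :=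
    ⟨ε / 2, by simpa using hε.ne', (ENNReal.add_halves ε).le⟩
  have h1 := eventually_whp_iff.1 (ENNReal.tendsto_nhds_zero.1 hf δ hδ)
  have h2 : Tendsto (fun N => (C : ℝ≥0∞) * P N {ω | ¬ f ⟨N, ω⟩ ≤ δ}) atTop (𝓝 0) := by
    simpa using ENNReal.Tendsto.const_mul h1 (Or.inr ENNReal.coe_ne_top)
  filter_upwards [ENNReal.tendsto_nhds_zero.1 h2 δ hδ] with N hN
  set T := toMeasurable (P N) {ω | ¬ f ⟨N, ω⟩ ≤ δ}
  have hT : MeasurableSet T := measurableSet_toMeasurable _ _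
  calc ∫⁻ ω, f ⟨N, ω⟩ ∂(P N) ≤ ∫⁻ ω, (δ + T.indicator (fun _ => (C : ℝ≥0∞)) ω) ∂(P N) := by
        refine lintegral_mono fun ω => ?_
        by_cases h : ω ∈ T
        · simpa [h] using (hC _).trans le_add_self
        · have : f ⟨N, ω⟩ ≤ δ := by
            by_contra h'
            exact h (subset_toMeasurable _ _ h')
          simpa [h] using this
    _ = δ + C * P N T := by
        rw [lintegral_add_left measurable_const, lintegral_indicator hT]
        simp
    _ ≤ δ + δ := by
        rw [measure_toMeasurable]
        gcongr
    _ ≤ ε := hδε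

/-- Markov's inequality: convergence of the means implies convergence in probability. -/
lemma tendsto_whp_of_tendsto_lintegral {f : (Σ N, Ω N) → ℝ≥0∞}
    (hm : ∀ N, Measurable fun ω => f ⟨N, ω⟩)
    (hf : Tendsto (fun N => ∫⁻ ω, f ⟨N, ω⟩ ∂(P N)) atTop (𝓝 0)) :
    Tendsto f (whp P) (𝓝 0) := by
  rw [ENNReal.tendsto_nhds_zero]
  intro ε hε
  wlog hε' : ε ≠ ∞ generalizing ε
  · simp only [ne_eq, not_not] at hε'
    simp [hε']
  rw [eventually_whp_iff]
  have h2 : Tendsto (fun N => (∫⁻ ω, f ⟨N, ω⟩ ∂(P N)) / ε) atTop (𝓝 0) := by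
    simpa using ENNReal.Tendsto.div_const hf (Or.inr hε.ne')
  refine tendsto_of_tendsto_of_tendsto_of_le_of_le tendsto_const_nhds h2 (fun _ => zero_le)
      (fun N => ?_)
  refine le_trans (measure_mono ?_) (meas_ge_le_lintegral_div (hm N).aemeasurable hε.ne' hε')
  intro ω hω
  exact (not_le.1 hω).le

/-- Bounded convergence for Bochner integrals. -/
lemma tendsto_integral_of_tendsto_whp [∀ N, IsProbabilityMeasure (P N)]
    {F : Type*} [NormedAddCommGroup F] [NormedSpace ℝ F]
    {f : (Σ N, Ω N) → F} {C : ℝ≥0} (hC : ∀ z, ‖f z‖ ≤ C) (hf : Tendsto f (whp P) (𝓝 0)) :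
    Tendsto (fun N => ∫ ω, f ⟨N, ω⟩ ∂(P N)) atTop (𝓝 0) := by
  have h1 : Tendsto (fun z => ‖f z‖ₑ) (whp P) (𝓝 0) := by
    have := hf.enorm
    simpa using this
  have h2 := tendsto_lintegral_of_tendsto_whp (P := P) (f := fun z => ‖f z‖ₑ) (C := C)
    (fun z => by
      rw [enorm_eq_nnnorm]
      exact_mod_cast hC z) h1
  rw [tendsto_zero_iff_enorm_tendsto_zero]
  exact tendsto_of_tendsto_of_tendsto_of_le_of_le tendsto_const_nhds h2 (fun _ => zero_le)
      (fun N => enorm_integral_le_lintegral_enorm _)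

end whp

/-! ### Independent samples: moment bounds and a quantitative central limit theorem -/

section iid
variable {S : Type*} [MeasurableSpace S]

lemma integrable_of_abs_le {μ : Measure S} [IsFiniteMeasure μ] {f : S → ℝ} (hf : Measurable f)
    {C : ℝ} (hC : ∀ x, |f x| ≤ C) : Integrable f μ :=
  Integrable.of_bound hf.aestronglyMeasurable C (ae_of_all _ hC)

lemma abs_integral_le_of_abs_le {μ : Measure S} [IsProbabilityMeasure μ] {f : S → ℝ}
    {C : ℝ} (hC : ∀ x, |f x| ≤ C) : |∫ x, f x ∂μ| ≤ C := by
  simpa using norm_integral_le_of_norm_le_const (μ := μ) (f := f) (C := C) (ae_of_all _ hC)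

lemma iIndepFun_eval_pi {N : ℕ} (μ : Measure S) [IsProbabilityMeasure μ] :
    iIndepFun (fun (i : Fin N) (u : Fin N → S) => u i) (Measure.pi fun _ : Fin N => μ) := by
  simpa using iIndepFun_pi (μ := fun _ : Fin N => μ) (X := fun _ => id) (fun _ => aemeasurable_id)

lemma map_pair_pi {N : ℕ} (μ : Measure S) [IsProbabilityMeasure μ] {i j : Fin N} (hij : i ≠ j) :
    (Measure.pi fun _ : Fin N => μ).map (fun u => (u i, u j)) = μ.prod μ := by
  have h := ((iIndepFun_eval_pi (N := N) μ).indepFun hij)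
  rw [indepFun_iff_map_prod_eq_prod_map_map (measurable_pi_apply i).aemeasurable
    (measurable_pi_apply j).aemeasurable] at h
  rw [h, (measurePreserving_eval (fun _ : Fin N => μ) i).map_eq,
    (measurePreserving_eval (fun _ : Fin N => μ) j).map_eq]

/-- The second moment of a centred V-statistic of order two is of order `1 / N`: among the `N ^ 4`
products of two summands, only those with a coincidence of indices can have a nonzero mean.
For `H` depending on its first argument only, this is the variance of an empirical mean. -/
lemma integral_sq_vstat_le (μ : Measure S) [IsProbabilityMeasure μ] {N : ℕ} (hN : 0 < N)
    {H : S × S → ℝ} (hH : Measurable H) {C : ℝ} (hC : ∀ x, |H x| ≤ C) :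
    ∫ u, ((N : ℝ)⁻¹ * (N : ℝ)⁻¹ * ∑ i, ∑ j, H (u i, u j) - ∫ z, H z ∂(μ.prod μ)) ^ 2
      ∂(Measure.pi fun _ : Fin N => μ) ≤ 20 * C ^ 2 / N := by
  set m := ∫ z, H z ∂(μ.prod μ) with hm
  set h : S × S → ℝ := fun z => H z - m with hh
  have hhm : Measurable h := hH.sub_const m
  have hmC : |m| ≤ C := abs_integral_le_of_abs_le hC
  have hhC : ∀ z, |h z| ≤ 2 * C := fun z => by
    have := abs_sub (H z) m
    have := hC z
    simp only [hh]; linarith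
  have hC0 : 0 ≤ C := (abs_nonneg m).trans hmC
  have hN' : (N : ℝ) ≠ 0 := by positivity
  set π := Measure.pi fun _ : Fin N => μ with hπ
  have hm0 : ∫ z, h z ∂(μ.prod μ) = 0 := by
    simp only [hh]
    rw [integral_sub (integrable_of_abs_le hH hC) (integrable_const _)]
    simp [hm]
  have hmean : ∀ i j : Fin N, i ≠ j → ∫ u, h (u i, u j) ∂π = 0 := fun i j hij => by
    rw [← hm0, ← map_pair_pi μ hij, integral_map (by fun_prop) (hhm.aestronglyMeasurable)]
  have hprodC : ∀ (i j k l : Fin N) (u : Fin N → S),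
      |h (u i, u j) * h (u k, u l)| ≤ 4 * C ^ 2 := fun i j k l u => by
    rw [abs_mul]
    nlinarith [hhC (u i, u j), hhC (u k, u l), abs_nonneg (h (u i, u j)),
      abs_nonneg (h (u k, u l))]
  -- if `i`, `j` are distinct and disjoint from `k`, `l`, then the two factors are independent
  have hterm : ∀ i j k l : Fin N, ∫ u, h (u i, u j) * h (u k, u l) ∂π ≤
      4 * C ^ 2 * ((if i = j then 1 else 0) + (if i = k then 1 else 0) + (if i = l then 1 else 0)
        + (if j = k then 1 else 0) + (if j = l then 1 else 0)) := by
    intro i j k l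
    by_cases hgood : i ≠ j ∧ i ≠ k ∧ i ≠ l ∧ j ≠ k ∧ j ≠ l
    · obtain ⟨hij, hik, hil, hjk, hjl⟩ := hgood
      have hind := ((iIndepFun_eval_pi (N := N) μ).indepFun_prodMk_prodMk
        (fun i => measurable_pi_apply i) i j k l hik hil hjk hjl).comp hhm hhm
      have := hind.integral_fun_mul_eq_mul_integral
        (hhm.comp (by fun_prop)).aestronglyMeasurable
        (hhm.comp (by fun_prop)).aestronglyMeasurable
      simp only [Function.comp_def] at this
      rw [this, hmean i j hij]
      simp [hij, hik, hil, hjk, hjl]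
    · have h1 : ∫ u, h (u i, u j) * h (u k, u l) ∂π ≤ 4 * C ^ 2 :=
        (le_abs_self _).trans (abs_integral_le_of_abs_le (hprodC i j k l))
      have h2 : (1 : ℝ) ≤ (if i = j then 1 else 0) + (if i = k then 1 else 0)
          + (if i = l then 1 else 0) + (if j = k then 1 else 0) + (if j = l then 1 else 0) := by
        split_ifs <;> first
          | (exfalso; apply hgood; simp only [*, ne_eq, not_false_eq_true, and_self]; done)
          | norm_num
      nlinarith [sq_nonneg C]
  have hint : ∀ i j k l : Fin N, Integrable (fun u => h (u i, u j) * h (u k, u l)) π :=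
    fun i j k l => integrable_of_abs_le (by fun_prop) (hprodC i j k l)
  have hexp : ∀ u : Fin N → S,
      ((N : ℝ)⁻¹ * (N : ℝ)⁻¹ * ∑ i, ∑ j, H (u i, u j) - m) ^ 2 =
        ((N : ℝ)⁻¹) ^ 4 * ∑ i, ∑ j, ∑ k, ∑ l, h (u i, u j) * h (u k, u l) := by
    intro u
    have h1 : (N : ℝ)⁻¹ * (N : ℝ)⁻¹ * ∑ i, ∑ j, H (u i, u j) - m =
        (N : ℝ)⁻¹ * (N : ℝ)⁻¹ * ∑ i, ∑ j, h (u i, u j) := by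
      simp only [hh, Finset.sum_sub_distrib, Finset.sum_const, Finset.card_univ, Fintype.card_fin,
        nsmul_eq_mul]
      field_simp
    have h2 : ∑ i, ∑ j, ∑ k, ∑ l, h (u i, u j) * h (u k, u l) =
        (∑ i, ∑ j, h (u i, u j)) * ∑ i, ∑ j, h (u i, u j) := by
      simp only [← Finset.mul_sum, ← Finset.sum_mul]
    rw [h1, h2]
    ring
  simp_rw [hexp]
  rw [integral_const_mul, integral_finsetSum _ fun i _ => integrable_finsetSum _ fun j _ =>
    integrable_finsetSum _ fun k _ => integrable_finsetSum _ fun l _ => hint i j k l]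
  have hsum : ∑ i, ∫ u, ∑ j, ∑ k, ∑ l, h (u i, u j) * h (u k, u l) ∂π ≤ 20 * C ^ 2 * N ^ 3 := by
    calc _ = ∑ i, ∑ j, ∑ k, ∑ l, ∫ u, h (u i, u j) * h (u k, u l) ∂π := by
          refine Finset.sum_congr rfl fun i _ => ?_
          rw [integral_finsetSum _ fun j _ => integrable_finsetSum _ fun k _ =>
            integrable_finsetSum _ fun l _ => hint i j k l]
          refine Finset.sum_congr rfl fun j _ => ?_
          rw [integral_finsetSum _ fun k _ => integrable_finsetSum _ fun l _ => hint i j k l]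
          refine Finset.sum_congr rfl fun k _ => ?_
          rw [integral_finsetSum _ fun l _ => hint i j k l]
      _ ≤ ∑ i : Fin N, ∑ j : Fin N, ∑ k : Fin N, ∑ l : Fin N, _ :=
          Finset.sum_le_sum fun i _ => Finset.sum_le_sum fun j _ => Finset.sum_le_sum fun k _ =>
            Finset.sum_le_sum fun l _ => hterm i j k l
      _ = 20 * C ^ 2 * N ^ 3 := by
          simp only [← Finset.mul_sum, Finset.sum_add_distrib, Finset.sum_ite_eq, Finset.mem_univ,
            if_true, Finset.sum_const, Finset.card_univ, Fintype.card_fin, nsmul_eq_mul]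
          ring
  calc _ ≤ ((N : ℝ)⁻¹) ^ 4 * (20 * C ^ 2 * N ^ 3) := by gcongr
    _ = 20 * C ^ 2 / N := by field_simp

lemma norm_exp_sub_quadratic_le {y : ℝ} (hy : |y| ≤ 1) :
    ‖Complex.exp (y * Complex.I) - (1 + y * Complex.I - (y : ℂ) ^ 2 / 2)‖ ≤ |y| ^ 3 := by
  have h := Complex.exp_bound (x := y * Complex.I) (by simpa using hy) (n := 3) (by norm_num)
  have h2 : ∑ m ∈ Finset.range 3, ((y : ℂ) * Complex.I) ^ m / (m.factorial : ℂ) =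
      1 + y * Complex.I - (y : ℂ) ^ 2 / 2 := by
    simp [Finset.sum_range_succ, mul_pow, Nat.factorial]
    ring
  rw [h2] at h
  refine h.trans ?_
  simp only [norm_mul, Complex.norm_real, Complex.norm_I, mul_one, Real.norm_eq_abs]
  have : (0 : ℝ) ≤ |y| ^ 3 := by positivity
  norm_num [Nat.factorial]
  nlinarith

lemma norm_pow_sub_pow_le_of_norm_le_one {a b : ℂ} (ha : ‖a‖ ≤ 1) (hb : ‖b‖ ≤ 1) (n : ℕ) :
    ‖a ^ n - b ^ n‖ ≤ n * ‖a - b‖ := by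
  induction n with
  | zero => simp
  | succ n ih =>
    have : a ^ (n + 1) - b ^ (n + 1) = a * (a ^ n - b ^ n) + (a - b) * b ^ n := by ring
    rw [this]
    refine (norm_add_le _ _).trans ?_
    rw [norm_mul, norm_mul, norm_pow]
    have h1 : ‖a‖ * ‖a ^ n - b ^ n‖ ≤ ‖a ^ n - b ^ n‖ :=
      mul_le_of_le_one_left (norm_nonneg _) ha
    have h2 : ‖a - b‖ * ‖b‖ ^ n ≤ ‖a - b‖ :=
      mul_le_of_le_one_right (norm_nonneg _) (pow_le_one₀ (norm_nonneg _) hb)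
    push_cast
    linarith

/-- A quantitative central limit theorem for one bounded, centred variable. -/
lemma norm_charFun_pow_sub_le (μ : Measure S) [IsProbabilityMeasure μ] {f : S → ℝ}
    (hf : Measurable f) {C : ℝ} (hC : ∀ x, |f x| ≤ C) (h0 : ∫ x, f x ∂μ = 0) (s : ℝ)
    (hs : |s| * C ≤ 1) (n : ℕ) :
    ‖(∫ x, Complex.exp ((s * f x : ℝ) * Complex.I) ∂μ) ^ n -
      Complex.exp (((-(n * s ^ 2 * ∫ x, f x ^ 2 ∂μ) / 2 : ℝ) : ℂ))‖ ≤ 2 * n * (|s| * C) ^ 3 := by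
  set V := ∫ x, f x ^ 2 ∂μ with hV
  have hC0 : 0 ≤ C := (abs_nonneg _).trans (abs_integral_le_of_abs_le (μ := μ) hC)
  have hsC : 0 ≤ |s| * C := by positivity
  have hV0 : 0 ≤ V := integral_nonneg fun x => sq_nonneg _
  have hf2C : ∀ x, |f x ^ 2| ≤ C ^ 2 := fun x => by
    rw [abs_pow]
    exact pow_le_pow_left₀ (abs_nonneg _) (hC x) 2
  have hVC : V ≤ C ^ 2 := (le_abs_self _).trans (abs_integral_le_of_abs_le hf2C)
  set a := ∫ x, Complex.exp ((s * f x : ℝ) * Complex.I) ∂μ with ha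
  set b := Complex.exp ((-(s ^ 2 * V) / 2 : ℝ) : ℂ) with hb
  have hb' : b ^ n = Complex.exp (((-(n * s ^ 2 * V) / 2 : ℝ) : ℂ)) := by
    rw [hb, ← Complex.exp_nat_mul]
    congr 1
    push_cast
    ring
  rw [← hb']
  have ha1 : ‖a‖ ≤ 1 := by
    refine (norm_integral_le_integral_norm _).trans ?_
    simp_rw [Complex.norm_exp_ofReal_mul_I]
    simp
  have hb1 : ‖b‖ ≤ 1 := by
    rw [hb, Complex.norm_exp_ofReal]
    rw [Real.exp_le_one_iff]
    have : 0 ≤ s ^ 2 * V := by positivity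
    linarith
  have hq : ∫ x, (1 + ((s * f x : ℝ) : ℂ) * Complex.I - ((s * f x : ℝ) : ℂ) ^ 2 / 2) ∂μ =
      ((1 - s ^ 2 * V / 2 : ℝ) : ℂ) := by
    have e : ∀ x, (1 + ((s * f x : ℝ) : ℂ) * Complex.I - ((s * f x : ℝ) : ℂ) ^ 2 / 2) =
        ((1 - s ^ 2 / 2 * f x ^ 2 : ℝ) : ℂ) + ((f x : ℝ) : ℂ) * (s * Complex.I) := fun x => by
      push_cast; ring
    simp_rw [e]
    have i1 : Integrable (fun x => 1 - s ^ 2 / 2 * f x ^ 2) μ :=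
      (integrable_const _).sub ((integrable_of_abs_le (hf.pow_const 2) hf2C).const_mul _)
    have i2 : Integrable f μ := integrable_of_abs_le hf hC
    rw [integral_add i1.ofReal (i2.ofReal.mul_const _), integral_mul_const]
    rw [integral_complex_ofReal, integral_complex_ofReal, h0, integral_sub (integrable_const _)
      ((integrable_of_abs_le (hf.pow_const 2) hf2C).const_mul _), integral_const_mul]
    simp [← hV]
    ring
  have hsf : ∀ x, |s * f x| ≤ |s| * C := fun x => by
    rw [abs_mul]
    exact mul_le_mul_of_nonneg_left (hC x) (abs_nonneg _)
  -- both `a` and `b` are compared with the quadratic Taylor polynomial `1 - s² V / 2`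
  have hab1 : ‖a - ((1 - s ^ 2 * V / 2 : ℝ) : ℂ)‖ ≤ (|s| * C) ^ 3 := by
    rw [← hq, ha, ← integral_sub]
    · have := norm_integral_le_of_norm_le_const (μ := μ) (C := (|s| * C) ^ 3)
        (f := fun x => Complex.exp ((s * f x : ℝ) * Complex.I) -
          (1 + ((s * f x : ℝ) : ℂ) * Complex.I - ((s * f x : ℝ) : ℂ) ^ 2 / 2))
        (ae_of_all _ fun x => (norm_exp_sub_quadratic_le ((hsf x).trans hs)).trans
          (pow_le_pow_left₀ (abs_nonneg _) (hsf x) 3))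
      simpa using this
    · refine Integrable.of_bound (by fun_prop) 1 (ae_of_all _ fun x => ?_)
      rw [Complex.norm_exp_ofReal_mul_I]
    · refine Integrable.of_bound (by fun_prop) (1 + 1 + 1) (ae_of_all _ fun x => ?_)
      have h1 : |s * f x| ≤ 1 := (hsf x).trans hs
      refine (norm_sub_le _ _).trans (add_le_add ((norm_add_le _ _).trans
        (add_le_add (by simp) ?_)) ?_)
      · rw [norm_mul, Complex.norm_I, mul_one, Complex.norm_real]; exact h1
      · rw [norm_div, norm_pow, Complex.norm_real, Real.norm_eq_abs]
        have : |s * f x| ^ 2 ≤ 1 := pow_le_one₀ (abs_nonneg _) h1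
        simp only [Complex.norm_ofNat]
        linarith
  have hab2 : ‖b - ((1 - s ^ 2 * V / 2 : ℝ) : ℂ)‖ ≤ (|s| * C) ^ 3 := by
    have hy0 : 0 ≤ s ^ 2 * V / 2 := by positivity
    have hy : s ^ 2 * V / 2 ≤ (|s| * C) ^ 2 := by
      rw [mul_pow, sq_abs]
      nlinarith [sq_nonneg s, mul_le_mul_of_nonneg_left hVC (sq_nonneg s)]
    have hy1 : |(-(s ^ 2 * V) / 2)| ≤ 1 := by
      rw [neg_div, abs_neg, abs_of_nonneg hy0]
      exact hy.trans (pow_le_one₀ hsC hs)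
    rw [hb, ← Complex.ofReal_exp, ← Complex.ofReal_sub, Complex.norm_real, Real.norm_eq_abs]
    have h3 := Real.abs_exp_sub_one_sub_id_le hy1
    have e : Real.exp (-(s ^ 2 * V) / 2) - (1 - s ^ 2 * V / 2) =
      Real.exp (-(s ^ 2 * V) / 2) - 1 - -(s ^ 2 * V) / 2 := by ring
    rw [e]
    refine h3.trans ?_
    have e2 : (-(s ^ 2 * V) / 2) ^ 2 = (s ^ 2 * V / 2) ^ 2 := by ring
    rw [e2]
    calc (s ^ 2 * V / 2) ^ 2 ≤ ((|s| * C) ^ 2) ^ 2 := pow_le_pow_left₀ hy0 hy 2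
      _ = (|s| * C) ^ 3 * (|s| * C) := by ring
      _ ≤ (|s| * C) ^ 3 := mul_le_of_le_one_right (by positivity) hs
  have hab : ‖a - b‖ ≤ 2 * (|s| * C) ^ 3 := by
    have : a - b = (a - ((1 - s ^ 2 * V / 2 : ℝ) : ℂ)) - (b - ((1 - s ^ 2 * V / 2 : ℝ) : ℂ)) := by
      ring
    rw [this]
    refine (norm_sub_le _ _).trans ?_
    linarith
  refine (norm_pow_sub_pow_le_of_norm_le_one ha1 hb1 n).trans ?_
  have : (0 : ℝ) ≤ n := by positivity
  nlinarith

/-- The characteristic function of a sum over an i.i.d. sample. -/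
lemma integral_exp_sum_pi (μ : Measure S) [IsProbabilityMeasure μ] {N : ℕ} (f : S → ℝ) :
    ∫ u, Complex.exp ((∑ i, f (u i) : ℝ) * Complex.I) ∂(Measure.pi fun _ : Fin N => μ) =
      (∫ x, Complex.exp ((f x : ℝ) * Complex.I) ∂μ) ^ N := by
  have h := integral_fintype_prod_eq_pow (ι := Fin N) (μ := μ)
    (fun x => Complex.exp ((f x : ℝ) * Complex.I))
  rw [Fintype.card_fin] at h
  rw [← h]
  refine integral_congr_ae (ae_of_all _ fun u => ?_)
  simp only
  rw [← Complex.exp_sum]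
  push_cast
  rw [Finset.sum_mul]

end iid

variable {X S : Type*} [MeasurableSpace X] [MeasurableSpace S]

/-! ### The particle chain and its last configuration -/

section chain

lemma integral_bind_kernel {T F : Type*} [MeasurableSpace T] [NormedAddCommGroup F]
    [NormedSpace ℝ F] {μ : Measure S} [SFinite μ] {κ : Kernel S T} [IsSFiniteKernel κ] {f : T → F}
    (hf : Integrable f (μ.bind κ)) : ∫ y, f y ∂(μ.bind κ) = ∫ x, ∫ y, f y ∂(κ x) ∂μ := by
  rw [← Measure.snd_compProd, Measure.snd] at hf ⊢
  rw [integral_map measurable_snd.aemeasurable hf.aestronglyMeasurable]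
  exact Measure.integral_compProd ((integrable_map_measure hf.aestronglyMeasurable
    measurable_snd.aemeasurable).1 hf)

/-- A configuration survives if some first and some second component has positive weight. -/
def Survives {N : ℕ} (g : X → ℝ≥0) (u : Fin N → X × X) : Prop :=
  (∃ i, 0 < g (u i).1) ∧ ∃ i, 0 < g (u i).2

lemma measurableSet_survives {N : ℕ} {g : X → ℝ≥0} (hg : Measurable g) :
    MeasurableSet {u : Fin N → X × X | Survives g u} := by
  have h1 : MeasurableSet {x | 0 < g x} := measurableSet_lt measurable_const hg
  have : {u : Fin N → X × X | Survives g u} =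
      (⋃ i, {u | (u i).1 ∈ {x | 0 < g x}}) ∩ ⋃ i, {u | (u i).2 ∈ {x | 0 < g x}} := by
    ext u
    simp [Survives]
  rw [this]
  refine (MeasurableSet.iUnion fun i => ?_).inter (MeasurableSet.iUnion fun i => ?_)
  · exact h1.preimage (by fun_prop : Measurable fun u : Fin N → X × X => (u i).1)
  · exact h1.preimage (by fun_prop : Measurable fun u : Fin N → X × X => (u i).2)

lemma stepLaw_of_survives {N : ℕ} {g : X → ℝ≥0} {Ψ : (Fin N → X × X) → Measure (X × X)}
    {R : Kernel (Fin N → X × X) (Fin N → X × X)} {u : Fin N → X × X} (h : Survives g u) :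
    stepLaw g Ψ R u = Measure.pi fun _ => Ψ u := if_pos h

lemma stepLaw_of_not_survives {N : ℕ} {g : X → ℝ≥0} {Ψ : (Fin N → X × X) → Measure (X × X)}
    {R : Kernel (Fin N → X × X) (Fin N → X × X)} {u : Fin N → X × X} (h : ¬ Survives g u) :
    stepLaw g Ψ R u = R u := if_neg h

lemma measurable_pi_measure {N : ℕ} {T : Type*} [MeasurableSpace T] {Ψ : T → Measure S}
    [∀ u, IsProbabilityMeasure (Ψ u)] (hΨ : Measurable Ψ) :
    Measurable fun u => Measure.pi fun _ : Fin N => Ψ u := by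
  refine Measurable.measure_of_isPiSystem_of_isProbabilityMeasure generateFrom_pi.symm
    isPiSystem_pi ?_
  rintro _ ⟨t, ht, rfl⟩
  simp_rw [Measure.pi_pi]
  exact Finset.measurable_prod _ fun i _ =>
    Measure.measurable_measure.1 hΨ (t i) (ht i (Set.mem_univ i))

/-- A rule `Ψ p` for sampling the pairs at time `p + 1` from a configuration at time `p`
depends measurably on the configuration, and is a probability measure unless extinction occurs. -/
structure IsSamplingRule {N : ℕ} (G : ℕ → X → ℝ≥0)
    (Ψ : ℕ → (Fin N → X × X) → Measure (X × X)) : Prop where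
  measurable : ∀ p, Measurable (Ψ p)
  isProbabilityMeasure : ∀ p u, Survives (G p) u → IsProbabilityMeasure (Ψ p u)

lemma measurable_stepLaw {N : ℕ} {g : X → ℝ≥0} (hg : Measurable g) [Nonempty X]
    {Ψ : (Fin N → X × X) → Measure (X × X)} (hm : Measurable Ψ)
    (hp : ∀ u, Survives g u → IsProbabilityMeasure (Ψ u))
    (R : Kernel (Fin N → X × X) (Fin N → X × X)) :
    Measurable (stepLaw g Ψ R) := by
  classical
  obtain ⟨x⟩ := ‹Nonempty X›
  -- a point mass replaces `Ψ u` after extinction, so that the products are measurable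
  set Ψ' : (Fin N → X × X) → Measure (X × X) :=
    fun u => if Survives g u then Ψ u else Measure.dirac (x, x) with hΨ'
  have hm' : Measurable Ψ' := Measurable.ite (measurableSet_survives hg) hm measurable_const
  have : ∀ u, IsProbabilityMeasure (Ψ' u) := fun u => by
    by_cases h : Survives g u
    · simp only [hΨ', h, if_true]; exact hp u h
    · simp only [hΨ', h, if_false]; infer_instance
  have e : stepLaw g Ψ R = fun u => if Survives g u then Measure.pi fun _ => Ψ' u else R u := by
    funext u
    by_cases h : Survives g u
    · simp [stepLaw_of_survives h, h, hΨ']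
    · simp [stepLaw_of_not_survives h, h]
  rw [e]
  exact Measurable.ite (measurableSet_survives hg) (measurable_pi_measure hm') R.measurable

lemma isProbabilityMeasure_stepLaw {N : ℕ} {g : X → ℝ≥0}
    {Ψ : (Fin N → X × X) → Measure (X × X)}
    (hp : ∀ u, Survives g u → IsProbabilityMeasure (Ψ u))
    (R : Kernel (Fin N → X × X) (Fin N → X × X)) [IsMarkovKernel R] (u : Fin N → X × X) :
    IsProbabilityMeasure (stepLaw g Ψ R u) := by
  by_cases h : Survives g u
  · have := hp u h
    rw [stepLaw_of_survives h]; infer_instance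
  · rw [stepLaw_of_not_survives h]; infer_instance

/-- The law of the configuration at time `n`. -/
def lastLaw {N : ℕ} (G : ℕ → X → ℝ≥0) (μ₀ : Measure (X × X))
    (Ψ : ℕ → (Fin N → X × X) → Measure (X × X))
    (R : ℕ → Kernel (Fin N → X × X) (Fin N → X × X)) : ℕ → Measure (Fin N → X × X)
  | 0 => Measure.pi fun _ => μ₀
  | n + 1 => (lastLaw G μ₀ Ψ R n).bind (stepLaw (G n) (Ψ n) (R n))

variable {N : ℕ} {G : ℕ → X → ℝ≥0} {μ₀ : Measure (X × X)}
  {Ψ : ℕ → (Fin N → X × X) → Measure (X × X)}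
  {R : ℕ → Kernel (Fin N → X × X) (Fin N → X × X)}

lemma IsSamplingRule.measurable_stepLaw [Nonempty X] (hG : ∀ n, Measurable (G n))
    (hΨ : IsSamplingRule G Ψ) (n : ℕ) : Measurable (stepLaw (G n) (Ψ n) (R n)) :=
  CoupledPF.measurable_stepLaw (hG n) (hΨ.measurable n) (hΨ.isProbabilityMeasure n) (R n)

lemma isProbabilityMeasure_lastLaw [Nonempty X] [IsProbabilityMeasure μ₀]
    [∀ n, IsMarkovKernel (R n)] (hG : ∀ n, Measurable (G n))
    (hΨ : IsSamplingRule G Ψ) (n : ℕ) : IsProbabilityMeasure (lastLaw G μ₀ Ψ R n) := by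
  induction n with
  | zero => rw [lastLaw]; infer_instance
  | succ n ih =>
    rw [lastLaw]
    exact isProbabilityMeasure_bind (hΨ.measurable_stepLaw hG n).aemeasurable
      (ae_of_all _ fun u => isProbabilityMeasure_stepLaw (hΨ.isProbabilityMeasure n) _ u)

lemma measurable_snoc {n : ℕ} :
    Measurable fun q : (Fin (n + 1) → S) × S => Fin.snoc (α := fun _ => S) q.1 q.2 := by
  refine measurable_pi_iff.2 fun i => ?_
  induction i using Fin.lastCases with
  | last => simpa using measurable_snd
  | cast i => simpa using (by fun_prop : Measurable fun q : (Fin (n + 1) → S) × S => q.1 i)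

lemma measurable_snoc_right {n : ℕ} (h : Fin (n + 1) → S) :
    Measurable fun v : S => Fin.snoc (α := fun _ => S) h v :=
  measurable_snoc.comp measurable_prodMk_left

lemma measurable_stepLaw_map_snoc [Nonempty X]
    [∀ n, IsMarkovKernel (R n)] (hG : ∀ n, Measurable (G n))
    (hΨ : IsSamplingRule G Ψ) (n : ℕ) :
    Measurable fun h : Fin (n + 1) → Fin N → X × X =>
      (stepLaw (G n) (Ψ n) (R n) (h (Fin.last n))).map
        (fun v => Fin.snoc (α := fun _ => Fin N → X × X) h v) := by
  have := fun u => isProbabilityMeasure_stepLaw (hΨ.isProbabilityMeasure n) (R n) u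
  let κ : Kernel (Fin (n + 1) → Fin N → X × X) (Fin N → X × X) :=
    ⟨fun h => stepLaw (G n) (Ψ n) (R n) (h (Fin.last n)),
      (hΨ.measurable_stepLaw hG n).comp (measurable_pi_apply _)⟩
  have : IsMarkovKernel κ := ⟨fun h => this _⟩
  refine Measure.measurable_measure.2 fun B hB => ?_
  have e : ∀ h : Fin (n + 1) → Fin N → X × X,
      ((stepLaw (G n) (Ψ n) (R n) (h (Fin.last n))).map
        (fun v => Fin.snoc (α := fun _ => Fin N → X × X) h v)) B =
      κ h (Prod.mk h ⁻¹' ((fun q : (Fin (n + 1) → Fin N → X × X) × (Fin N → X × X) =>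
        Fin.snoc (α := fun _ => Fin N → X × X) q.1 q.2) ⁻¹' B)) := fun h => by
    rw [Measure.map_apply (measurable_snoc_right h) hB]
    rfl
  simp_rw [e]
  exact Kernel.measurable_kernel_prodMk_left (measurable_snoc hB)

lemma isProbabilityMeasure_particleLaw [Nonempty X] [IsProbabilityMeasure μ₀]
    [∀ n, IsMarkovKernel (R n)] (hG : ∀ n, Measurable (G n))
    (hΨ : IsSamplingRule G Ψ) (n : ℕ) : IsProbabilityMeasure (particleLaw G μ₀ Ψ R n) := by
  induction n with
  | zero =>
    rw [particleLaw]
    exact Measure.isProbabilityMeasure_map (by fun_prop)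
  | succ n ih =>
    rw [particleLaw]
    refine isProbabilityMeasure_bind (measurable_stepLaw_map_snoc hG hΨ n).aemeasurable
      (ae_of_all _ fun h => ?_)
    have := isProbabilityMeasure_stepLaw (hΨ.isProbabilityMeasure n) (R n) (h (Fin.last n))
    exact Measure.isProbabilityMeasure_map (measurable_snoc_right h).aemeasurable

/-- The scaled errors only depend on the last configuration, which is a Markov chain. -/
lemma map_last_particleLaw [Nonempty X] [IsProbabilityMeasure μ₀]
    [∀ n, IsMarkovKernel (R n)] (hG : ∀ n, Measurable (G n))
    (hΨ : IsSamplingRule G Ψ) (n : ℕ) :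
    (particleLaw G μ₀ Ψ R n).map (fun h => h (Fin.last n)) = lastLaw G μ₀ Ψ R n := by
  induction n with
  | zero =>
    rw [particleLaw, lastLaw, Measure.map_map (by fun_prop) (by fun_prop)]
    exact Measure.map_id
  | succ n ih =>
    have hlast : Measurable fun h : Fin (n + 1 + 1) → Fin N → X × X => h (Fin.last (n + 1)) :=
      measurable_pi_apply _
    ext B hB
    rw [Measure.map_apply hlast hB, particleLaw, Measure.bind_apply (hlast hB)
      (measurable_stepLaw_map_snoc hG hΨ n).aemeasurable, lastLaw, ← ih,
      Measure.bind_apply hB (hΨ.measurable_stepLaw hG n).aemeasurable,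
      lintegral_map (Measure.measurable_measure.1 (hΨ.measurable_stepLaw hG n) B hB)
        (measurable_pi_apply _)]
    refine lintegral_congr fun h => ?_
    rw [Measure.map_apply (measurable_snoc_right h) (hlast hB)]
    congr 1
    ext v
    simp

lemma integral_lastLaw_succ [Nonempty X] [IsProbabilityMeasure μ₀]
    [∀ n, IsMarkovKernel (R n)] (hG : ∀ n, Measurable (G n))
    (hΨ : IsSamplingRule G Ψ) (n : ℕ) {f : (Fin N → X × X) → ℂ} (hf : Measurable f)
    {C : ℝ} (hC : ∀ v, ‖f v‖ ≤ C) :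
    ∫ v, f v ∂(lastLaw G μ₀ Ψ R (n + 1)) =
      ∫ u, ∫ v, f v ∂(stepLaw (G n) (Ψ n) (R n) u) ∂(lastLaw G μ₀ Ψ R n) := by
  have := fun u => isProbabilityMeasure_stepLaw (hΨ.isProbabilityMeasure n) (R n) u
  have := isProbabilityMeasure_lastLaw (μ₀ := μ₀) (R := R) hG hΨ n
  have := isProbabilityMeasure_lastLaw (μ₀ := μ₀) (R := R) hG hΨ (n + 1)
  let κ : Kernel (Fin N → X × X) (Fin N → X × X) :=
    ⟨stepLaw (G n) (Ψ n) (R n), hΨ.measurable_stepLaw hG n⟩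
  have hκ : lastLaw G μ₀ Ψ R (n + 1) = κ ∘ₘ lastLaw G μ₀ Ψ R n := rfl
  have : IsMarkovKernel κ := ⟨fun u => ‹∀ u, IsProbabilityMeasure (stepLaw _ _ _ u)› u⟩
  have : IsProbabilityMeasure (κ ∘ₘ lastLaw G μ₀ Ψ R n) := hκ ▸ ‹_›
  rw [hκ]
  exact integral_bind_kernel (Integrable.of_bound hf.aestronglyMeasurable C (ae_of_all _ hC))

end chain

/-! ### Feynman-Kac flows and the backward recursion -/

section feynmanKac

/-- Bounded measurable real functions. -/
def BddMeas (φ : S → ℝ) : Prop := Measurable φ ∧ ∃ C : ℝ, ∀ x, |φ x| ≤ C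

namespace BddMeas
variable {φ ψ : S → ℝ}

lemma integrable (h : BddMeas φ) (μ : Measure S) [IsFiniteMeasure μ] : Integrable φ μ := by
  obtain ⟨hm, C, hC⟩ := h
  exact integrable_of_abs_le hm hC

lemma const (c : ℝ) : BddMeas fun _ : S => c := ⟨measurable_const, |c|, fun _ => le_rfl⟩

lemma add (h : BddMeas φ) (h' : BddMeas ψ) : BddMeas fun x => φ x + ψ x := by
  obtain ⟨hm, C, hC⟩ := h
  obtain ⟨hm', C', hC'⟩ := h'
  exact ⟨hm.add hm', C + C', fun x => (abs_add_le _ _).trans (add_le_add (hC x) (hC' x))⟩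

lemma sub (h : BddMeas φ) (h' : BddMeas ψ) : BddMeas fun x => φ x - ψ x := by
  obtain ⟨hm, C, hC⟩ := h
  obtain ⟨hm', C', hC'⟩ := h'
  exact ⟨hm.sub hm', C + C', fun x => (abs_sub _ _).trans (add_le_add (hC x) (hC' x))⟩

lemma mul (h : BddMeas φ) (h' : BddMeas ψ) : BddMeas fun x => φ x * ψ x := by
  obtain ⟨hm, C, hC⟩ := h
  obtain ⟨hm', C', hC'⟩ := h'
  refine ⟨hm.mul hm', C * C', fun x => ?_⟩
  rw [abs_mul]
  exact mul_le_mul (hC x) (hC' x) (abs_nonneg _) ((abs_nonneg _).trans (hC x))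

lemma div_const (h : BddMeas φ) (c : ℝ) : BddMeas fun x => φ x / c := by
  simp_rw [div_eq_mul_inv]
  exact h.mul (const _)

lemma pow_two (h : BddMeas φ) : BddMeas fun x => φ x ^ 2 := by
  simp_rw [_root_.pow_two]
  exact h.mul h

lemma comp {T : Type*} [MeasurableSpace T] (h : BddMeas φ) {f : T → S} (hf : Measurable f) :
    BddMeas fun x => φ (f x) := by
  obtain ⟨hm, C, hC⟩ := h
  exact ⟨hm.comp hf, C, fun x => hC _⟩

lemma of_nnreal {g : S → ℝ≥0} (hg : Measurable g) {C : ℝ≥0} (hC : ∀ x, g x ≤ C) :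
    BddMeas fun x => (g x : ℝ) :=
  ⟨by fun_prop, C, fun x => by simpa using hC x⟩

lemma integral_kernel {T : Type*} [MeasurableSpace T] (h : BddMeas φ) (κ : Kernel T S)
    [IsMarkovKernel κ] : BddMeas fun x => ∫ y, φ y ∂(κ x) := by
  obtain ⟨hm, C, hC⟩ := h
  exact ⟨(hm.stronglyMeasurable.integral_kernel (κ := κ)).measurable, C,
    fun x => abs_integral_le_of_abs_le hC⟩

end BddMeas

/-- The Feynman-Kac transition `μ ↦ μ(g M) / μ(g)` on probability measures. -/
def PhiS (g : X → ℝ≥0) (M : Kernel X X) (μ : Measure X) : Measure X :=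
  (∫⁻ x, (g x : ℝ≥0∞) ∂μ)⁻¹ • (μ.withDensity fun x => (g x : ℝ≥0∞)).bind M

variable {g : X → ℝ≥0} {M : Kernel X X} [IsMarkovKernel M] {μ : Measure X}

lemma lintegral_coe_ne_top [IsFiniteMeasure μ] (hg : ∃ C : ℝ≥0, ∀ x, g x ≤ C) :
    ∫⁻ x, (g x : ℝ≥0∞) ∂μ ≠ ∞ := by
  obtain ⟨C, hC⟩ := hg
  refine ne_top_of_le_ne_top (b := C * μ Set.univ) (by finiteness) ?_
  rw [← lintegral_const]
  exact lintegral_mono fun x => ENNReal.coe_le_coe.2 (hC x)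

lemma toReal_lintegral_coe (hgm : Measurable g) :
    (∫⁻ x, (g x : ℝ≥0∞) ∂μ).toReal = ∫ x, (g x : ℝ) ∂μ := by
  rw [integral_eq_lintegral_of_nonneg_ae (f := fun x => (g x : ℝ))
    (ae_of_all _ fun x => (g x).2)
    (by fun_prop)]
  simp

lemma integral_coe_pos [IsFiniteMeasure μ] (hgm : Measurable g) (hg : ∃ C : ℝ≥0, ∀ x, g x ≤ C)
    (h0 : ∫⁻ x, (g x : ℝ≥0∞) ∂μ ≠ 0) : 0 < ∫ x, (g x : ℝ) ∂μ := by
  rw [← toReal_lintegral_coe hgm]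
  exact ENNReal.toReal_pos h0 (lintegral_coe_ne_top hg)

lemma isProbabilityMeasure_PhiS [IsFiniteMeasure μ] (hg : ∃ C : ℝ≥0, ∀ x, g x ≤ C)
    (h0 : ∫⁻ x, (g x : ℝ≥0∞) ∂μ ≠ 0) : IsProbabilityMeasure (PhiS g M μ) := by
  constructor
  rw [PhiS, Measure.smul_apply, Measure.bind_apply MeasurableSet.univ (Kernel.aemeasurable _)]
  simp only [measure_univ, lintegral_const, one_mul, smul_eq_mul]
  rw [withDensity_apply _ MeasurableSet.univ, Measure.restrict_univ]
  exact ENNReal.inv_mul_cancel h0 (lintegral_coe_ne_top hg)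

lemma integral_PhiS [IsFiniteMeasure μ] (hgm : Measurable g) (hg : ∃ C : ℝ≥0, ∀ x, g x ≤ C)
    {φ : X → ℝ} (hφ : BddMeas φ) :
    ∫ x, φ x ∂(PhiS g M μ) = (∫ x, g x * ∫ y, φ y ∂(M x) ∂μ) / ∫ x, (g x : ℝ) ∂μ := by
  have : IsFiniteMeasure (μ.withDensity fun x => (g x : ℝ≥0∞)) :=
    isFiniteMeasure_withDensity (lintegral_coe_ne_top hg)
  rw [PhiS, integral_smul_measure, integral_bind_kernel (hφ.integrable _),
    integral_withDensity_eq_integral_smul hgm, ENNReal.toReal_inv, toReal_lintegral_coe hgm,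
    smul_eq_mul, inv_mul_eq_div]
  simp_rw [NNReal.smul_def, smul_eq_mul]

/-- The function `φ'` with `Φ(ν)(φ) - Φ(μ)(φ) ∝ ν(φ')` for the Feynman-Kac transition `Φ`. It
carries the fluctuations at time `n + 1` that stem from those at time `n`. -/
def backStep (g : X → ℝ≥0) (M : Kernel X X) (μ : Measure X) (φ : X → ℝ) (x : X) : ℝ :=
  g x * (∫ y, φ y ∂(M x) - ∫ y, φ y ∂(PhiS g M μ)) / ∫ y, (g y : ℝ) ∂μ

lemma BddMeas.backStep (hgm : Measurable g) (hg : ∃ C : ℝ≥0, ∀ x, g x ≤ C) {φ : X → ℝ}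
    (hφ : BddMeas φ) : BddMeas (backStep g M μ φ) := by
  obtain ⟨C, hC⟩ := hg
  exact ((of_nnreal hgm hC).mul ((hφ.integral_kernel M).sub (const _))).div_const _

/-- The error of one Feynman-Kac transition is the integral of the pulled back function, up to a
ratio of normalizing constants. -/
lemma integral_PhiS_sub [IsFiniteMeasure μ] {ν : Measure X} [IsFiniteMeasure ν]
    (hgm : Measurable g) (hg : ∃ C : ℝ≥0, ∀ x, g x ≤ C)
    (hμ : ∫⁻ x, (g x : ℝ≥0∞) ∂μ ≠ 0) (hν : ∫⁻ x, (g x : ℝ≥0∞) ∂ν ≠ 0)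
    {φ : X → ℝ} (hφ : BddMeas φ) :
    ∫ x, φ x ∂(PhiS g M ν) - ∫ x, φ x ∂(PhiS g M μ) =
      (∫ x, backStep g M μ φ x ∂ν) * ((∫ x, (g x : ℝ) ∂μ) / ∫ x, (g x : ℝ) ∂ν) := by
  have h1 := integral_coe_pos hgm hg hμ
  have h2 := integral_coe_pos hgm hg hν
  obtain ⟨C, hC⟩ := id hg
  have hgb := BddMeas.of_nnreal hgm hC
  have e : ∫ x, backStep g M μ φ x ∂ν = ((∫ x, g x * ∫ y, φ y ∂(M x) ∂ν) -
      (∫ x, (g x : ℝ) ∂ν) * ∫ y, φ y ∂(PhiS g M μ)) / ∫ y, (g y : ℝ) ∂μ := by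
    unfold backStep
    rw [integral_div]
    simp_rw [mul_sub]
    rw [integral_sub ((hgb.mul (hφ.integral_kernel M)).integrable ν)
      ((hgb.mul (BddMeas.const _)).integrable ν), integral_mul_const]
  rw [e, integral_PhiS (μ := ν) hgm hg hφ]
  field_simp

lemma integral_backStep [IsFiniteMeasure μ] (hgm : Measurable g) (hg : ∃ C : ℝ≥0, ∀ x, g x ≤ C)
    (hμ : ∫⁻ x, (g x : ℝ≥0∞) ∂μ ≠ 0) {φ : X → ℝ} (hφ : BddMeas φ) :
    ∫ x, backStep g M μ φ x ∂μ = 0 := by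
  have h := integral_PhiS_sub (M := M) hgm hg hμ hμ hφ
  have h1 := integral_coe_pos hgm hg hμ
  rw [sub_self, div_self h1.ne', mul_one] at h
  exact h.symm

variable {G : ℕ → X → ℝ≥0} {η₀ : Measure X} {Mk : ℕ → Kernel X X}

lemma isFiniteMeasure_gam [IsFiniteMeasure η₀] [∀ n, IsMarkovKernel (Mk n)]
    (hGb : ∀ n, ∃ C : ℝ≥0, ∀ x, G n x ≤ C) (n : ℕ) : IsFiniteMeasure (gam G η₀ Mk n) := by
  induction n with
  | zero => rw [gam]; infer_instance
  | succ n ih =>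
    rw [gam]
    have : IsFiniteMeasure ((gam G η₀ Mk n).withDensity fun x => (G n x : ℝ≥0∞)) :=
      isFiniteMeasure_withDensity (lintegral_coe_ne_top (hGb n))
    infer_instance

lemma gam_succ_univ [∀ n, IsMarkovKernel (Mk n)] (n : ℕ) :
    gam G η₀ Mk (n + 1) Set.univ = ∫⁻ x, (G n x : ℝ≥0∞) ∂(gam G η₀ Mk n) := by
  rw [gam, Measure.bind_apply MeasurableSet.univ (Kernel.aemeasurable _)]
  simp

lemma isProbabilityMeasure_eta [IsFiniteMeasure η₀] [∀ n, IsMarkovKernel (Mk n)]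
    (hGb : ∀ n, ∃ C : ℝ≥0, ∀ x, G n x ≤ C) (hpos : ∀ n, 0 < gam G η₀ Mk n Set.univ) (n : ℕ) :
    IsProbabilityMeasure (eta G η₀ Mk n) := by
  have := isFiniteMeasure_gam (η₀ := η₀) (Mk := Mk) hGb n
  constructor
  rw [eta, Measure.smul_apply, smul_eq_mul]
  exact ENNReal.inv_mul_cancel (hpos n).ne' (measure_ne_top _ _)

lemma lintegral_eta_ne_zero [IsFiniteMeasure η₀] [∀ n, IsMarkovKernel (Mk n)]
    (hGb : ∀ n, ∃ C : ℝ≥0, ∀ x, G n x ≤ C) (hpos : ∀ n, 0 < gam G η₀ Mk n Set.univ) (n : ℕ) :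
    ∫⁻ x, (G n x : ℝ≥0∞) ∂(eta G η₀ Mk n) ≠ 0 := by
  have := isFiniteMeasure_gam (η₀ := η₀) (Mk := Mk) hGb n
  rw [eta, lintegral_smul_measure, ← gam_succ_univ, smul_eq_mul]
  exact mul_ne_zero (ENNReal.inv_ne_zero.2 (measure_ne_top _ _)) (hpos (n + 1)).ne'

lemma eta_zero [IsProbabilityMeasure η₀] : eta G η₀ Mk 0 = η₀ := by
  simp [eta, gam]

lemma eta_succ [IsFiniteMeasure η₀] [∀ n, IsMarkovKernel (Mk n)]
    (hGb : ∀ n, ∃ C : ℝ≥0, ∀ x, G n x ≤ C) (hpos : ∀ n, 0 < gam G η₀ Mk n Set.univ) (n : ℕ) :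
    eta G η₀ Mk (n + 1) = PhiS (G n) (Mk (n + 1)) (eta G η₀ Mk n) := by
  have := isFiniteMeasure_gam (η₀ := η₀) (Mk := Mk) hGb n
  have h1 : gam G η₀ Mk n Set.univ ≠ 0 := (hpos n).ne'
  have h2 : gam G η₀ Mk n Set.univ ≠ ∞ := measure_ne_top _ _
  rw [PhiS, eta, eta, lintegral_smul_measure, ← gam_succ_univ, withDensity_smul_measure,
    Measure.bind_smul, smul_smul, gam, smul_eq_mul]
  congr 1
  rw [ENNReal.mul_inv (Or.inl (ENNReal.inv_ne_zero.2 h2)) (Or.inl (ENNReal.inv_ne_top.2 h1)),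
    inv_inv, mul_comm, ← mul_assoc, ENNReal.inv_mul_cancel h1 h2, one_mul]

/-- The semigroup can also be unrolled at its end. -/
lemma Qop_succ_right (φ : X → ℝ) (k : ℕ) : ∀ p, Qop G Mk p (k + 1) φ =
    Qop G Mk p k fun x => G (p + k) x * ∫ y, φ y ∂(Mk (p + k + 1) x) := by
  induction k with
  | zero => intro p; rfl
  | succ k ih =>
    intro p
    have := ih (p + 1)
    rw [show p + 1 + k = p + (k + 1) by ring] at this
    funext x
    rw [Qop, this]
    rfl

lemma Qop_div_const (φ : X → ℝ) (c : ℝ) (k : ℕ) : ∀ p, Qop G Mk p k (fun x => φ x / c) =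
    fun x => Qop G Mk p k φ x / c := by
  induction k with
  | zero => intro p; rfl
  | succ k ih =>
    intro p
    funext x
    simp only [Qop]
    rw [ih (p + 1), integral_div, mul_div_assoc]

lemma integral_gam_succ [IsFiniteMeasure η₀] [∀ n, IsMarkovKernel (Mk n)]
    (hGm : ∀ n, Measurable (G n)) (hGb : ∀ n, ∃ C : ℝ≥0, ∀ x, G n x ≤ C) {φ : X → ℝ}
    (hφ : BddMeas φ) (n : ℕ) :
    ∫ x, φ x ∂(gam G η₀ Mk (n + 1)) =
      ∫ x, G n x * ∫ y, φ y ∂(Mk (n + 1) x) ∂(gam G η₀ Mk n) := by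
  have := isFiniteMeasure_gam (η₀ := η₀) (Mk := Mk) hGb n
  have : IsFiniteMeasure ((gam G η₀ Mk n).withDensity fun x => (G n x : ℝ≥0∞)) :=
    isFiniteMeasure_withDensity (lintegral_coe_ne_top (hGb n))
  rw [gam, integral_bind_kernel (hφ.integrable _), integral_withDensity_eq_integral_smul (hGm n)]
  simp_rw [NNReal.smul_def, smul_eq_mul]

lemma integral_Qop_gam [IsFiniteMeasure η₀] [∀ n, IsMarkovKernel (Mk n)]
    (hGm : ∀ n, Measurable (G n)) (hGb : ∀ n, ∃ C : ℝ≥0, ∀ x, G n x ≤ C) {φ : X → ℝ}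
    (hφ : BddMeas φ) (k p : ℕ) :
    ∫ x, Qop G Mk p k φ x ∂(gam G η₀ Mk p) = ∫ x, φ x ∂(gam G η₀ Mk (p + k)) := by
  induction k generalizing φ with
  | zero => rfl
  | succ k ih =>
    obtain ⟨C, hC⟩ := hGb (p + k)
    rw [Qop_succ_right, ih ((BddMeas.of_nnreal (hGm _) hC).mul (hφ.integral_kernel _)),
      ← integral_gam_succ hGm hGb hφ (p + k)]
    rfl

lemma integral_eta (φ : X → ℝ) (n : ℕ) : ∫ x, φ x ∂(eta G η₀ Mk n) =
    (∫ x, φ x ∂(gam G η₀ Mk n)) / (gam G η₀ Mk n).real Set.univ := by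
  rw [eta, integral_smul_measure, ENNReal.toReal_inv, smul_eq_mul, inv_mul_eq_div]
  rfl

lemma Dop_self [IsFiniteMeasure η₀] [∀ n, IsMarkovKernel (Mk n)]
    (hGb : ∀ n, ∃ C : ℝ≥0, ∀ x, G n x ≤ C) (hpos : ∀ n, 0 < gam G η₀ Mk n Set.univ) (n : ℕ)
    (φ : X → ℝ) (x : X) : Dop G η₀ Mk n n φ x = φ x - ∫ z, φ z ∂(eta G η₀ Mk n) := by
  have := isProbabilityMeasure_eta hGb hpos n
  simp [Dop, Qop]

/-- The operators `D_{p,n}` satisfy a one-step recursion at their end point, which is what makes an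
induction over the time horizon possible. -/
lemma Dop_succ [IsFiniteMeasure η₀] [∀ n, IsMarkovKernel (Mk n)]
    (hGm : ∀ n, Measurable (G n)) (hGb : ∀ n, ∃ C : ℝ≥0, ∀ x, G n x ≤ C)
    (hpos : ∀ n, 0 < gam G η₀ Mk n Set.univ) {p n : ℕ} (hpn : p ≤ n) {φ : X → ℝ}
    (hφ : BddMeas φ) : Dop G η₀ Mk p (n + 1) φ =
      Dop G η₀ Mk p n (backStep (G n) (Mk (n + 1)) (eta G η₀ Mk n) φ) := by
  have i1 := isProbabilityMeasure_eta (Mk := Mk) (η₀ := η₀) hGb hpos n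
  have h0 := lintegral_eta_ne_zero (Mk := Mk) (η₀ := η₀) hGb hpos n
  have i2 := fun n => isFiniteMeasure_gam (η₀ := η₀) (Mk := Mk) hGb n
  obtain ⟨C, hC⟩ := id (hGb n)
  have hgb := BddMeas.of_nnreal (hGm n) hC
  obtain ⟨k, rfl⟩ := Nat.exists_eq_add_of_le hpn
  funext x
  unfold Dop
  rw [integral_backStep (hGm (p + k)) (hGb (p + k)) h0 hφ]
  simp only [sub_zero, add_tsub_cancel_left, show p + k + 1 - p = k + 1 by omega]
  rw [Qop_succ_right, Qop_succ_right]
  have e1 : ∀ x, ∫ y, (φ y - ∫ z, φ z ∂(eta G η₀ Mk (p + k + 1))) ∂(Mk (p + k + 1) x) =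
      ∫ y, φ y ∂(Mk (p + k + 1) x) - ∫ z, φ z ∂(eta G η₀ Mk (p + k + 1)) := fun x => by
    rw [integral_sub (hφ.integrable _) (integrable_const _)]
    simp
  simp_rw [e1]
  have e2 : backStep (G (p + k)) (Mk (p + k + 1)) (eta G η₀ Mk (p + k)) φ = fun x =>
      (G (p + k) x * (∫ y, φ y ∂(Mk (p + k + 1) x) - ∫ z, φ z ∂(eta G η₀ Mk (p + k + 1)))) /
        ∫ y, (G (p + k) y : ℝ) ∂(eta G η₀ Mk (p + k)) := by
    funext x
    rw [backStep, eta_succ hGb hpos]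
  rw [e2, Qop_div_const]
  simp only [integral_const, probReal_univ, smul_eq_mul, mul_one]
  rw [integral_eta _ p, integral_eta _ p, integral_eta _ (p + k), integral_Qop_gam hGm hGb hgb,
    integral_Qop_gam hGm hGb (BddMeas.const 1)]
  have h1 : (gam G η₀ Mk (p + k)).real Set.univ ≠ 0 :=
    (ENNReal.toReal_pos (hpos _).ne' (measure_ne_top _ _)).ne'
  have h2 : (gam G η₀ Mk p).real Set.univ ≠ 0 :=
    (ENNReal.toReal_pos (hpos _).ne' (measure_ne_top _ _)).ne'
  have h3 : ∫ x, (G (p + k) x : ℝ) ∂(gam G η₀ Mk (p + k)) ≠ 0 := by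
    have := integral_coe_pos (hGm (p + k)) (hGb (p + k)) h0
    rw [integral_eta] at this
    intro h
    rw [h] at this
    simp at this
  simp only [integral_const, smul_eq_mul, mul_one]
  field_simp

end feynmanKac

/-! ### Empirical measures of coupled particle systems -/

section empirical

variable {N : ℕ}

lemma lintegral_empirical (x : Fin N → S) {f : S → ℝ≥0∞} (hf : Measurable f) :
    ∫⁻ y, f y ∂(empirical x) = (N : ℝ≥0∞)⁻¹ * ∑ i, f (x i) := by
  simp [empirical, lintegral_dirac' _ hf]

lemma integral_empirical (x : Fin N → S) {f : S → ℝ} (hf : Measurable f) :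
    ∫ y, f y ∂(empirical x) = (N : ℝ)⁻¹ * ∑ i, f (x i) := by
  rw [empirical, integral_smul_measure, integral_finsetSum_measure fun i _ =>
    integrable_dirac' hf.stronglyMeasurable (by simp)]
  simp [integral_dirac' _ _ hf.stronglyMeasurable]

lemma isProbabilityMeasure_empirical (hN : 0 < N) (x : Fin N → S) :
    IsProbabilityMeasure (empirical x) := by
  constructor
  simp only [empirical, Measure.smul_apply, Measure.finsetSum_apply, measure_univ,
    Finset.sum_const, Finset.card_univ, Fintype.card_fin, nsmul_eq_mul, mul_one, smul_eq_mul]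
  exact ENNReal.inv_mul_cancel (by simpa using hN.ne') (by simp)

instance (x : Fin N → S) : IsFiniteMeasure (empirical x) := by
  rcases Nat.eq_zero_or_pos N with rfl | hN
  · simp only [empirical, Finset.univ_eq_empty, Finset.sum_empty, smul_zero]
    infer_instance
  · exact ⟨by simp [(isProbabilityMeasure_empirical hN x).measure_univ]⟩

lemma map_empirical {T : Type*} [MeasurableSpace T] (x : Fin N → S) {f : S → T}
    (hf : Measurable f) : (empirical x).map f = empirical fun i => f (x i) := by
  ext B hB
  rw [Measure.map_apply hf hB]
  simp only [empirical, Measure.smul_apply, Measure.finsetSum_apply,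
    Measure.dirac_apply' _ (hf hB), Measure.dirac_apply' _ hB]
  rfl

lemma Survives.pos {g : X → ℝ≥0} {u : Fin N → X × X} (h : Survives g u) : 0 < N := by
  obtain ⟨⟨i, -⟩, -⟩ := h
  exact i.pos

lemma lintegral_empirical_ne_zero_iff {g : S → ℝ≥0} (hg : Measurable g) (x : Fin N → S) :
    ∫⁻ y, (g y : ℝ≥0∞) ∂(empirical x) ≠ 0 ↔ ∃ i, 0 < g (x i) := by
  rw [lintegral_empirical x (by fun_prop)]
  simp [pos_iff_ne_zero]

lemma survives_iff {g : X → ℝ≥0} (hg : Measurable g) (u : Fin N → X × X) : Survives g u ↔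
    ∫⁻ y, (g y : ℝ≥0∞) ∂(empirical fun i => (u i).1) ≠ 0 ∧
      ∫⁻ y, (g y : ℝ≥0∞) ∂(empirical fun i => (u i).2) ≠ 0 := by
  rw [lintegral_empirical_ne_zero_iff hg, lintegral_empirical_ne_zero_iff hg]
  rfl

end empirical

section lln

lemma meas_ge_le_integral_sq {P : Measure S} [IsFiniteMeasure P] {f : S → ℝ} (hf : BddMeas f)
    (a : ℝ) {δ : ℝ} (hδ : 0 < δ) :
    P {x | ¬ |f x - a| < δ} ≤ ENNReal.ofReal ((∫ x, (f x - a) ^ 2 ∂P) / δ ^ 2) := by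
  have h := mul_meas_ge_le_integral_of_nonneg (μ := P) (f := fun x => (f x - a) ^ 2)
    (ae_of_all _ fun x => sq_nonneg _) ((hf.sub (BddMeas.const a)).pow_two.integrable P) (δ ^ 2)
  have e : {x | ¬ |f x - a| < δ} = {x | δ ^ 2 ≤ (f x - a) ^ 2} := by
    ext x
    simp only [not_lt, Set.mem_ofPred_eq]
    rw [← sq_abs (f x - a)]
    exact (pow_le_pow_iff_left₀ hδ.le (abs_nonneg _) two_ne_zero).symm
  rw [e]
  refine ENNReal.le_ofReal_iff_toReal_le (measure_ne_top _ _) (by positivity) |>.2 ?_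
  rw [le_div_iff₀ (by positivity), mul_comm]
  exact h

/-- The standing assumptions: two Feynman-Kac models with common potentials, couplings `η n` of
their predictors, and rules `Ψ N p` that sample the pairs at time `p + 1` from couplings of the
Feynman-Kac transitions of the two empirical measures at time `p`. -/
structure IsCoupledFilter (G : ℕ → X → ℝ≥0) (ηf ηc : Measure X) (Mf Mc : ℕ → Kernel X X)
    (η : ℕ → Measure (X × X)) (Ψ : ∀ N : ℕ, ℕ → (Fin N → X × X) → Measure (X × X)) : Prop where
  measurable_potential : ∀ n, Measurable (G n)
  bounded_potential : ∀ n, ∃ C : ℝ≥0, ∀ x, G n x ≤ C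
  isProb_f : IsProbabilityMeasure ηf
  isProb_c : IsProbabilityMeasure ηc
  isMarkov_f : ∀ n, IsMarkovKernel (Mf n)
  isMarkov_c : ∀ n, IsMarkovKernel (Mc n)
  pos_f : ∀ n, 0 < gam G ηf Mf n Set.univ
  pos_c : ∀ n, 0 < gam G ηc Mc n Set.univ
  isCoupling : ∀ n, IsCoupling (η n) (eta G ηf Mf n) (eta G ηc Mc n)
  measurable_rule : ∀ N p, Measurable (Ψ N p)
  isCoupling_rule : ∀ (N p : ℕ) (u : Fin N → X × X), Survives (G p) u → IsCoupling (Ψ N p u)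
    (PhiS (G p) (Mf (p + 1)) (empirical fun i => (u i).1))
    (PhiS (G p) (Mc (p + 1)) (empirical fun i => (u i).2))

lemma IsCoupling.isProbabilityMeasure {μ : Measure (X × X)} {μ₁ μ₂ : Measure X}
    (h : IsCoupling μ μ₁ μ₂) [h₁ : IsProbabilityMeasure μ₁] : IsProbabilityMeasure μ := by
  rw [← h.1] at h₁
  exact (Measure.isProbabilityMeasure_map_iff measurable_fst.aemeasurable).1 h₁

lemma IsCoupling.integral_fst {μ : Measure (X × X)} {μ₁ μ₂ : Measure X}
    (h : IsCoupling μ μ₁ μ₂) {φ : X → ℝ} (hφ : Measurable φ) :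
    ∫ v, φ v.1 ∂μ = ∫ x, φ x ∂μ₁ := by
  rw [← h.1, integral_map measurable_fst.aemeasurable hφ.aestronglyMeasurable]

lemma IsCoupling.integral_snd {μ : Measure (X × X)} {μ₁ μ₂ : Measure X}
    (h : IsCoupling μ μ₁ μ₂) {φ : X → ℝ} (hφ : Measurable φ) :
    ∫ v, φ v.2 ∂μ = ∫ x, φ x ∂μ₂ := by
  rw [← h.2, integral_map measurable_snd.aemeasurable hφ.aestronglyMeasurable]

namespace IsCoupledFilter

variable {G : ℕ → X → ℝ≥0} {ηf ηc : Measure X} {Mf Mc : ℕ → Kernel X X}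
  {η : ℕ → Measure (X × X)} {Ψ : ∀ N : ℕ, ℕ → (Fin N → X × X) → Measure (X × X)}
  {R : ∀ N : ℕ, ℕ → Kernel (Fin N → X × X) (Fin N → X × X)}

lemma nonempty (h : IsCoupledFilter G ηf ηc Mf Mc η Ψ) : Nonempty X :=
  have := h.isProb_f
  ηf.nonempty_of_neZero

lemma isProb_eta_f (h : IsCoupledFilter G ηf ηc Mf Mc η Ψ) (n : ℕ) :
    IsProbabilityMeasure (eta G ηf Mf n) :=
  have := h.isProb_f
  have := h.isMarkov_f
  isProbabilityMeasure_eta h.bounded_potential h.pos_f n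

lemma isProb_eta_c (h : IsCoupledFilter G ηf ηc Mf Mc η Ψ) (n : ℕ) :
    IsProbabilityMeasure (eta G ηc Mc n) :=
  have := h.isProb_c
  have := h.isMarkov_c
  isProbabilityMeasure_eta h.bounded_potential h.pos_c n

lemma isProb_lim (h : IsCoupledFilter G ηf ηc Mf Mc η Ψ) (n : ℕ) :
    IsProbabilityMeasure (η n) :=
  have := h.isProb_eta_f n
  (h.isCoupling n).isProbabilityMeasure

lemma isProb_rule (h : IsCoupledFilter G ηf ηc Mf Mc η Ψ) {N p : ℕ} {u : Fin N → X × X}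
    (hu : Survives (G p) u) : IsProbabilityMeasure (Ψ N p u) :=
  have := h.isMarkov_f
  have := isProbabilityMeasure_PhiS (M := Mf (p + 1)) (h.bounded_potential p)
    ((survives_iff (h.measurable_potential p) u).1 hu).1
  (h.isCoupling_rule N p u hu).isProbabilityMeasure

lemma isSamplingRule (h : IsCoupledFilter G ηf ηc Mf Mc η Ψ) (N : ℕ) :
    IsSamplingRule G (Ψ N) :=
  ⟨h.measurable_rule N, fun _ _ hu => h.isProb_rule hu⟩

lemma isProb_lastLaw [∀ N n, IsMarkovKernel (R N n)] (h : IsCoupledFilter G ηf ηc Mf Mc η Ψ)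
    (N n : ℕ) : IsProbabilityMeasure (lastLaw G (η 0) (Ψ N) (R N) n) :=
  have := h.nonempty
  have := h.isProb_lim 0
  isProbabilityMeasure_lastLaw h.measurable_potential (h.isSamplingRule N) n

/-- Conditional Chebyshev inequality: if, given the configuration at time `n`, the mean square
distance of `f` to `m` is small, and `m` converges, then so does `f`. -/
lemma tendsto_succ [∀ N n, IsMarkovKernel (R N n)] (h : IsCoupledFilter G ηf ηc Mf Mc η Ψ)
    {n : ℕ} {f m : (Σ N : ℕ, Fin N → X × X) → ℝ} (hf : ∀ N, BddMeas fun v => f ⟨N, v⟩)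
    {b : ℕ → ℝ} (hb : Tendsto b atTop (𝓝 0))
    (hs : ∀ᶠ z in whp fun N => lastLaw G (η 0) (Ψ N) (R N) n, Survives (G n) z.2)
    (hfm : ∀ (N : ℕ) (u : Fin N → X × X), Survives (G n) u →
      ∫ v, (f ⟨N, v⟩ - m ⟨N, u⟩) ^ 2 ∂(Measure.pi fun _ => Ψ N n u) ≤ b N)
    {c : ℝ} (hm : Tendsto m (whp fun N => lastLaw G (η 0) (Ψ N) (R N) n) (𝓝 c)) :
    Tendsto f (whp fun N => lastLaw G (η 0) (Ψ N) (R N) (n + 1)) (𝓝 c) := by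
  have := h.nonempty
  have := fun N n => h.isProb_lastLaw (R := R) N n
  rw [Metric.tendsto_nhds]
  intro ε hε
  have hε2 : 0 < ε / 2 := by positivity
  rw [eventually_whp_iff]
  have hmeas : ∀ N, MeasurableSet {v : Fin N → X × X | ¬ dist (f ⟨N, v⟩) c < ε} := fun N =>
    (measurableSet_lt ((hf N).1.dist measurable_const) measurable_const).compl
  have e : ∀ N, lastLaw G (η 0) (Ψ N) (R N) (n + 1) {v | ¬ dist (f ⟨N, v⟩) c < ε} =
      ∫⁻ u, stepLaw (G n) (Ψ N n) (R N n) u {v | ¬ dist (f ⟨N, v⟩) c < ε}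
        ∂(lastLaw G (η 0) (Ψ N) (R N) n) := fun N => by
    rw [lastLaw, Measure.bind_apply (hmeas N)
      ((h.isSamplingRule N).measurable_stepLaw h.measurable_potential n).aemeasurable]
  simp_rw [e]
  have hprob : ∀ N u, IsProbabilityMeasure (stepLaw (G n) (Ψ N n) (R N n) u) := fun N u =>
    isProbabilityMeasure_stepLaw ((h.isSamplingRule N).isProbabilityMeasure n) _ u
  refine tendsto_lintegral_of_tendsto_whp (C := 1)
    (f := fun z : Σ N : ℕ, Fin N → X × X => stepLaw (G n) (Ψ z.1 n) (R z.1 n) z.2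
      {v | ¬ dist (f ⟨z.1, v⟩) c < ε}) (fun z => ?_) ?_
  · have := hprob z.1 z.2
    simpa using prob_le_one
  have hlim : Tendsto (fun z : Σ N : ℕ, Fin N → X × X => ENNReal.ofReal (b z.1 / (ε / 2) ^ 2))
      (whp fun N => lastLaw G (η 0) (Ψ N) (R N) n) (𝓝 0) := by
    have := (hb.div_const ((ε / 2) ^ 2)).comp
      (tendsto_fst_whp (P := fun N => lastLaw G (η 0) (Ψ N) (R N) n))
    simpa using ENNReal.tendsto_ofReal this
  refine tendsto_of_tendsto_of_tendsto_of_le_of_le' tendsto_const_nhds hlim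
    (Eventually.of_forall fun _ => zero_le) ?_
  filter_upwards [hs, Metric.tendsto_nhds.1 hm _ hε2] with z hz1 hz2
  obtain ⟨N, u⟩ := z
  have := h.isProb_rule hz1
  simp only [] at hz1 hz2 ⊢
  rw [stepLaw_of_survives hz1]
  calc (Measure.pi fun _ => Ψ N n u) {v | ¬ dist (f ⟨N, v⟩) c < ε}
      ≤ (Measure.pi fun _ => Ψ N n u) {v | ¬ |f ⟨N, v⟩ - m ⟨N, u⟩| < ε / 2} := by
        refine measure_mono fun v hv hv' => hv ?_
        rw [Real.dist_eq] at hz2 ⊢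
        have := abs_sub_le (f ⟨N, v⟩) (m ⟨N, u⟩) c
        linarith
    _ ≤ ENNReal.ofReal ((∫ v, (f ⟨N, v⟩ - m ⟨N, u⟩) ^ 2 ∂(Measure.pi fun _ => Ψ N n u)) /
        (ε / 2) ^ 2) := meas_ge_le_integral_sq (hf N) _ hε2
    _ ≤ ENNReal.ofReal (b N / (ε / 2) ^ 2) := by
        gcongr
        exact hfm N u hz1

/-- Chebyshev inequality at time `0`. -/
lemma tendsto_zero (h : IsCoupledFilter G ηf ηc Mf Mc η Ψ)
    {f : (Σ N : ℕ, Fin N → X × X) → ℝ} (hf : ∀ N, BddMeas fun v => f ⟨N, v⟩)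
    {b : ℕ → ℝ} (hb : Tendsto b atTop (𝓝 0)) {c : ℝ}
    (hfm : ∀ N : ℕ, 0 < N → ∫ v, (f ⟨N, v⟩ - c) ^ 2 ∂(Measure.pi fun _ => η 0) ≤ b N) :
    Tendsto f (whp fun N => lastLaw G (η 0) (Ψ N) (R N) 0) (𝓝 c) := by
  have := h.isProb_lim 0
  rw [Metric.tendsto_nhds]
  intro ε hε
  rw [eventually_whp_iff]
  have hlim : Tendsto (fun N => ENNReal.ofReal (b N / ε ^ 2)) atTop (𝓝 0) := by
    simpa using ENNReal.tendsto_ofReal (hb.div_const (ε ^ 2))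
  refine tendsto_of_tendsto_of_tendsto_of_le_of_le' tendsto_const_nhds hlim
    (Eventually.of_forall fun _ => zero_le) ?_
  filter_upwards [eventually_gt_atTop 0] with N hN
  rw [lastLaw]
  simp_rw [Real.dist_eq]
  refine (meas_ge_le_integral_sq (hf N) c hε).trans ?_
  gcongr
  exact hfm N hN

/-- The V-statistic of order two with kernel `H`. -/
def vstat (H : (X × X) × (X × X) → ℝ) (z : Σ N : ℕ, Fin N → X × X) : ℝ :=
  (z.1 : ℝ)⁻¹ * (z.1 : ℝ)⁻¹ * ∑ i, ∑ j, H (z.2 i, z.2 j)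

lemma vstat_mk (H : (X × X) × (X × X) → ℝ) {N : ℕ} (v : Fin N → X × X) :
    vstat H ⟨N, v⟩ = (N : ℝ)⁻¹ * (N : ℝ)⁻¹ * ∑ i, ∑ j, H (v i, v j) := rfl

lemma bddMeas_vstat {H : (X × X) × (X × X) → ℝ} (hH : BddMeas H) (N : ℕ) :
    BddMeas fun v => vstat H ⟨N, v⟩ := by
  obtain ⟨hm, C, hC⟩ := hH
  simp_rw [vstat_mk]
  refine ⟨by fun_prop, (N : ℝ)⁻¹ * (N : ℝ)⁻¹ * ∑ i : Fin N, ∑ j : Fin N, C,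
    fun v => ?_⟩
  rw [abs_mul, abs_of_nonneg (by positivity : (0 : ℝ) ≤ (N : ℝ)⁻¹ * (N : ℝ)⁻¹)]
  gcongr
  exact (Finset.abs_sum_le_sum_abs _ _).trans (Finset.sum_le_sum fun i _ =>
    (Finset.abs_sum_le_sum_abs _ _).trans (Finset.sum_le_sum fun j _ => hC _))

lemma integral_sq_mul_vstat_le {μ : Measure (X × X)} [IsProbabilityMeasure μ]
    {H : (X × X) × (X × X) → ℝ} (hHm : Measurable H) {C : ℝ} (hC : ∀ x, |H x| ≤ C) (r c : ℝ)
    {N : ℕ} (hN : 0 < N) :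
    ∫ v, (r * (vstat H ⟨N, v⟩ - c) - r * (∫ y, H y ∂(μ.prod μ) - c)) ^ 2
      ∂(Measure.pi fun _ : Fin N => μ) ≤ r ^ 2 / N * (20 * C ^ 2) := by
  have e : ∀ v : Fin N → X × X,
      (r * (vstat H ⟨N, v⟩ - c) - r * (∫ y, H y ∂(μ.prod μ) - c)) ^ 2 =
      r ^ 2 * ((N : ℝ)⁻¹ * (N : ℝ)⁻¹ * ∑ i, ∑ j, H (v i, v j) - ∫ y, H y ∂(μ.prod μ)) ^ 2 :=
    fun v => by rw [vstat_mk]; ring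
  simp_rw [e]
  rw [integral_const_mul]
  calc _ ≤ r ^ 2 * (20 * C ^ 2 / N) := by
        gcongr
        exact integral_sq_vstat_le μ hN hHm hC
    _ = r ^ 2 / N * (20 * C ^ 2) := by ring

/-- Law of large numbers for V-statistics, with the rate `r`, given the previous configuration. -/
lemma tendsto_vstat_succ [∀ N n, IsMarkovKernel (R N n)]
    (h : IsCoupledFilter G ηf ηc Mf Mc η Ψ) {n : ℕ} {H : (X × X) × (X × X) → ℝ}
    (hH : BddMeas H) {r : ℕ → ℝ} (hr : Tendsto (fun N => r N ^ 2 / N) atTop (𝓝 0))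
    (hs : ∀ᶠ z in whp fun N => lastLaw G (η 0) (Ψ N) (R N) n, Survives (G n) z.2) {c : ℝ}
    (hm : Tendsto (fun z : Σ N : ℕ, Fin N → X × X =>
        r z.1 * (∫ y, H y ∂((Ψ z.1 n z.2).prod (Ψ z.1 n z.2)) - c))
      (whp fun N => lastLaw G (η 0) (Ψ N) (R N) n) (𝓝 0)) :
    Tendsto (fun z => r z.1 * (vstat H z - c))
      (whp fun N => lastLaw G (η 0) (Ψ N) (R N) (n + 1)) (𝓝 0) := by
  obtain ⟨C, hC⟩ := hH.2
  refine h.tendsto_succ (fun N => ?_) (b := fun N => r N ^ 2 / N * (20 * C ^ 2))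
    (by simpa using hr.mul_const (20 * C ^ 2)) hs (fun N u hu => ?_) hm
  · exact (BddMeas.const (r N)).mul ((bddMeas_vstat hH N).sub (BddMeas.const c))
  · have := h.isProb_rule hu
    exact integral_sq_mul_vstat_le hH.1 hC (r N) c hu.pos

lemma tendsto_vstat_zero (h : IsCoupledFilter G ηf ηc Mf Mc η Ψ)
    {H : (X × X) × (X × X) → ℝ}
    (hH : BddMeas H) {r : ℕ → ℝ} (hr : Tendsto (fun N => r N ^ 2 / N) atTop (𝓝 0)) :
    Tendsto (fun z => r z.1 * (vstat H z - ∫ y, H y ∂((η 0).prod (η 0))))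
      (whp fun N => lastLaw G (η 0) (Ψ N) (R N) 0) (𝓝 0) := by
  obtain ⟨C, hC⟩ := hH.2
  have := h.isProb_lim 0
  refine h.tendsto_zero (fun N => ?_) (b := fun N => r N ^ 2 / N * (20 * C ^ 2))
    (by simpa using hr.mul_const (20 * C ^ 2)) (fun N hN => ?_)
  · exact (BddMeas.const (r N)).mul ((bddMeas_vstat hH N).sub (BddMeas.const _))
  · have := integral_sq_mul_vstat_le (μ := η 0) hH.1 hC (r N) (∫ y, H y ∂((η 0).prod (η 0))) hN
    simpa using this

lemma vstat_fst {ψ : X × X → ℝ} (hψ : Measurable ψ) (z : Σ N : ℕ, Fin N → X × X) :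
    vstat (fun y => ψ y.1) z = ∫ v, ψ v ∂(empirical z.2) := by
  rw [vstat, integral_empirical _ hψ]
  rcases Nat.eq_zero_or_pos z.1 with h | h
  · simp [h]
  · simp only [Finset.sum_const, Finset.card_univ, Fintype.card_fin, nsmul_eq_mul,
      ← Finset.mul_sum]
    field_simp

lemma integral_prod_fst {μ : Measure (X × X)} [IsProbabilityMeasure μ] (ψ : X × X → ℝ) :
    ∫ y, ψ y.1 ∂(μ.prod μ) = ∫ v, ψ v ∂μ := by
  simpa using integral_fun_fst (μ := μ) (ν := μ) ψ

lemma tendsto_empirical_succ [∀ N n, IsMarkovKernel (R N n)]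
    (h : IsCoupledFilter G ηf ηc Mf Mc η Ψ) {n : ℕ} {ψ : X × X → ℝ}
    (hψ : BddMeas ψ) {r : ℕ → ℝ} (hr : Tendsto (fun N => r N ^ 2 / N) atTop (𝓝 0))
    (hs : ∀ᶠ z in whp fun N => lastLaw G (η 0) (Ψ N) (R N) n, Survives (G n) z.2) {c : ℝ}
    (hm : Tendsto (fun z : Σ N : ℕ, Fin N → X × X => r z.1 * (∫ v, ψ v ∂(Ψ z.1 n z.2) - c))
      (whp fun N => lastLaw G (η 0) (Ψ N) (R N) n) (𝓝 0)) :
    Tendsto (fun z => r z.1 * (∫ v, ψ v ∂(empirical z.2) - c))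
      (whp fun N => lastLaw G (η 0) (Ψ N) (R N) (n + 1)) (𝓝 0) := by
  simp_rw [← vstat_fst hψ.1]
  refine h.tendsto_vstat_succ (hψ.comp measurable_fst) hr hs (hm.congr' ?_)
  filter_upwards [hs] with z hz
  have := h.isProb_rule hz
  rw [integral_prod_fst]

lemma tendsto_empirical_zero (h : IsCoupledFilter G ηf ηc Mf Mc η Ψ) {ψ : X × X → ℝ}
    (hψ : BddMeas ψ) {r : ℕ → ℝ} (hr : Tendsto (fun N => r N ^ 2 / N) atTop (𝓝 0)) :
    Tendsto (fun z => r z.1 * (∫ v, ψ v ∂(empirical z.2) - ∫ v, ψ v ∂(η 0)))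
      (whp fun N => lastLaw G (η 0) (Ψ N) (R N) 0) (𝓝 0) := by
  have := h.isProb_lim 0
  have := h.tendsto_vstat_zero (R := R) (hψ.comp measurable_fst) hr
  simp_rw [vstat_fst hψ.1] at this
  rwa [integral_prod_fst] at this

end IsCoupledFilter
end lln

/-! ### Laws of large numbers with a rate for the marginals -/

section marginals

/-- The rate `N ^ (1/4)`. It is slower than the rate `N ^ (1/2)` of the central limit theorem, so
that laws of large numbers hold with it, and the product of two errors is still
negligible after multiplication by `√N`. -/
def rate (N : ℕ) : ℝ := √√(N : ℝ)

lemma rate_sq (N : ℕ) : rate N ^ 2 = √(N : ℝ) := Real.sq_sqrt (Real.sqrt_nonneg _)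

lemma tendsto_rate : Tendsto rate atTop atTop :=
  Real.tendsto_sqrt_atTop.comp (Real.tendsto_sqrt_atTop.comp tendsto_natCast_atTop_atTop)

lemma tendsto_inv_sqrt : Tendsto (fun N : ℕ => (√(N : ℝ))⁻¹) atTop (𝓝 0) :=
  tendsto_inv_atTop_zero.comp (Real.tendsto_sqrt_atTop.comp tendsto_natCast_atTop_atTop)

lemma tendsto_rate_sq_div : Tendsto (fun N : ℕ => rate N ^ 2 / N) atTop (𝓝 0) := by
  refine tendsto_inv_sqrt.congr fun N => ?_
  rw [rate_sq, Real.sqrt_div_self']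
  simp

lemma tendsto_of_rate {Ω : ℕ → Type*} [∀ N, MeasurableSpace (Ω N)] {P : ∀ N, Measure (Ω N)}
    {f : (Σ N, Ω N) → ℝ} {c : ℝ}
    (hf : Tendsto (fun z => rate z.1 * (f z - c)) (whp P) (𝓝 0)) :
    Tendsto f (whp P) (𝓝 c) := by
  have h1 := tendsto_rate.comp (tendsto_fst_whp (P := P))
  have h2 := (tendsto_inv_atTop_zero.comp h1).mul hf
  rw [mul_zero] at h2
  have h3 : Tendsto (fun z => f z - c) (whp P) (𝓝 0) := by
    refine h2.congr' ?_
    filter_upwards [h1.eventually (eventually_gt_atTop 0)] with z hz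
    simp only [Function.comp_apply] at hz ⊢
    field_simp
  simpa using h3.add_const c

namespace IsCoupledFilter

variable {G : ℕ → X → ℝ≥0} {ηf ηc : Measure X} {Mf Mc : ℕ → Kernel X X}
  {η : ℕ → Measure (X × X)} {Ψ : ∀ N : ℕ, ℕ → (Fin N → X × X) → Measure (X × X)}
  {R : ∀ N : ℕ, ℕ → Kernel (Fin N → X × X) (Fin N → X × X)}

/-- Ratios inherit the rate `N ^ (1/4)`; this is used for `μ(g) / μ^N(g)`. -/
lemma tendsto_rate_ratio {Ω : ℕ → Type*} [∀ N, MeasurableSpace (Ω N)] {P : ∀ N, Measure (Ω N)}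
    {f : (Σ N, Ω N) → ℝ} {c : ℝ} (hc : c ≠ 0)
    (hf : Tendsto (fun z => rate z.1 * (f z - c)) (whp P) (𝓝 0)) :
    Tendsto (fun z => rate z.1 * (c / f z - 1)) (whp P) (𝓝 0) := by
  have h1 := tendsto_of_rate hf
  have h2 := (hf.neg).div h1 hc
  rw [neg_zero, zero_div] at h2
  refine h2.congr' ?_
  filter_upwards [h1.eventually_ne hc] with z hz
  simp only [Pi.div_apply]
  field_simp
  ring

lemma integral_comp_empirical {N : ℕ} (u : Fin N → X × X) {pr : X × X → X} (hpr : Measurable pr)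
    {φ : X → ℝ} (hφ : Measurable φ) :
    ∫ v, φ (pr v) ∂(empirical u) = ∫ x, φ x ∂(empirical fun i => pr (u i)) := by
  rw [← map_empirical u hpr, integral_map hpr.aemeasurable hφ.aestronglyMeasurable]

/-- The data of one of the two marginal particle filters, which is obtained by applying the
projection `pr` to all pairs. -/
structure IsMarginal (G : ℕ → X → ℝ≥0) (ηs : Measure X) (M : ℕ → Kernel X X)
    (η : ℕ → Measure (X × X)) (Ψ : ∀ N : ℕ, ℕ → (Fin N → X × X) → Measure (X × X))
    (pr : X × X → X) : Prop where
  measurable : Measurable pr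
  isProb : IsProbabilityMeasure ηs
  isMarkov : ∀ n, IsMarkovKernel (M n)
  pos : ∀ n, 0 < gam G ηs M n Set.univ
  map_lim : ∀ n, (η n).map pr = eta G ηs M n
  map_rule : ∀ (N n : ℕ) (u : Fin N → X × X), Survives (G n) u →
    (Ψ N n u).map pr = PhiS (G n) (M (n + 1)) (empirical fun i => pr (u i))
  lintegral_ne_zero : ∀ (N n : ℕ) (u : Fin N → X × X), Survives (G n) u →
    ∫⁻ x, (G n x : ℝ≥0∞) ∂(empirical fun i => pr (u i)) ≠ 0

lemma isMarginal_fst (h : IsCoupledFilter G ηf ηc Mf Mc η Ψ) :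
    IsMarginal G ηf Mf η Ψ Prod.fst where
  measurable := measurable_fst
  isProb := h.isProb_f
  isMarkov := h.isMarkov_f
  pos := h.pos_f
  map_lim n := (h.isCoupling n).1
  map_rule N n u hu := (h.isCoupling_rule N n u hu).1
  lintegral_ne_zero _ n u hu := ((survives_iff (h.measurable_potential n) u).1 hu).1

lemma isMarginal_snd (h : IsCoupledFilter G ηf ηc Mf Mc η Ψ) :
    IsMarginal G ηc Mc η Ψ Prod.snd where
  measurable := measurable_snd
  isProb := h.isProb_c
  isMarkov := h.isMarkov_c
  pos := h.pos_c
  map_lim n := (h.isCoupling n).2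
  map_rule N n u hu := (h.isCoupling_rule N n u hu).2
  lintegral_ne_zero _ n u hu := ((survives_iff (h.measurable_potential n) u).1 hu).2

/-- The law of large numbers, with the rate `N ^ (1/4)`, for one of the two marginals at
time `n`. -/
def MarginalLLN (G : ℕ → X → ℝ≥0) (ηs : Measure X) (M : ℕ → Kernel X X)
    (η : ℕ → Measure (X × X)) (Ψ : ∀ N : ℕ, ℕ → (Fin N → X × X) → Measure (X × X))
    (R : ∀ N : ℕ, ℕ → Kernel (Fin N → X × X) (Fin N → X × X)) (pr : X × X → X) (n : ℕ) : Prop :=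
  ∀ φ : X → ℝ, BddMeas φ → Tendsto (fun z : Σ N : ℕ, Fin N → X × X =>
      rate z.1 * (∫ v, φ (pr v) ∂(empirical z.2) - ∫ x, φ x ∂(eta G ηs M n)))
    (whp fun N => lastLaw G (η 0) (Ψ N) (R N) n) (𝓝 0)

section marginal
variable {ηs : Measure X} {M : ℕ → Kernel X X} {pr : X × X → X}

lemma IsMarginal.isProb_eta (hm : IsMarginal G ηs M η Ψ pr)
    (hGb : ∀ n, ∃ C : ℝ≥0, ∀ x, G n x ≤ C) (n : ℕ) : IsProbabilityMeasure (eta G ηs M n) :=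
  have := hm.isProb
  have := hm.isMarkov
  isProbabilityMeasure_eta hGb hm.pos n

lemma IsMarginal.lintegral_eta_ne_zero (hm : IsMarginal G ηs M η Ψ pr)
    (hGb : ∀ n, ∃ C : ℝ≥0, ∀ x, G n x ≤ C) (n : ℕ) :
    ∫⁻ x, (G n x : ℝ≥0∞) ∂(eta G ηs M n) ≠ 0 :=
  have := hm.isProb
  have := hm.isMarkov
  CoupledPF.lintegral_eta_ne_zero hGb hm.pos n

lemma IsMarginal.integral_pos (hm : IsMarginal G ηs M η Ψ pr) (hGm : ∀ n, Measurable (G n))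
    (hGb : ∀ n, ∃ C : ℝ≥0, ∀ x, G n x ≤ C) (n : ℕ) : 0 < ∫ x, (G n x : ℝ) ∂(eta G ηs M n) :=
  have := hm.isProb_eta hGb n
  integral_coe_pos (hGm n) (hGb n) (hm.lintegral_eta_ne_zero hGb n)

/-- One marginal of the conditional sampling law, relative to its limit, is the empirical error of
the pulled back function, up to a factor that tends to one. -/
lemma IsMarginal.integral_rule_sub (hm : IsMarginal G ηs M η Ψ pr) {n N : ℕ}
    (hGm : ∀ n, Measurable (G n)) (hGb : ∀ n, ∃ C : ℝ≥0, ∀ x, G n x ≤ C)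
    {u : Fin N → X × X} (hu : Survives (G n) u) {φ : X → ℝ} (hφ : BddMeas φ) :
    ∫ v, φ (pr v) ∂(Ψ N n u) - ∫ x, φ x ∂(eta G ηs M (n + 1)) =
      (∫ v, backStep (G n) (M (n + 1)) (eta G ηs M n) φ (pr v) ∂(empirical u)) *
        ((∫ x, (G n x : ℝ) ∂(eta G ηs M n)) / ∫ v, (G n (pr v) : ℝ) ∂(empirical u)) := by
  have := hm.isProb
  have := hm.isMarkov
  have := hm.isProb_eta hGb n
  have e : ∫ v, φ (pr v) ∂(Ψ N n u) =
      ∫ x, φ x ∂(PhiS (G n) (M (n + 1)) (empirical fun i => pr (u i))) := by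
    rw [← hm.map_rule N n u hu, integral_map hm.measurable.aemeasurable hφ.1.aestronglyMeasurable]
  have hGn := hGm n
  rw [e, eta_succ hGb hm.pos, integral_PhiS_sub (hGm n) (hGb n) (hm.lintegral_eta_ne_zero hGb n)
      (hm.lintegral_ne_zero N n u hu) hφ,
    integral_comp_empirical u hm.measurable (hφ.backStep (hGm n) (hGb n)).1,
    integral_comp_empirical (φ := fun x => (G n x : ℝ)) u hm.measurable (by fun_prop)]

lemma eventually_ne_zero (hm : IsMarginal G ηs M η Ψ pr) (hGm : ∀ n, Measurable (G n))
    (hGb : ∀ n, ∃ C : ℝ≥0, ∀ x, G n x ≤ C) {n : ℕ} (hl : MarginalLLN G ηs M η Ψ R pr n) :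
    ∀ᶠ z in whp fun N => lastLaw G (η 0) (Ψ N) (R N) n,
      ∫⁻ x, (G n x : ℝ≥0∞) ∂(empirical fun i => pr (z.2 i)) ≠ 0 := by
  obtain ⟨C, hC⟩ := hGb n
  have hl' := tendsto_of_rate (hl (fun x => (G n x : ℝ)) (BddMeas.of_nnreal (hGm n) hC))
  have hGn := hGm n
  filter_upwards [hl'.eventually_ne (hm.integral_pos hGm hGb n).ne'] with z hz h0
  refine hz ?_
  rw [integral_comp_empirical (φ := fun x => (G n x : ℝ)) z.2 hm.measurable (by fun_prop),
    ← toReal_lintegral_coe hGn, h0, ENNReal.toReal_zero]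

lemma tendsto_backStep (hm : IsMarginal G ηs M η Ψ pr) (hGm : ∀ n, Measurable (G n))
    (hGb : ∀ n, ∃ C : ℝ≥0, ∀ x, G n x ≤ C) {n : ℕ} (hl : MarginalLLN G ηs M η Ψ R pr n)
    {φ : X → ℝ} (hφ : BddMeas φ) : Tendsto (fun z : Σ N : ℕ, Fin N → X × X => rate z.1 *
        ∫ v, backStep (G n) (M (n + 1)) (eta G ηs M n) φ (pr v) ∂(empirical z.2))
      (whp fun N => lastLaw G (η 0) (Ψ N) (R N) n) (𝓝 0) := by
  have := hm.isMarkov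
  have := hm.isProb_eta hGb n
  have h1 := hl _ (hφ.backStep (M := M (n + 1)) (μ := eta G ηs M n) (hGm n) (hGb n))
  rw [integral_backStep (hGm n) (hGb n) (hm.lintegral_eta_ne_zero hGb n) hφ] at h1
  simpa only [sub_zero] using h1

lemma tendsto_rate_potential_ratio (hm : IsMarginal G ηs M η Ψ pr) (hGm : ∀ n, Measurable (G n))
    (hGb : ∀ n, ∃ C : ℝ≥0, ∀ x, G n x ≤ C) {n : ℕ} (hl : MarginalLLN G ηs M η Ψ R pr n) :
    Tendsto (fun z : Σ N : ℕ, Fin N → X × X => rate z.1 *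
        ((∫ x, (G n x : ℝ) ∂(eta G ηs M n)) / ∫ v, (G n (pr v) : ℝ) ∂(empirical z.2) - 1))
      (whp fun N => lastLaw G (η 0) (Ψ N) (R N) n) (𝓝 0) := by
  obtain ⟨C, hC⟩ := hGb n
  exact tendsto_rate_ratio (hm.integral_pos hGm hGb n).ne'
    (hl (fun x => (G n x : ℝ)) (BddMeas.of_nnreal (hGm n) hC))

lemma tendsto_rate_rule [∀ N n, IsMarkovKernel (R N n)]
    (h : IsCoupledFilter G ηf ηc Mf Mc η Ψ) (hm : IsMarginal G ηs M η Ψ pr) {n : ℕ}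
    (hs : ∀ᶠ z in whp fun N => lastLaw G (η 0) (Ψ N) (R N) n, Survives (G n) z.2)
    (hl : MarginalLLN G ηs M η Ψ R pr n) {φ : X → ℝ} (hφ : BddMeas φ) :
    Tendsto (fun z : Σ N : ℕ, Fin N → X × X => rate z.1 *
        (∫ v, φ (pr v) ∂(Ψ z.1 n z.2) - ∫ x, φ x ∂(eta G ηs M (n + 1))))
      (whp fun N => lastLaw G (η 0) (Ψ N) (R N) n) (𝓝 0) := by
  have hGm := h.measurable_potential
  have hGb := h.bounded_potential
  have h3 := (tendsto_backStep hm hGm hGb hl hφ).mul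
    (tendsto_of_rate (tendsto_rate_potential_ratio hm hGm hGb hl))
  rw [zero_mul] at h3
  refine h3.congr' ?_
  filter_upwards [hs] with z hz
  rw [hm.integral_rule_sub hGm hGb hz hφ]
  ring

/-- On the scale `√N`, the conditional sampling law deviates from its limit by the empirical error
of the pulled back function at the previous time: the difference is a product of two errors
that both vanish on the scale `N ^ (1/4)`. -/
lemma tendsto_sqrt_rule_sub_backStep [∀ N n, IsMarkovKernel (R N n)]
    (h : IsCoupledFilter G ηf ηc Mf Mc η Ψ) (hm : IsMarginal G ηs M η Ψ pr) {n : ℕ}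
    (hs : ∀ᶠ z in whp fun N => lastLaw G (η 0) (Ψ N) (R N) n, Survives (G n) z.2)
    (hl : MarginalLLN G ηs M η Ψ R pr n) {φ : X → ℝ} (hφ : BddMeas φ) :
    Tendsto (fun z : Σ N : ℕ, Fin N → X × X => √(z.1 : ℝ) *
        (∫ v, φ (pr v) ∂(Ψ z.1 n z.2) - ∫ x, φ x ∂(eta G ηs M (n + 1)) -
          ∫ v, backStep (G n) (M (n + 1)) (eta G ηs M n) φ (pr v) ∂(empirical z.2)))
      (whp fun N => lastLaw G (η 0) (Ψ N) (R N) n) (𝓝 0) := by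
  have hGm := h.measurable_potential
  have hGb := h.bounded_potential
  have h3 := (tendsto_backStep hm hGm hGb hl hφ).mul (tendsto_rate_potential_ratio hm hGm hGb hl)
  rw [zero_mul] at h3
  refine h3.congr' ?_
  filter_upwards [hs] with z hz
  rw [hm.integral_rule_sub hGm hGb hz hφ, ← rate_sq]
  ring

lemma tendsto_marginal_succ [∀ N n, IsMarkovKernel (R N n)]
    (h : IsCoupledFilter G ηf ηc Mf Mc η Ψ) (hm : IsMarginal G ηs M η Ψ pr) {n : ℕ}
    (hs : ∀ᶠ z in whp fun N => lastLaw G (η 0) (Ψ N) (R N) n, Survives (G n) z.2)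
    (hl : MarginalLLN G ηs M η Ψ R pr n) : MarginalLLN G ηs M η Ψ R pr (n + 1) :=
  fun _ hφ => h.tendsto_empirical_succ (hφ.comp hm.measurable) tendsto_rate_sq_div hs
    (tendsto_rate_rule h hm hs hl hφ)

lemma tendsto_marginal_zero (h : IsCoupledFilter G ηf ηc Mf Mc η Ψ)
    (hm : IsMarginal G ηs M η Ψ pr) : MarginalLLN G ηs M η Ψ R pr 0 := by
  intro φ hφ
  have := h.tendsto_empirical_zero (R := R) (hφ.comp hm.measurable) tendsto_rate_sq_div
  rwa [← integral_map hm.measurable.aemeasurable hφ.1.aestronglyMeasurable, hm.map_lim 0] at this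

end marginal

lemma eventually_survives (h : IsCoupledFilter G ηf ηc Mf Mc η Ψ) {n : ℕ}
    (hf : MarginalLLN G ηf Mf η Ψ R Prod.fst n) (hc : MarginalLLN G ηc Mc η Ψ R Prod.snd n) :
    ∀ᶠ z in whp fun N => lastLaw G (η 0) (Ψ N) (R N) n, Survives (G n) z.2 := by
  filter_upwards [
    eventually_ne_zero h.isMarginal_fst h.measurable_potential h.bounded_potential hf,
    eventually_ne_zero h.isMarginal_snd h.measurable_potential h.bounded_potential hc] with z h1 h2
  exact (survives_iff (h.measurable_potential n) z.2).2 ⟨h1, h2⟩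

/-- The law of large numbers for the two marginals. It only involves the marginals of the sampling
rule, so that it holds for every coupling. -/
theorem marginalLLN [∀ N n, IsMarkovKernel (R N n)]
    (h : IsCoupledFilter G ηf ηc Mf Mc η Ψ) (n : ℕ) :
    MarginalLLN G ηf Mf η Ψ R Prod.fst n ∧ MarginalLLN G ηc Mc η Ψ R Prod.snd n := by
  induction n with
  | zero => exact ⟨tendsto_marginal_zero h h.isMarginal_fst,
      tendsto_marginal_zero h h.isMarginal_snd⟩
  | succ n ih =>
    have hs := h.eventually_survives ih.1 ih.2
    exact ⟨tendsto_marginal_succ h h.isMarginal_fst hs ih.1,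
      tendsto_marginal_succ h h.isMarginal_snd hs ih.2⟩

/-- Survival has probability tending to one. -/
lemma eventually_survives_lastLaw [∀ N n, IsMarkovKernel (R N n)]
    (h : IsCoupledFilter G ηf ηc Mf Mc η Ψ) (n : ℕ) :
    ∀ᶠ z in whp fun N => lastLaw G (η 0) (Ψ N) (R N) n, Survives (G n) z.2 :=
  h.eventually_survives (h.marginalLLN n).1 (h.marginalLLN n).2

end IsCoupledFilter
end marginals

/-! ### Propagation of the central limit theorem -/

section clt

/-- The characteristic function of the scaled error of an i.i.d. sample from `μ`, centred at an
arbitrary `c`, is up to `O(N ^ (-1/2))` that of a Gaussian with mean `√N (μ(ψ) - c)` and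
variance `Var_μ(ψ)`, uniformly in `μ`. -/
lemma norm_integral_exp_empirical_sub_le (μ : Measure S) [IsProbabilityMeasure μ] {ψ : S → ℝ}
    (hψ : Measurable ψ) {C : ℝ} (hC : ∀ x, |ψ x| ≤ C) (t c : ℝ) {N : ℕ} (hN : 0 < N)
    (hs : |t| * (√(N : ℝ))⁻¹ * (2 * C) ≤ 1) :
    ‖(∫ v, Complex.exp ((t * (√(N : ℝ) * (∫ x, ψ x ∂(empirical v) - c)) : ℝ) * Complex.I)
        ∂(Measure.pi fun _ : Fin N => μ)) -
      Complex.exp ((t * (√(N : ℝ) * (∫ x, ψ x ∂μ - c)) : ℝ) * Complex.I) *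
        Complex.exp (((-(t ^ 2 * ∫ x, (ψ x - ∫ y, ψ y ∂μ) ^ 2 ∂μ) / 2 : ℝ) : ℂ))‖ ≤
      2 * (|t| * (2 * C)) ^ 3 * (√(N : ℝ))⁻¹ := by
  set m := ∫ x, ψ x ∂μ with hm
  have hmC : |m| ≤ C := abs_integral_le_of_abs_le hC
  have hN' : (0 : ℝ) < N := by positivity
  have hsq : (0 : ℝ) < √(N : ℝ) := Real.sqrt_pos.2 hN'
  have hsq2 : √(N : ℝ) ^ 2 = N := Real.sq_sqrt hN'.le
  set s := t * (√(N : ℝ))⁻¹ with hsdef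
  have e : ∀ v : Fin N → S, Complex.exp
      ((t * (√(N : ℝ) * (∫ x, ψ x ∂(empirical v) - c)) : ℝ) * Complex.I) =
      Complex.exp ((t * (√(N : ℝ) * (m - c)) : ℝ) * Complex.I) *
        Complex.exp ((∑ i, s * (ψ (v i) - m) : ℝ) * Complex.I) := fun v => by
    rw [← Complex.exp_add, ← add_mul, ← Complex.ofReal_add, integral_empirical v hψ,
      ← Finset.mul_sum, Finset.sum_sub_distrib]
    simp only [Finset.sum_const, Finset.card_univ, Fintype.card_fin, nsmul_eq_mul]
    congr 3
    rw [hsdef]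
    have : (N : ℝ)⁻¹ = (√(N : ℝ))⁻¹ * (√(N : ℝ))⁻¹ := by
      rw [← mul_inv, ← _root_.pow_two, hsq2]
    rw [this]
    generalize ∑ i, ψ (v i) = A
    have h3 : (√(N : ℝ))⁻¹ * ((N : ℝ) * m) = √(N : ℝ) * m := by
      rw [← mul_assoc, inv_mul_eq_div, Real.div_sqrt]
    have h4 : √(N : ℝ) * ((√(N : ℝ))⁻¹ * (√(N : ℝ))⁻¹ * A) = (√(N : ℝ))⁻¹ * A := by
      field_simp
    linear_combination t * h4 + t * h3
  simp_rw [e]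
  rw [integral_const_mul, ← mul_sub, norm_mul, Complex.norm_exp_ofReal_mul_I, one_mul,
    integral_exp_sum_pi μ (fun x => s * (ψ x - m))]
  have hNs : (N : ℝ) * s ^ 2 = t ^ 2 := by
    rw [hsdef, mul_pow, inv_pow, hsq2]
    field_simp
  have habs : |s| = |t| * (√(N : ℝ))⁻¹ := by
    rw [hsdef, abs_mul, abs_of_pos (inv_pos.2 hsq)]
  have h0 : ∫ x, (ψ x - m) ∂μ = 0 := by
    rw [integral_sub (integrable_of_abs_le hψ hC) (integrable_const _)]
    simp [hm]
  have hb : ∀ x, |ψ x - m| ≤ 2 * C := fun x => by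
    have := abs_sub (ψ x) m
    have := hC x
    linarith
  have := norm_charFun_pow_sub_le μ (f := fun x => ψ x - m) (hψ.sub_const m) hb h0 s
    (by rw [habs]; exact hs) N
  rw [hNs] at this
  refine this.trans (le_of_eq ?_)
  rw [habs]
  have : (N : ℝ) * ((√(N : ℝ))⁻¹) ^ 3 = (√(N : ℝ))⁻¹ := by
    rw [← hsq2, inv_pow]
    rw [Real.sqrt_sq hsq.le]
    field_simp
  linear_combination 2 * (|t| * (2 * C)) ^ 3 * this

namespace IsCoupledFilter

variable {G : ℕ → X → ℝ≥0} {ηf ηc : Measure X} {Mf Mc : ℕ → Kernel X X}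
  {η : ℕ → Measure (X × X)} {Ψ : ∀ N : ℕ, ℕ → (Fin N → X × X) → Measure (X × X)}
  {R : ∀ N : ℕ, ℕ → Kernel (Fin N → X × X) (Fin N → X × X)}

/-- The scaled error `√N [η^N - η](φ₁ ⊗ 1 - 1 ⊗ φ₂)` as a function of one configuration. -/
def werr (η : Measure (X × X)) (φ₁ φ₂ : X → ℝ) (z : Σ N : ℕ, Fin N → X × X) : ℝ :=
  √(z.1 : ℝ) * (∫ v, (φ₁ v.1 - φ₂ v.2) ∂(empirical z.2) - ∫ v, (φ₁ v.1 - φ₂ v.2) ∂η)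

/-- The asymptotic variance for a pair of test functions. -/
def pairVar (G : ℕ → X → ℝ≥0) (ηf ηc : Measure X) (Mf Mc : ℕ → Kernel X X)
    (η : ℕ → Measure (X × X)) (n : ℕ) (φ₁ φ₂ : X → ℝ) : ℝ :=
  ∑ p ∈ Finset.range (n + 1),
    ∫ u, (Dop G ηf Mf p n φ₁ u.1 - Dop G ηc Mc p n φ₂ u.2) ^ 2 ∂(η p)

lemma measurable_werr {η : Measure (X × X)} {φ₁ φ₂ : X → ℝ} (h₁ : Measurable φ₁)
    (h₂ : Measurable φ₂) (N : ℕ) : Measurable fun v => werr η φ₁ φ₂ ⟨N, v⟩ := by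
  have hψ : Measurable fun v : X × X => φ₁ v.1 - φ₂ v.2 := by fun_prop
  have : (fun v => werr η φ₁ φ₂ ⟨N, v⟩) = fun v : Fin N → X × X =>
      √(N : ℝ) * ((N : ℝ)⁻¹ * ∑ i, (φ₁ (v i).1 - φ₂ (v i).2) -
        ∫ v, (φ₁ v.1 - φ₂ v.2) ∂η) := by
    funext v
    rw [← integral_empirical v hψ]
    rfl
  rw [this]
  fun_prop

lemma integral_sub_coupling {μ : Measure (X × X)} {μ₁ μ₂ : Measure X} [IsProbabilityMeasure μ₁]
    (h : IsCoupling μ μ₁ μ₂) {φ₁ φ₂ : X → ℝ} (h₁ : BddMeas φ₁) (h₂ : BddMeas φ₂) :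
    ∫ v, (φ₁ v.1 - φ₂ v.2) ∂μ = ∫ x, φ₁ x ∂μ₁ - ∫ x, φ₂ x ∂μ₂ := by
  have := h.isProbabilityMeasure
  rw [integral_sub ((h₁.comp measurable_fst).integrable μ) ((h₂.comp measurable_snd).integrable μ),
    h.integral_fst h₁.1, h.integral_snd h₂.1]

/-- The asymptotic variance at time `n + 1` is that at time `n` for the pulled back functions, plus
the variance under the limiting coupling. -/
lemma pairVar_succ (h : IsCoupledFilter G ηf ηc Mf Mc η Ψ) (n : ℕ) {φ₁ φ₂ : X → ℝ}
    (h₁ : BddMeas φ₁) (h₂ : BddMeas φ₂) :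
    pairVar G ηf ηc Mf Mc η (n + 1) φ₁ φ₂ =
      pairVar G ηf ηc Mf Mc η n (backStep (G n) (Mf (n + 1)) (eta G ηf Mf n) φ₁)
        (backStep (G n) (Mc (n + 1)) (eta G ηc Mc n) φ₂) +
      ∫ v, (φ₁ v.1 - φ₂ v.2 - ∫ w, (φ₁ w.1 - φ₂ w.2) ∂(η (n + 1))) ^ 2 ∂(η (n + 1)) := by
  have := h.isProb_f
  have := h.isProb_c
  have := h.isMarkov_f
  have := h.isMarkov_c
  have := h.isProb_eta_f (n + 1)
  rw [pairVar, Finset.sum_range_succ, pairVar]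
  congr 1
  · refine Finset.sum_congr rfl fun p hp => ?_
    have hpn : p ≤ n := Nat.lt_succ_iff.1 (Finset.mem_range.1 hp)
    rw [Dop_succ h.measurable_potential h.bounded_potential h.pos_f hpn h₁,
      Dop_succ h.measurable_potential h.bounded_potential h.pos_c hpn h₂]
  · rw [integral_sub_coupling (h.isCoupling (n + 1)) h₁ h₂]
    refine integral_congr_ae (ae_of_all _ fun v => ?_)
    simp only [Dop_self h.bounded_potential h.pos_f, Dop_self h.bounded_potential h.pos_c]
    ring

lemma pairVar_zero (h : IsCoupledFilter G ηf ηc Mf Mc η Ψ) {φ₁ φ₂ : X → ℝ}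
    (h₁ : BddMeas φ₁) (h₂ : BddMeas φ₂) :
    pairVar G ηf ηc Mf Mc η 0 φ₁ φ₂ =
      ∫ v, (φ₁ v.1 - φ₂ v.2 - ∫ w, (φ₁ w.1 - φ₂ w.2) ∂(η 0)) ^ 2 ∂(η 0) := by
  have := h.isProb_f
  have := h.isProb_c
  have := h.isMarkov_f
  have := h.isMarkov_c
  have := h.isProb_eta_f 0
  rw [pairVar, Finset.sum_range_one, integral_sub_coupling (h.isCoupling 0) h₁ h₂]
  refine integral_congr_ae (ae_of_all _ fun v => ?_)
  simp only [Dop_self h.bounded_potential h.pos_f, Dop_self h.bounded_potential h.pos_c]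
  ring

lemma integral_sub_mean_sq {μ : Measure S} [IsProbabilityMeasure μ] {ψ : S → ℝ}
    (hψ : BddMeas ψ) : ∫ x, (ψ x - ∫ y, ψ y ∂μ) ^ 2 ∂μ = ∫ x, ψ x ^ 2 ∂μ - (∫ x, ψ x ∂μ) ^ 2 := by
  have := variance_eq_sub (μ := μ) (X := ψ) (MemLp.of_bound hψ.1.aestronglyMeasurable
    hψ.2.choose (ae_of_all _ hψ.2.choose_spec))
  rw [variance_eq_integral hψ.1.aemeasurable] at this
  simpa using this

lemma integral_sub_sq_coupling {μ : Measure (X × X)} [IsProbabilityMeasure μ]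
    {φ₁ φ₂ : X → ℝ} (h₁ : BddMeas φ₁) (h₂ : BddMeas φ₂) :
    ∫ v, (φ₁ v.1 - φ₂ v.2) ^ 2 ∂μ =
      ∫ v, φ₁ v.1 ^ 2 ∂μ + ∫ v, φ₂ v.2 ^ 2 ∂μ - 2 * ∫ v, φ₁ v.1 * φ₂ v.2 ∂μ := by
  have b₁ := h₁.comp (measurable_fst (α := X) (β := X))
  have b₂ := h₂.comp (measurable_snd (α := X) (β := X))
  have e : ∀ v : X × X, (φ₁ v.1 - φ₂ v.2) ^ 2 =
      φ₁ v.1 ^ 2 + φ₂ v.2 ^ 2 - 2 * (φ₁ v.1 * φ₂ v.2) := fun v => by ring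
  simp_rw [e]
  rw [integral_sub ((b₁.pow_two.add b₂.pow_two).integrable μ)
    (((b₁.mul b₂).integrable μ).const_mul 2),
    integral_add (b₁.pow_two.integrable μ) (b₂.pow_two.integrable μ), integral_const_mul]

/-- The variance of the conditional sampling law converges as soon as the mixed moment does, since
the two marginals are under control. -/
lemma tendsto_rule_variance [∀ N n, IsMarkovKernel (R N n)]
    (h : IsCoupledFilter G ηf ηc Mf Mc η Ψ) {n : ℕ} {φ₁ φ₂ : X → ℝ}
    (h₁ : BddMeas φ₁) (h₂ : BddMeas φ₂)
    (hmix : Tendsto (fun z : Σ N : ℕ, Fin N → X × X => ∫ v, φ₁ v.1 * φ₂ v.2 ∂(Ψ z.1 n z.2))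
      (whp fun N => lastLaw G (η 0) (Ψ N) (R N) n) (𝓝 (∫ v, φ₁ v.1 * φ₂ v.2 ∂(η (n + 1))))) :
    Tendsto (fun z : Σ N : ℕ, Fin N → X × X =>
        ∫ v, (φ₁ v.1 - φ₂ v.2 - ∫ w, (φ₁ w.1 - φ₂ w.2) ∂(Ψ z.1 n z.2)) ^ 2 ∂(Ψ z.1 n z.2))
      (whp fun N => lastLaw G (η 0) (Ψ N) (R N) n)
      (𝓝 (∫ v, (φ₁ v.1 - φ₂ v.2 - ∫ w, (φ₁ w.1 - φ₂ w.2) ∂(η (n + 1))) ^ 2 ∂(η (n + 1)))) := by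
  have hs := h.eventually_survives_lastLaw (R := R) n
  have hp := h.isProb_lim (n + 1)
  have lf : ∀ φ : X → ℝ, BddMeas φ → Tendsto (fun z : Σ N : ℕ, Fin N → X × X =>
      ∫ v, φ v.1 ∂(Ψ z.1 n z.2)) (whp fun N => lastLaw G (η 0) (Ψ N) (R N) n)
      (𝓝 (∫ v, φ v.1 ∂(η (n + 1)))) := fun φ hφ => by
    rw [(h.isCoupling (n + 1)).integral_fst hφ.1]
    exact tendsto_of_rate (tendsto_rate_rule h h.isMarginal_fst hs (h.marginalLLN n).1 hφ)
  have lc : ∀ φ : X → ℝ, BddMeas φ → Tendsto (fun z : Σ N : ℕ, Fin N → X × X =>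
      ∫ v, φ v.2 ∂(Ψ z.1 n z.2)) (whp fun N => lastLaw G (η 0) (Ψ N) (R N) n)
      (𝓝 (∫ v, φ v.2 ∂(η (n + 1)))) := fun φ hφ => by
    rw [(h.isCoupling (n + 1)).integral_snd hφ.1]
    exact tendsto_of_rate (tendsto_rate_rule h h.isMarginal_snd hs (h.marginalLLN n).2 hφ)
  have b₁ := h₁.comp (measurable_fst (α := X) (β := X))
  have b₂ := h₂.comp (measurable_snd (α := X) (β := X))
  have key : ∀ μ : Measure (X × X), IsProbabilityMeasure μ →
      ∫ v, (φ₁ v.1 - φ₂ v.2 - ∫ w, (φ₁ w.1 - φ₂ w.2) ∂μ) ^ 2 ∂μ =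
        ∫ v, φ₁ v.1 ^ 2 ∂μ + ∫ v, φ₂ v.2 ^ 2 ∂μ - 2 * ∫ v, φ₁ v.1 * φ₂ v.2 ∂μ -
          (∫ v, φ₁ v.1 ∂μ - ∫ v, φ₂ v.2 ∂μ) ^ 2 := fun μ hμ => by
    rw [integral_sub_mean_sq (b₁.sub b₂), integral_sub_sq_coupling h₁ h₂,
      integral_sub (b₁.integrable μ) (b₂.integrable μ)]
  rw [key _ hp]
  refine Tendsto.congr' ?_ ((((lf _ h₁.pow_two).add (lc _ h₂.pow_two)).sub (hmix.const_mul 2)).sub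
    (((lf _ h₁).sub (lc _ h₂)).pow 2))
  filter_upwards [hs] with z hz
  exact (key _ (h.isProb_rule hz)).symm

/-- The conditional mean of the scaled error at time `n + 1` is asymptotically the scaled error at
time `n` of the pulled back functions. -/
lemma tendsto_sqrt_rule_sub_werr [∀ N n, IsMarkovKernel (R N n)]
    (h : IsCoupledFilter G ηf ηc Mf Mc η Ψ) (n : ℕ) {φ₁ φ₂ : X → ℝ}
    (h₁ : BddMeas φ₁) (h₂ : BddMeas φ₂) :
    Tendsto (fun z : Σ N : ℕ, Fin N → X × X =>
        √(z.1 : ℝ) * (∫ v, (φ₁ v.1 - φ₂ v.2) ∂(Ψ z.1 n z.2) -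
          ∫ v, (φ₁ v.1 - φ₂ v.2) ∂(η (n + 1))) -
        werr (η n) (backStep (G n) (Mf (n + 1)) (eta G ηf Mf n) φ₁)
          (backStep (G n) (Mc (n + 1)) (eta G ηc Mc n) φ₂) z)
      (whp fun N => lastLaw G (η 0) (Ψ N) (R N) n) (𝓝 0) := by
  have := h.isMarkov_f
  have := h.isMarkov_c
  have := h.isProb_eta_f n
  have := h.isProb_eta_c n
  have := h.isProb_eta_f (n + 1)
  have hGm := h.measurable_potential
  have hGb := h.bounded_potential
  have hs := h.eventually_survives_lastLaw (R := R) n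
  have t₁ := tendsto_sqrt_rule_sub_backStep h h.isMarginal_fst hs (h.marginalLLN n).1 h₁
  have t₂ := tendsto_sqrt_rule_sub_backStep h h.isMarginal_snd hs (h.marginalLLN n).2 h₂
  have t := t₁.sub t₂
  rw [sub_zero] at t
  refine t.congr' ?_
  filter_upwards [hs] with z hz
  have := h.isProb_rule hz
  have := isProbabilityMeasure_empirical hz.pos z.2
  have b₁ := h₁.comp (measurable_fst (α := X) (β := X))
  have b₂ := h₂.comp (measurable_snd (α := X) (β := X))
  have k₁ : BddMeas (backStep (G n) (Mf (n + 1)) (eta G ηf Mf n) φ₁) :=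
    h₁.backStep (hGm n) (hGb n)
  have k₂ : BddMeas (backStep (G n) (Mc (n + 1)) (eta G ηc Mc n) φ₂) :=
    h₂.backStep (hGm n) (hGb n)
  rw [werr, integral_sub_coupling (h.isCoupling (n + 1)) h₁ h₂,
    integral_sub_coupling (h.isCoupling n) k₁ k₂,
    integral_backStep (hGm n) (hGb n) (h.isMarginal_fst.lintegral_eta_ne_zero hGb n) h₁,
    integral_backStep (hGm n) (hGb n) (h.isMarginal_snd.lintegral_eta_ne_zero hGb n) h₂,
    integral_sub (b₁.integrable _) (b₂.integrable _),
    integral_sub ((k₁.comp measurable_fst).integrable _) ((k₂.comp measurable_snd).integrable _)]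
  ring

lemma norm_exp_mul_exp_le (a : ℝ) {b : ℝ} (hb : 0 ≤ b) :
    ‖Complex.exp (a * Complex.I) * Complex.exp ((-b / 2 : ℝ) : ℂ)‖ ≤ 1 := by
  rw [norm_mul, Complex.norm_exp_ofReal_mul_I, one_mul, Complex.norm_exp_ofReal,
    Real.exp_le_one_iff]
  linarith

/-- The central limit theorem in terms of characteristic functions. The class `F` of test functions
has to be stable under pulling back along the two Feynman-Kac models, and the mixed moments of the
conditional sampling law have to converge for test functions from this class. -/
theorem tendsto_charFun_werr [∀ N n, IsMarkovKernel (R N n)]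
    (h : IsCoupledFilter G ηf ηc Mf Mc η Ψ) {F : (X → ℝ) → Prop}
    (hF : ∀ φ, F φ → BddMeas φ)
    (hFf : ∀ n φ, F φ → F (backStep (G n) (Mf (n + 1)) (eta G ηf Mf n) φ))
    (hFc : ∀ n φ, F φ → F (backStep (G n) (Mc (n + 1)) (eta G ηc Mc n) φ))
    (hmix : ∀ n φ₁ φ₂, F φ₁ → F φ₂ →
      Tendsto (fun z : Σ N : ℕ, Fin N → X × X => ∫ v, φ₁ v.1 * φ₂ v.2 ∂(Ψ z.1 n z.2))
        (whp fun N => lastLaw G (η 0) (Ψ N) (R N) n) (𝓝 (∫ v, φ₁ v.1 * φ₂ v.2 ∂(η (n + 1)))))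
    (n : ℕ) {φ₁ φ₂ : X → ℝ} (h₁ : F φ₁) (h₂ : F φ₂) (t : ℝ) :
    Tendsto (fun N : ℕ => ∫ v, Complex.exp ((t * werr (η n) φ₁ φ₂ ⟨N, v⟩ : ℝ) * Complex.I)
        ∂(lastLaw G (η 0) (Ψ N) (R N) n)) atTop
      (𝓝 (Complex.exp ((-(t ^ 2 * pairVar G ηf ηc Mf Mc η n φ₁ φ₂) / 2 : ℝ) : ℂ))) := by
  have hexpm : ∀ (n : ℕ) {φ₁ φ₂ : X → ℝ}, BddMeas φ₁ → BddMeas φ₂ → ∀ N : ℕ, Measurable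
      fun v => Complex.exp ((t * werr (η n) φ₁ φ₂ ⟨N, v⟩ : ℝ) * Complex.I) := by
    intro n φ₁ φ₂ h₁ h₂ N
    have := measurable_werr (η := η n) h₁.1 h₂.1 N
    fun_prop
  have hsmall : ∀ C : ℝ, ∀ᶠ N : ℕ in atTop, |t| * (√(N : ℝ))⁻¹ * (2 * C) ≤ 1 := fun C => by
    have : Tendsto (fun N : ℕ => |t| * (√(N : ℝ))⁻¹ * (2 * C)) atTop (𝓝 0) := by
      simpa using (tendsto_inv_sqrt.const_mul |t|).mul_const (2 * C)
    exact this.eventually (ge_mem_nhds one_pos)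
  have herr : ∀ C : ℝ, Tendsto (fun N : ℕ => 2 * (|t| * (2 * C)) ^ 3 * (√(N : ℝ))⁻¹)
      atTop (𝓝 0) := fun C => by
    simpa using tendsto_inv_sqrt.const_mul (2 * (|t| * (2 * C)) ^ 3)
  induction n generalizing φ₁ φ₂ with
  | zero =>
    have b := ((hF _ h₁).comp (measurable_fst (β := X))).sub
      ((hF _ h₂).comp (measurable_snd (α := X)))
    obtain ⟨hψ, C, hC⟩ := id b
    have := h.isProb_lim 0
    rw [tendsto_iff_norm_sub_tendsto_zero]
    refine tendsto_of_tendsto_of_tendsto_of_le_of_le' tendsto_const_nhds (herr C)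
      (Eventually.of_forall fun _ => norm_nonneg _) ?_
    filter_upwards [hsmall C, eventually_gt_atTop 0] with N hN hN0
    have := norm_integral_exp_empirical_sub_le (η 0) hψ hC t
      (∫ v, (φ₁ v.1 - φ₂ v.2) ∂(η 0)) hN0 hN
    rw [h.pairVar_zero (hF _ h₁) (hF _ h₂)]
    simpa [werr, lastLaw] using this
  | succ n ih =>
    have hb₁ := hF _ h₁
    have hb₂ := hF _ h₂
    have b := (hb₁.comp (measurable_fst (β := X))).sub (hb₂.comp (measurable_snd (α := X)))
    obtain ⟨hψ, C, hC⟩ := id b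
    have := h.nonempty
    have := h.isProb_lim 0
    have := fun N n => h.isProb_lastLaw (R := R) N n
    have hs := h.eventually_survives_lastLaw (R := R) n
    have ih' := ih (hFf n _ h₁) (hFc n _ h₂)
    set φ₁' := backStep (G n) (Mf (n + 1)) (eta G ηf Mf n) φ₁ with hφ₁'
    set φ₂' := backStep (G n) (Mc (n + 1)) (eta G ηc Mc n) φ₂ with hφ₂'
    set ψ : X × X → ℝ := fun v => φ₁ v.1 - φ₂ v.2 with hψdef
    set c := ∫ v, ψ v ∂(η (n + 1)) with hc
    set V := ∫ v, (ψ v - c) ^ 2 ∂(η (n + 1)) with hV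
    have hV0 : 0 ≤ V := integral_nonneg fun _ => sq_nonneg _
    let cond : (Σ N : ℕ, Fin N → X × X) → ℂ := fun z =>
      ∫ v, Complex.exp ((t * werr (η (n + 1)) φ₁ φ₂ ⟨z.1, v⟩ : ℝ) * Complex.I)
        ∂(stepLaw (G n) (Ψ z.1 n) (R z.1 n) z.2)
    let appr : (Σ N : ℕ, Fin N → X × X) → ℂ := fun z =>
      Complex.exp ((t * werr (η n) φ₁' φ₂' z : ℝ) * Complex.I) *
        Complex.exp ((-(t ^ 2 * V) / 2 : ℝ) : ℂ)
    have happr1 : ∀ z, ‖appr z‖ ≤ 1 := fun z =>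
      norm_exp_mul_exp_le _ (mul_nonneg (sq_nonneg t) hV0)
    have hstep : ∀ N u, IsProbabilityMeasure (stepLaw (G n) (Ψ N n) (R N n) u) := fun N u =>
      isProbabilityMeasure_stepLaw ((h.isSamplingRule N).isProbabilityMeasure n) _ u
    have hcond1 : ∀ z, ‖cond z‖ ≤ 1 := fun z => by
      have := hstep z.1 z.2
      refine (norm_integral_le_integral_norm _).trans ?_
      simp_rw [Complex.norm_exp_ofReal_mul_I]
      simp
    -- conditionally on the configuration at time `n`, the error is asymptotically Gaussian
    have hdiff : Tendsto (fun z => cond z - appr z)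
        (whp fun N => lastLaw G (η 0) (Ψ N) (R N) n) (𝓝 0) := by
      let mid : (Σ N : ℕ, Fin N → X × X) → ℂ := fun z =>
        Complex.exp ((t * (√(z.1 : ℝ) * (∫ x, ψ x ∂(Ψ z.1 n z.2) - c)) : ℝ) * Complex.I) *
          Complex.exp (((-(t ^ 2 * ∫ x, (ψ x - ∫ y, ψ y ∂(Ψ z.1 n z.2)) ^ 2 ∂(Ψ z.1 n z.2)) / 2
            : ℝ) : ℂ))
      have hd1 : Tendsto (fun z => cond z - mid z)
          (whp fun N => lastLaw G (η 0) (Ψ N) (R N) n) (𝓝 0) := by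
        have hN := tendsto_fst_whp (P := fun N => lastLaw G (η 0) (Ψ N) (R N) n)
        rw [tendsto_zero_iff_norm_tendsto_zero]
        refine tendsto_of_tendsto_of_tendsto_of_le_of_le' tendsto_const_nhds ((herr C).comp hN)
          (Eventually.of_forall fun _ => norm_nonneg _) ?_
        filter_upwards [hs, hN.eventually (hsmall C)] with z hz hz1
        have := h.isProb_rule hz
        have := norm_integral_exp_empirical_sub_le (Ψ z.1 n z.2) hψ hC t c hz.pos hz1
        simp only [cond, mid, stepLaw_of_survives hz]
        exact this
      have hd2 : Tendsto (fun z => mid z - appr z)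
          (whp fun N => lastLaw G (η 0) (Ψ N) (R N) n) (𝓝 0) := by
        have e1 := h.tendsto_sqrt_rule_sub_werr (R := R) n hb₁ hb₂
        have e2 := h.tendsto_rule_variance hb₁ hb₂ (hmix n _ _ h₁ h₂)
        have cont1 : Continuous fun x : ℝ => Complex.exp ((t * x : ℝ) * Complex.I) := by fun_prop
        have cont2 : Continuous fun x : ℝ => Complex.exp ((-(t ^ 2 * x) / 2 : ℝ) : ℂ) := by
          fun_prop
        have f1 := (cont1.tendsto 0).comp e1
        have f2 := (cont2.tendsto V).comp e2
        have f3 := (f1.mul f2).sub_const (Complex.exp ((-(t ^ 2 * V) / 2 : ℝ) : ℂ))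
        simp only [mul_zero, Complex.ofReal_zero, zero_mul, Complex.exp_zero, one_mul,
          sub_self] at f3
        rw [tendsto_zero_iff_norm_tendsto_zero] at f3 ⊢
        refine f3.congr fun z => ?_
        have : mid z - appr z = Complex.exp ((t * werr (η n) φ₁' φ₂' z : ℝ) * Complex.I) *
            (Complex.exp ((t * (√(z.1 : ℝ) * (∫ x, ψ x ∂(Ψ z.1 n z.2) - c) -
              werr (η n) φ₁' φ₂' z) : ℝ) * Complex.I) *
              Complex.exp (((-(t ^ 2 * ∫ x, (ψ x - ∫ y, ψ y ∂(Ψ z.1 n z.2)) ^ 2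
                ∂(Ψ z.1 n z.2)) / 2 : ℝ) : ℂ)) - Complex.exp ((-(t ^ 2 * V) / 2 : ℝ) : ℂ)) := by
          rw [mul_sub, ← mul_assoc, ← Complex.exp_add, ← add_mul, ← Complex.ofReal_add]
          simp only [mid, appr]
          congr 5
          ring
        rw [this, norm_mul, Complex.norm_exp_ofReal_mul_I, one_mul]
        rfl
      simpa using hd1.add hd2
    have hlim := tendsto_integral_of_tendsto_whp (C := 2) (fun z => by
      refine (norm_sub_le _ _).trans ?_
      have := hcond1 z
      have := happr1 z
      norm_num
      linarith) hdiff
    have hih := ih'.mul_const (Complex.exp ((-(t ^ 2 * V) / 2 : ℝ) : ℂ))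
    rw [← Complex.exp_add, ← Complex.ofReal_add] at hih
    have hfin := hlim.add hih
    rw [zero_add] at hfin
    have hval : -(t ^ 2 * pairVar G ηf ηc Mf Mc η n φ₁' φ₂') / 2 + -(t ^ 2 * V) / 2 =
        -(t ^ 2 * pairVar G ηf ηc Mf Mc η (n + 1) φ₁ φ₂) / 2 := by
      rw [h.pairVar_succ n hb₁ hb₂]
      ring
    rw [hval] at hfin
    refine hfin.congr fun N => ?_
    have hκ : Measurable fun u => cond ⟨N, u⟩ := by
      let κ : Kernel (Fin N → X × X) (Fin N → X × X) := ⟨stepLaw (G n) (Ψ N n) (R N n),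
        (h.isSamplingRule N).measurable_stepLaw h.measurable_potential n⟩
      have : IsMarkovKernel κ := ⟨fun u => hstep N u⟩
      exact ((hexpm (n + 1) hb₁ hb₂ N).stronglyMeasurable.integral_kernel (κ := κ)).measurable
    have happrm : Measurable fun u => appr ⟨N, u⟩ :=
      (hexpm n (hF _ (hFf n _ h₁)) (hF _ (hFc n _ h₂)) N).mul_const _
    rw [integral_lastLaw_succ h.measurable_potential (h.isSamplingRule N) n
      (hexpm (n + 1) hb₁ hb₂ N) (C := 1) (fun v => (Complex.norm_exp_ofReal_mul_I _).le),
      integral_sub (Integrable.of_bound hκ.aestronglyMeasurable 1 (ae_of_all _ fun u => hcond1 _))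
      (Integrable.of_bound happrm.aestronglyMeasurable 1 (ae_of_all _ fun u => happr1 _)),
      ← integral_mul_const]
    exact sub_add_cancel _ _

/-- Convergence of the characteristic functions gives the central limit theorem for the particle
system, by Lévy's theorem. -/
theorem errorCLT [∀ N n, IsMarkovKernel (R N n)]
    (h : IsCoupledFilter G ηf ηc Mf Mc η Ψ) {n : ℕ} {φ : X → ℝ} (hφ : BddMeas φ)
    (hclt : ∀ t : ℝ, Tendsto (fun N : ℕ =>
        ∫ v, Complex.exp ((t * werr (η n) φ φ ⟨N, v⟩ : ℝ) * Complex.I)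
          ∂(lastLaw G (η 0) (Ψ N) (R N) n)) atTop
      (𝓝 (Complex.exp ((-(t ^ 2 * pairVar G ηf ηc Mf Mc η n φ φ) / 2 : ℝ) : ℂ)))) :
    ErrorCLT n (fun N => particleLaw G (η 0) (Ψ N) (R N) n) (η n) φ
      (asympVar G ηf ηc Mf Mc η n φ) := by
  have := h.nonempty
  have := h.isProb_lim 0
  have hp : ∀ N, IsProbabilityMeasure (particleLaw G (η 0) (Ψ N) (R N) n) := fun N =>
    isProbabilityMeasure_particleLaw h.measurable_potential (h.isSamplingRule N) n
  have hw := fun N => measurable_werr (η := η n) hφ.1 hφ.1 N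
  have hlast : ∀ N, Measurable fun u : Fin (n + 1) → Fin N → X × X => u (Fin.last n) :=
    fun N => measurable_pi_apply _
  have hm : ∀ N, Measurable (scaledError n N (η n) φ) := fun N => (hw N).comp (hlast N)
  refine ⟨hp, ⟨fun N => (hm N).aemeasurable, aemeasurable_id, ?_⟩⟩
  refine ProbabilityMeasure.tendsto_iff_tendsto_charFun.2 fun t => ?_
  simp only [ProbabilityMeasure.coe_mk, Measure.map_id, charFun_gaussianReal]
  have hv : 0 ≤ asympVar G ηf ηc Mf Mc η n φ :=
    Finset.sum_nonneg fun p _ => integral_nonneg fun _ => sq_nonneg _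
  have e : Complex.exp (t * ((0 : ℝ) : ℂ) * Complex.I -
      (((asympVar G ηf ηc Mf Mc η n φ).toNNReal : ℝ) : ℂ) * t ^ 2 / 2) =
      Complex.exp ((-(t ^ 2 * pairVar G ηf ηc Mf Mc η n φ φ) / 2 : ℝ) : ℂ) := by
    rw [Real.coe_toNNReal _ hv]
    congr 1
    have : asympVar G ηf ηc Mf Mc η n φ = pairVar G ηf ηc Mf Mc η n φ φ := rfl
    rw [this]
    push_cast
    ring
  rw [e]
  refine (hclt t).congr fun N => ?_
  have hexp : Measurable fun v => Complex.exp ((t * werr (η n) φ φ ⟨N, v⟩ : ℝ) * Complex.I) := by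
    have := hw N
    fun_prop
  rw [charFun_apply_real, integral_map (hm N).aemeasurable (by fun_prop),
    ← map_last_particleLaw h.measurable_potential (h.isSamplingRule N),
    integral_map (hlast N).aemeasurable hexp.aestronglyMeasurable]
  refine integral_congr_ae (ae_of_all _ fun u => ?_)
  simp only [Complex.ofReal_mul]
  rfl

end IsCoupledFilter
end clt

/-! ### Independent resampling of the pairs -/

section independent

lemma lintegral_withDensity_bind_apply {T : Type*} [MeasurableSpace T] {μ : Measure S}
    {f : S → ℝ≥0∞} (hf : Measurable f) (κ : Kernel S T) {B : Set T} (hB : MeasurableSet B) :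
    (μ.withDensity f).bind κ B = ∫⁻ x, f x * κ x B ∂μ := by
  rw [Measure.bind_apply hB κ.aemeasurable,
    lintegral_withDensity_eq_lintegral_mul _ hf (Kernel.measurable_coe κ hB)]
  rfl

lemma PhiS_apply {g : X → ℝ≥0} (hg : Measurable g) (M : Kernel X X) (μ : Measure X) {B : Set X}
    (hB : MeasurableSet B) :
    PhiS g M μ B = (∫⁻ x, (g x : ℝ≥0∞) ∂μ)⁻¹ * ∫⁻ x, g x * M x B ∂μ := by
  rw [PhiS, Measure.smul_apply, lintegral_withDensity_bind_apply (by fun_prop) M hB, smul_eq_mul]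

lemma measurable_PhiS {g : X → ℝ≥0} (hg : Measurable g) (M : Kernel X X) :
    Measurable (PhiS g M) := by
  refine Measure.measurable_measure.2 fun B hB => ?_
  simp_rw [PhiS_apply hg M _ hB]
  have h1 : Measurable fun x => (g x : ℝ≥0∞) := by fun_prop
  exact (Measure.measurable_lintegral h1).inv.mul
    (Measure.measurable_lintegral (h1.mul (Kernel.measurable_coe M hB)))

/-- Two independent Feynman-Kac transitions are one Feynman-Kac transition on the product space. -/
lemma PhiS_prod {g : X → ℝ≥0} (hgm : Measurable g) (hg : ∃ C : ℝ≥0, ∀ x, g x ≤ C)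
    (M₁ M₂ : Kernel X X) [IsMarkovKernel M₁] [IsMarkovKernel M₂] {μ₁ μ₂ : Measure X}
    [IsFiniteMeasure μ₁] [IsFiniteMeasure μ₂] (h₁ : ∫⁻ x, (g x : ℝ≥0∞) ∂μ₁ ≠ 0)
    (h₂ : ∫⁻ x, (g x : ℝ≥0∞) ∂μ₂ ≠ 0) :
    (PhiS g M₁ μ₁).prod (PhiS g M₂ μ₂) =
      PhiS (fun u : X × X => g u.1 * g u.2) (M₁ ∥ₖ M₂) (μ₁.prod μ₂) := by
  have := isProbabilityMeasure_PhiS (M := M₁) hg h₁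
  have := isProbabilityMeasure_PhiS (M := M₂) hg h₂
  refine Measure.prod_eq fun A B hA hB => ?_
  have e1 : ∀ u : X × X, ((g u.1 * g u.2 : ℝ≥0) : ℝ≥0∞) * (M₁ ∥ₖ M₂) u (A ×ˢ B) =
      (g u.1 * M₁ u.1 A) * (g u.2 * M₂ u.2 B) := fun u => by
    rw [Kernel.parallelComp_apply, Measure.prod_prod, ENNReal.coe_mul]
    ring
  rw [PhiS_apply (by fun_prop) _ _ (hA.prod hB), PhiS_apply hgm _ _ hA, PhiS_apply hgm _ _ hB]
  simp_rw [e1, ENNReal.coe_mul]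
  have m1 : Measurable fun x => (g x : ℝ≥0∞) := by fun_prop
  rw [lintegral_prod_mul (f := fun x => (g x : ℝ≥0∞) * M₁ x A)
      (g := fun x => (g x : ℝ≥0∞) * M₂ x B)
      (m1.mul (Kernel.measurable_coe M₁ hA)).aemeasurable
      (m1.mul (Kernel.measurable_coe M₂ hB)).aemeasurable,
    lintegral_prod_mul (f := fun x => (g x : ℝ≥0∞)) (g := fun x => (g x : ℝ≥0∞))
      m1.aemeasurable m1.aemeasurable,
    ENNReal.mul_inv (Or.inl h₁) (Or.inl (lintegral_coe_ne_top hg))]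
  ring

lemma PhiI_eq_PhiS (g : X → ℝ≥0) (K : Kernel (X × X) (X × X)) (μ : Measure (X × X)) :
    PhiI g K μ = PhiS (fun u : X × X => g u.1 * g u.2) K μ := by
  simp [PhiI, PhiS]

/-- Independent pair resampling of a product measure is a coupling of the two marginal
Feynman-Kac transitions. -/
lemma isCoupling_PhiI {g : X → ℝ≥0} (hgm : Measurable g) (hg : ∃ C : ℝ≥0, ∀ x, g x ≤ C)
    {M₁ M₂ : Kernel X X} [IsMarkovKernel M₁] [IsMarkovKernel M₂] {K : Kernel (X × X) (X × X)}
    (hK : ∀ u, IsCoupling (K u) (M₁ u.1) (M₂ u.2)) {μ₁ μ₂ : Measure X}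
    [IsFiniteMeasure μ₁] [IsFiniteMeasure μ₂] (h₁ : ∫⁻ x, (g x : ℝ≥0∞) ∂μ₁ ≠ 0)
    (h₂ : ∫⁻ x, (g x : ℝ≥0∞) ∂μ₂ ≠ 0) :
    IsCoupling (PhiI g K (μ₁.prod μ₂)) (PhiS g M₁ μ₁) (PhiS g M₂ μ₂) := by
  have p1 := isProbabilityMeasure_PhiS (M := M₁) hg h₁
  have p2 := isProbabilityMeasure_PhiS (M := M₂) hg h₂
  have hgg : Measurable fun u : X × X => g u.1 * g u.2 := by fun_prop
  -- the projections only see the marginals of the kernel, as if the kernel were `M₁ ∥ₖ M₂`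
  have hKf : ∀ (B : Set X), MeasurableSet B → ∀ u,
      K u (Prod.fst ⁻¹' B) = (M₁ ∥ₖ M₂) u (Prod.fst ⁻¹' B) := fun B hB u => by
    rw [Kernel.parallelComp_apply, ← Measure.map_apply measurable_fst hB,
      ← Measure.map_apply measurable_fst hB, (hK u).1, ← Measure.fst, Measure.fst_prod]
  have hKc : ∀ (B : Set X), MeasurableSet B → ∀ u,
      K u (Prod.snd ⁻¹' B) = (M₁ ∥ₖ M₂) u (Prod.snd ⁻¹' B) := fun B hB u => by
    rw [Kernel.parallelComp_apply, ← Measure.map_apply measurable_snd hB,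
      ← Measure.map_apply measurable_snd hB, (hK u).2, ← Measure.snd, Measure.snd_prod]
  rw [PhiI_eq_PhiS]
  constructor
  · calc _ = (PhiS (fun u : X × X => g u.1 * g u.2) (M₁ ∥ₖ M₂) (μ₁.prod μ₂)).map Prod.fst := by
          ext B hB
          rw [Measure.map_apply measurable_fst hB, Measure.map_apply measurable_fst hB,
            PhiS_apply hgg _ _ (measurable_fst hB), PhiS_apply hgg _ _ (measurable_fst hB)]
          simp_rw [hKf B hB]
      _ = _ := by
          rw [← PhiS_prod hgm hg M₁ M₂ h₁ h₂, ← Measure.fst, Measure.fst_prod]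
  · calc _ = (PhiS (fun u : X × X => g u.1 * g u.2) (M₁ ∥ₖ M₂) (μ₁.prod μ₂)).map Prod.snd := by
          ext B hB
          rw [Measure.map_apply measurable_snd hB, Measure.map_apply measurable_snd hB,
            PhiS_apply hgg _ _ (measurable_snd hB), PhiS_apply hgg _ _ (measurable_snd hB)]
          simp_rw [hKc B hB]
      _ = _ := by
          rw [← PhiS_prod hgm hg M₁ M₂ h₁ h₂, ← Measure.snd, Measure.snd_prod]

lemma measurable_empirical {N : ℕ} {T : Type*} [MeasurableSpace T] {f : Fin N → T → S}
    (hf : ∀ i, Measurable (f i)) : Measurable fun u : T => empirical fun i => f i u := by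
  refine Measure.measurable_measure.2 fun B hB => ?_
  simp only [empirical, Measure.smul_apply, Measure.finsetSum_apply, smul_eq_mul]
  refine (Finset.measurable_sum _ fun i _ => ?_).const_mul _
  simp_rw [Measure.dirac_apply' _ hB]
  exact (measurable_one.indicator hB).comp (hf i)

lemma integral_prod_empirical {N : ℕ} (u : Fin N → X × X) {H : (X × X) × (X × X) → ℝ}
    (hH : BddMeas H) : ∫ y, H y ∂((empirical u).prod (empirical u)) =
      IsCoupledFilter.vstat H ⟨N, u⟩ := by
  rw [integral_prod _ (hH.integrable _), IsCoupledFilter.vstat_mk]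
  have m : ∀ x, Measurable fun y => H (x, y) := fun x => hH.1.comp measurable_prodMk_left
  simp_rw [integral_empirical u (m _)]
  have hm := hH.1
  rw [integral_empirical u (by fun_prop)]
  simp_rw [← Finset.mul_sum, mul_assoc]

lemma integral_prod_marginals {μ : Measure (X × X)} [IsFiniteMeasure μ]
    {H : X × X → ℝ} (hH : Measurable H) :
    ∫ y, H y ∂((μ.map Prod.fst).prod (μ.map Prod.snd)) =
      ∫ y, H (y.1.1, y.2.2) ∂(μ.prod μ) := by
  rw [Measure.map_prod_map _ _ measurable_fst measurable_snd,
    integral_map (by fun_prop) hH.aestronglyMeasurable]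
  rfl

lemma prod_empirical_marginals {N : ℕ} (u : Fin N → X × X) :
    (empirical fun i => (u i).1).prod (empirical fun i => (u i).2) =
      ((empirical u).map Prod.fst).prod ((empirical u).map Prod.snd) := by
  rw [map_empirical u measurable_fst, map_empirical u measurable_snd]

namespace IsCoupledFilter

variable {G : ℕ → X → ℝ≥0} {ηf ηc : Measure X} {Mf Mc : ℕ → Kernel X X}
  {η : ℕ → Measure (X × X)} {Ψ : ∀ N : ℕ, ℕ → (Fin N → X × X) → Measure (X × X)}
  {R : ∀ N : ℕ, ℕ → Kernel (Fin N → X × X) (Fin N → X × X)}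

lemma bddMeas_prod_potential (h : IsCoupledFilter G ηf ηc Mf Mc η Ψ) (n : ℕ) :
    BddMeas fun u : X × X => (G n u.1 : ℝ) * G n u.2 := by
  obtain ⟨C, hC⟩ := h.bounded_potential n
  have := BddMeas.of_nnreal (h.measurable_potential n) hC
  exact (this.comp measurable_fst).mul (this.comp measurable_snd)

lemma bounded_prod_potential (h : IsCoupledFilter G ηf ηc Mf Mc η Ψ) (n : ℕ) :
    ∃ C : ℝ≥0, ∀ u : X × X, G n u.1 * G n u.2 ≤ C := by
  obtain ⟨C, hC⟩ := h.bounded_potential n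
  exact ⟨C * C, fun u => mul_le_mul' (hC _) (hC _)⟩

/-- Convergence of the products of the two marginal empirical measures carries over to their image
under a Feynman-Kac transition on the product space. -/
lemma tendsto_integral_PhiS_prod [∀ N n, IsMarkovKernel (R N n)]
    (h : IsCoupledFilter G ηf ηc Mf Mc η Ψ) {n : ℕ} (L : Kernel (X × X) (X × X))
    [IsMarkovKernel L]
    (hU : ∀ H : X × X → ℝ, BddMeas H →
      Tendsto (fun z : Σ N : ℕ, Fin N → X × X => ∫ y, H y
          ∂((empirical fun i => (z.2 i).1).prod (empirical fun i => (z.2 i).2)))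
        (whp fun N => lastLaw G (η 0) (Ψ N) (R N) n)
        (𝓝 (∫ y, H y ∂((eta G ηf Mf n).prod (eta G ηc Mc n)))))
    {H : X × X → ℝ} (hH : BddMeas H) :
    Tendsto (fun z : Σ N : ℕ, Fin N → X × X =>
        ∫ y, H y ∂(PhiS (fun u : X × X => G n u.1 * G n u.2) L
          ((empirical fun i => (z.2 i).1).prod (empirical fun i => (z.2 i).2))))
      (whp fun N => lastLaw G (η 0) (Ψ N) (R N) n)
      (𝓝 (∫ y, H y ∂(PhiS (fun u : X × X => G n u.1 * G n u.2) L
          ((eta G ηf Mf n).prod (eta G ηc Mc n))))) := by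
  have hGm := h.measurable_potential n
  have hGb := h.bounded_potential
  have := h.isProb_eta_f n
  have := h.isProb_eta_c n
  have hgg := h.bddMeas_prod_potential n
  have hm : Measurable fun u : X × X => G n u.1 * G n u.2 := by fun_prop
  simp_rw [integral_PhiS hm (h.bounded_prod_potential n) hH, NNReal.coe_mul]
  refine (hU _ (hgg.mul (hH.integral_kernel L))).div (hU _ hgg) ?_
  rw [integral_prod_mul (fun x => (G n x : ℝ)) (fun x => (G n x : ℝ))]
  exact mul_ne_zero (h.isMarginal_fst.integral_pos h.measurable_potential hGb n).ne'
    (h.isMarginal_snd.integral_pos h.measurable_potential hGb n).ne'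

/-- The product of the two marginal empirical measures converges to the product of the predictors,
for every bounded measurable function on the product space: it is a V-statistic. -/
theorem tendsto_prod_empirical [∀ N n, IsMarkovKernel (R N n)]
    (h : IsCoupledFilter G ηf ηc Mf Mc η Ψ) (n : ℕ) : ∀ H : X × X → ℝ, BddMeas H →
      Tendsto (fun z : Σ N : ℕ, Fin N → X × X => ∫ y, H y
          ∂((empirical fun i => (z.2 i).1).prod (empirical fun i => (z.2 i).2)))
        (whp fun N => lastLaw G (η 0) (Ψ N) (R N) n)
        (𝓝 (∫ y, H y ∂((eta G ηf Mf n).prod (eta G ηc Mc n)))) := by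
  have := h.isMarkov_f
  have := h.isMarkov_c
  have hr : Tendsto (fun N : ℕ => (1 : ℝ) ^ 2 / N) atTop (𝓝 0) := by
    simpa using tendsto_inv_atTop_nhds_zero_nat (𝕜 := ℝ)
  have hv : ∀ H : X × X → ℝ, BddMeas H → ∀ z : Σ N : ℕ, Fin N → X × X, ∫ y, H y
      ∂((empirical fun i => (z.2 i).1).prod (empirical fun i => (z.2 i).2)) =
      vstat (fun y => H (y.1.1, y.2.2)) z := fun H hH z => by
    rw [prod_empirical_marginals, integral_prod_marginals hH.1,
      integral_prod_empirical z.2 (hH.comp (by fun_prop))]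
  induction n with
  | zero =>
    intro H hH
    have := h.isProb_lim 0
    have key := h.tendsto_vstat_zero (R := R) (H := fun y => H (y.1.1, y.2.2))
      (hH.comp (by fun_prop)) (r := fun _ => 1) hr
    rw [← integral_prod_marginals hH.1, (h.isCoupling 0).1, (h.isCoupling 0).2] at key
    simp only [one_mul] at key
    simp_rw [hv H hH]
    simpa using key.add_const (∫ y, H y ∂((eta G ηf Mf 0).prod (eta G ηc Mc 0)))
  | succ n ih =>
    intro H hH
    have := h.isProb_f
    have := h.isProb_c
    have := h.isProb_eta_f n
    have := h.isProb_eta_c n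
    have hGm := h.measurable_potential n
    have hGb := h.bounded_potential
    have hs := h.eventually_survives_lastLaw (R := R) n
    have t := h.tendsto_integral_PhiS_prod (Mf (n + 1) ∥ₖ Mc (n + 1)) ih hH
    rw [← PhiS_prod hGm (hGb n) _ _ (h.isMarginal_fst.lintegral_eta_ne_zero hGb n)
      (h.isMarginal_snd.lintegral_eta_ne_zero hGb n), ← eta_succ hGb h.pos_f,
      ← eta_succ hGb h.pos_c] at t
    have key := h.tendsto_vstat_succ (H := fun y => H (y.1.1, y.2.2))
      (hH.comp (by fun_prop)) (r := fun _ => 1) hr hs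
      (c := ∫ y, H y ∂((eta G ηf Mf (n + 1)).prod (eta G ηc Mc (n + 1)))) (by
        have t' := t.sub_const (∫ y, H y ∂((eta G ηf Mf (n + 1)).prod (eta G ηc Mc (n + 1))))
        rw [sub_self] at t'
        refine t'.congr' ?_
        filter_upwards [hs] with z hz
        have := h.isProb_rule hz
        have hz' := (survives_iff hGm z.2).1 hz
        rw [one_mul, ← integral_prod_marginals hH.1, (h.isCoupling_rule _ _ _ hz).1,
          (h.isCoupling_rule _ _ _ hz).2, PhiS_prod hGm (hGb n) _ _ hz'.1 hz'.2])
    simp only [one_mul] at key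
    simp_rw [hv H hH]
    simpa using key.add_const (∫ y, H y ∂((eta G ηf Mf (n + 1)).prod (eta G ηc Mc (n + 1))))

end IsCoupledFilter

section limitI
variable {G : ℕ → X → ℝ≥0} {ηf ηc : Measure X} [IsProbabilityMeasure ηf] [IsProbabilityMeasure ηc]
  {Mf Mc : ℕ → Kernel X X} [∀ n, IsMarkovKernel (Mf n)] [∀ n, IsMarkovKernel (Mc n)]
  {η₀ : Measure (X × X)} {K : ℕ → Kernel (X × X) (X × X)}

/-- The limit of independent pair resampling couples the predictors, and the particle system fits
the standing assumptions. -/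
lemma isCoupledFilter_limI (hGm : ∀ n, Measurable (G n)) (hGb : ∀ n, ∃ C : ℝ≥0, ∀ x, G n x ≤ C)
    (hf : ∀ n, 0 < gam G ηf Mf n Set.univ) (hc : ∀ n, 0 < gam G ηc Mc n Set.univ)
    (hη₀ : IsCoupling η₀ ηf ηc)
    (hK : ∀ n, 1 ≤ n → ∀ u : X × X, IsCoupling (K n u) (Mf n u.1) (Mc n u.2)) :
    IsCoupledFilter G ηf ηc Mf Mc (limI G ηf ηc Mf Mc η₀ K) (fun _ p u => PhiI (G p) (K (p + 1))
      ((empirical (fun i => (u i).1)).prod (empirical (fun i => (u i).2)))) where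
  measurable_potential := hGm
  bounded_potential := hGb
  isProb_f := inferInstance
  isProb_c := inferInstance
  isMarkov_f := inferInstance
  isMarkov_c := inferInstance
  pos_f := hf
  pos_c := hc
  isCoupling n := by
    cases n with
    | zero => rwa [limI, eta_zero, eta_zero]
    | succ n =>
      have := isProbabilityMeasure_eta hGb hf n
      have := isProbabilityMeasure_eta hGb hc n
      rw [limI, eta_succ hGb hf, eta_succ hGb hc]
      exact isCoupling_PhiI (hGm n) (hGb n) (hK (n + 1) (by omega))
        (lintegral_eta_ne_zero hGb hf n) (lintegral_eta_ne_zero hGb hc n)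
  measurable_rule N p := by
    simp_rw [PhiI_eq_PhiS]
    have hm : Measurable fun u : X × X => G p u.1 * G p u.2 := by
      have := hGm p
      fun_prop
    refine (measurable_PhiS hm _).comp ?_
    simp_rw [prod_empirical_marginals, Measure.map_prod_map _ _ measurable_fst measurable_snd]
    refine (Measure.measurable_map _ (by fun_prop)).comp ?_
    refine Measure.measurable_measure.2 fun B hB => ?_
    simp_rw [Measure.prod_apply hB, empirical, lintegral_smul_measure,
      lintegral_finsetSum_measure, lintegral_dirac' _ (measurable_measure_prodMk_left hB)]
    simp only [Measure.smul_apply, Measure.finsetSum_apply, smul_eq_mul,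
      Measure.dirac_apply' _ (measurable_prodMk_left hB)]
    refine (Finset.measurable_sum _ fun i _ => (Finset.measurable_sum _ fun j _ => ?_).const_mul
      _).const_mul _
    exact (measurable_one.indicator hB).comp
      (by fun_prop : Measurable fun u : Fin N → X × X => (u i, u j))
  isCoupling_rule N p u hu := by
    have hu' := (survives_iff (hGm p) u).1 hu
    exact isCoupling_PhiI (hGm p) (hGb p) (hK (p + 1) (by omega)) hu'.1 hu'.2

end limitI

/-- The central limit theorem for independent pair resampling. -/
theorem errorCLT_lawI (G : ℕ → X → ℝ≥0) (hGm : ∀ n, Measurable (G n))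
    (hGb : ∀ n, ∃ C : ℝ≥0, ∀ x, G n x ≤ C)
    (ηf ηc : Measure X) [IsProbabilityMeasure ηf] [IsProbabilityMeasure ηc]
    (Mf Mc : ℕ → Kernel X X) [∀ n, IsMarkovKernel (Mf n)] [∀ n, IsMarkovKernel (Mc n)]
    (hf : ∀ n, 0 < gam G ηf Mf n Set.univ) (hc : ∀ n, 0 < gam G ηc Mc n Set.univ)
    (η₀ : Measure (X × X)) (hη₀ : IsCoupling η₀ ηf ηc)
    (K : ℕ → Kernel (X × X) (X × X)) [∀ n, IsMarkovKernel (K n)]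
    (hK : ∀ n, 1 ≤ n → ∀ u : X × X, IsCoupling (K n u) (Mf n u.1) (Mc n u.2))
    (R : ∀ N : ℕ, ℕ → Kernel (Fin N → X × X) (Fin N → X × X)) [∀ N n, IsMarkovKernel (R N n)]
    {φ : X → ℝ} (hφ : BddMeas φ) (n : ℕ) :
    (∫ u, (φ u.1 - φ u.2) ∂(limI G ηf ηc Mf Mc η₀ K n) =
        ∫ x, φ x ∂(eta G ηf Mf n) - ∫ x, φ x ∂(eta G ηc Mc n)) ∧
      ErrorCLT n (fun N => lawI G η₀ K N (R N) n) (limI G ηf ηc Mf Mc η₀ K n) φ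
        (asympVar G ηf ηc Mf Mc (limI G ηf ηc Mf Mc η₀ K) n φ) := by
  have h := isCoupledFilter_limI hGm hGb hf hc hη₀ hK
  have := h.isProb_eta_f n
  refine ⟨IsCoupledFilter.integral_sub_coupling (h.isCoupling n) hφ hφ, ?_⟩
  refine h.errorCLT (R := R) hφ fun t => h.tendsto_charFun_werr (F := BddMeas) (fun _ => id)
    (fun n φ hφ => hφ.backStep (hGm n) (hGb n)) (fun n φ hφ => hφ.backStep (hGm n) (hGb n))
    (fun n φ₁ φ₂ h₁ h₂ => ?_) n hφ hφ t
  rw [limI]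
  simp_rw [PhiI_eq_PhiS]
  exact h.tendsto_integral_PhiS_prod (K (n + 1)) (h.tendsto_prod_empirical n)
    ((h₁.comp measurable_fst).mul (h₂.comp measurable_snd))

end independent

/-! ### Maximally coupled resampling: marginals and measurability -/

section maximal

section coupling
variable {g : X → ℝ≥0} {μ : Measure (X × X)}

lemma measurable_Ff (hg : Measurable g) : Measurable (Ff g μ) := by unfold Ff; fun_prop
lemma measurable_Fc (hg : Measurable g) : Measurable (Fc g μ) := by unfold Fc; fun_prop
lemma measurable_Fmin (hg : Measurable g) : Measurable (Fmin g μ) :=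
  (measurable_Ff hg).min (measurable_Fc hg)
lemma measurable_Fbarf (hg : Measurable g) : Measurable (Fbarf g μ) :=
  ((measurable_Ff hg).sub (measurable_Fmin hg)).div_const _
lemma measurable_Fbarc (hg : Measurable g) : Measurable (Fbarc g μ) :=
  ((measurable_Fc hg).sub (measurable_Fmin hg)).div_const _

lemma lintegral_Ff (hgm : Measurable g) (hg : ∃ C : ℝ≥0, ∀ x, g x ≤ C) [IsFiniteMeasure μ]
    (h : ∫⁻ w, (g w.1 : ℝ≥0∞) ∂μ ≠ 0) : ∫⁻ w, Ff g μ w ∂μ = 1 := by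
  obtain ⟨C, hC⟩ := hg
  have h' : ∫⁻ w, (g w.1 : ℝ≥0∞) ∂μ ≠ ∞ :=
    lintegral_coe_ne_top (g := fun w : X × X => g w.1) ⟨C, fun w => hC _⟩
  simp_rw [Ff, div_eq_mul_inv]
  rw [lintegral_mul_const _ (by fun_prop), ENNReal.mul_inv_cancel h h']

lemma lintegral_Fc (hgm : Measurable g) (hg : ∃ C : ℝ≥0, ∀ x, g x ≤ C) [IsFiniteMeasure μ]
    (h : ∫⁻ w, (g w.2 : ℝ≥0∞) ∂μ ≠ 0) : ∫⁻ w, Fc g μ w ∂μ = 1 := by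
  obtain ⟨C, hC⟩ := hg
  have h' : ∫⁻ w, (g w.2 : ℝ≥0∞) ∂μ ≠ ∞ :=
    lintegral_coe_ne_top (g := fun w : X × X => g w.2) ⟨C, fun w => hC _⟩
  simp_rw [Fc, div_eq_mul_inv]
  rw [lintegral_mul_const _ (by fun_prop), ENNReal.mul_inv_cancel h h']

/-- The residual of a probability density `a` after removing `a ∧ b`, reweighted by `k ≤ 1`, is
recovered from its normalized version; this includes the degenerate case `∫ a ∧ b = 1`. -/
lemma residual_identity {μ : Measure S} {a b k : S → ℝ≥0∞} (ha : Measurable a)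
    (hb : Measurable b) (hk : Measurable k) (hk1 : ∀ x, k x ≤ 1) (ha1 : ∫⁻ x, a x ∂μ = 1)
    (hb1 : ∫⁻ x, b x ∂μ = 1) :
    ∫⁻ x, min (a x) (b x) * k x ∂μ + (1 - ∫⁻ x, min (a x) (b x) ∂μ) *
      ((∫⁻ x, (a x - min (a x) (b x)) * k x ∂μ) / (∫⁻ x, (a x - min (a x) (b x)) ∂μ) *
      ((∫⁻ x, (b x - min (a x) (b x)) ∂μ) / (∫⁻ x, (b x - min (a x) (b x)) ∂μ))) =
    ∫⁻ x, a x * k x ∂μ := by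
  have hmm : Measurable fun x => min (a x) (b x) := ha.min hb
  have hm1 : ∫⁻ x, min (a x) (b x) ∂μ ≤ 1 := by
    rw [← ha1]
    exact lintegral_mono fun x => min_le_left _ _
  have hmt : ∫⁻ x, min (a x) (b x) ∂μ ≠ ∞ := ne_top_of_le_ne_top ENNReal.one_ne_top hm1
  have ra : ∫⁻ x, (a x - min (a x) (b x)) ∂μ = 1 - ∫⁻ x, min (a x) (b x) ∂μ := by
    rw [lintegral_sub hmm hmt (ae_of_all _ fun x => min_le_left _ _), ha1]
  have rb : ∫⁻ x, (b x - min (a x) (b x)) ∂μ = 1 - ∫⁻ x, min (a x) (b x) ∂μ := by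
    rw [lintegral_sub hmm hmt (ae_of_all _ fun x => min_le_right _ _), hb1]
  have hA : ∫⁻ x, (a x - min (a x) (b x)) * k x ∂μ ≤ 1 - ∫⁻ x, min (a x) (b x) ∂μ := by
    rw [← ra]
    exact lintegral_mono fun x => mul_le_of_le_one_right' (hk1 x)
  have hsum : ∫⁻ x, min (a x) (b x) * k x ∂μ + ∫⁻ x, (a x - min (a x) (b x)) * k x ∂μ =
      ∫⁻ x, a x * k x ∂μ := by
    rw [← lintegral_add_left (f := fun x => min (a x) (b x) * k x) (hmm.mul hk)]
    refine lintegral_congr fun x => ?_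
    rw [← add_mul, add_tsub_cancel_of_le (min_le_left _ _)]
  rw [ra, rb, ← hsum]
  congr 1
  set r := 1 - ∫⁻ x, min (a x) (b x) ∂μ
  rcases eq_or_ne r 0 with h0 | h0
  · rw [h0] at hA ⊢
    rw [zero_mul]
    exact (le_antisymm hA zero_le).symm
  · have hr : r ≠ ∞ := ne_top_of_le_ne_top ENNReal.one_ne_top tsub_le_self
    rw [ENNReal.div_self h0 hr, mul_one, ENNReal.mul_div_cancel h0 hr]

lemma PhiM_apply (hg : Measurable g) (K : Kernel (X × X) (X × X)) {B : Set (X × X)}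
    (hB : MeasurableSet B) :
    PhiM g K μ B = ∫⁻ u, Fmin g μ u * K u B ∂μ + (1 - ∫⁻ u, Fmin g μ u ∂μ) *
      ∫⁻ w, Fbarf g μ w.1 * Fbarc g μ w.2 * K (w.1.1, w.2.2) B ∂(μ.prod μ) := by
  have h1 : Measurable fun w : (X × X) × (X × X) => Fbarf g μ w.1 * Fbarc g μ w.2 :=
    ((measurable_Fbarf hg).comp measurable_fst).mul ((measurable_Fbarc hg).comp measurable_snd)
  rw [PhiM, Measure.add_apply, Measure.smul_apply,
    lintegral_withDensity_bind_apply (measurable_Fmin hg) K hB,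
    lintegral_withDensity_bind_apply h1 (barK K) hB]
  rfl

/-- Maximally coupled resampling yields a coupling of the two marginal Feynman-Kac transitions. -/
lemma isCoupling_PhiM (hgm : Measurable g) (hg : ∃ C : ℝ≥0, ∀ x, g x ≤ C)
    {M₁ M₂ : Kernel X X} [IsMarkovKernel M₁] [IsMarkovKernel M₂] {K : Kernel (X × X) (X × X)}
    (hK : ∀ u, IsCoupling (K u) (M₁ u.1) (M₂ u.2)) [IsFiniteMeasure μ]
    (h₁ : ∫⁻ w, (g w.1 : ℝ≥0∞) ∂μ ≠ 0) (h₂ : ∫⁻ w, (g w.2 : ℝ≥0∞) ∂μ ≠ 0) :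
    IsCoupling (PhiM g K μ) (PhiS g M₁ (μ.map Prod.fst)) (PhiS g M₂ (μ.map Prod.snd)) := by
  have mf := measurable_Ff (μ := μ) hgm
  have mc := measurable_Fc (μ := μ) hgm
  have mm := measurable_Fmin (μ := μ) hgm
  have if1 := lintegral_Ff hgm hg h₁
  have ic1 := lintegral_Fc hgm hg h₂
  constructor
  · ext B hB
    have mk : Measurable fun w : X × X => M₁ w.1 B :=
      (Kernel.measurable_coe M₁ hB).comp measurable_fst
    have eK : ∀ u, K u (Prod.fst ⁻¹' B) = M₁ u.1 B := fun u => by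
      rw [← (hK u).1, Measure.map_apply measurable_fst hB]
    rw [Measure.map_apply measurable_fst hB, PhiM_apply hgm K (measurable_fst hB),
      PhiS_apply hgm M₁ _ hB, lintegral_map (by fun_prop) measurable_fst,
      lintegral_map (by have := Kernel.measurable_coe M₁ hB; fun_prop) measurable_fst]
    simp_rw [eK]
    have e1 : ∀ w : (X × X) × (X × X), Fbarf g μ w.1 * Fbarc g μ w.2 * M₁ w.1.1 B =
        (Fbarf g μ w.1 * M₁ w.1.1 B) * Fbarc g μ w.2 := fun w => by ring
    simp_rw [e1]
    rw [lintegral_prod_mul (f := fun w => Fbarf g μ w * M₁ w.1 B) (g := Fbarc g μ)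
      ((measurable_Fbarf hgm).mul mk).aemeasurable (measurable_Fbarc hgm).aemeasurable]
    have e2 : ∀ w, Fbarf g μ w * M₁ w.1 B = (Ff g μ w - Fmin g μ w) * M₁ w.1 B /
        ∫⁻ w, (Ff g μ w - Fmin g μ w) ∂μ := fun w => by
      rw [Fbarf, div_eq_mul_inv, div_eq_mul_inv]; ring
    simp_rw [e2, Fbarc, div_eq_mul_inv]
    have q1 : Measurable fun w => (Ff g μ w - Fmin g μ w) * M₁ w.1 B := (mf.sub mm).mul mk
    have q2 : Measurable fun w => Fc g μ w - Fmin g μ w := mc.sub mm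
    have q3 : Measurable fun w : X × X => (g w.1 : ℝ≥0∞) * M₁ w.1 B :=
      (hgm.coe_nnreal_ennreal.comp measurable_fst).mul mk
    rw [lintegral_mul_const _ q1, lintegral_mul_const _ q2]
    simp_rw [← div_eq_mul_inv]
    refine (residual_identity mf mc mk (fun _ => prob_le_one) if1 ic1).trans ?_
    simp_rw [Ff, ENNReal.div_eq_inv_mul, mul_assoc]
    rw [lintegral_const_mul _ q3]
  · ext B hB
    have mk : Measurable fun w : X × X => M₂ w.2 B :=
      (Kernel.measurable_coe M₂ hB).comp measurable_snd
    have eK : ∀ u, K u (Prod.snd ⁻¹' B) = M₂ u.2 B := fun u => by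
      rw [← (hK u).2, Measure.map_apply measurable_snd hB]
    rw [Measure.map_apply measurable_snd hB, PhiM_apply hgm K (measurable_snd hB),
      PhiS_apply hgm M₂ _ hB, lintegral_map (by fun_prop) measurable_snd,
      lintegral_map (by have := Kernel.measurable_coe M₂ hB; fun_prop) measurable_snd]
    simp_rw [eK]
    have e1 : ∀ w : (X × X) × (X × X), Fbarf g μ w.1 * Fbarc g μ w.2 * M₂ w.2.2 B =
        Fbarf g μ w.1 * (Fbarc g μ w.2 * M₂ w.2.2 B) := fun w => by ring
    simp_rw [e1]
    rw [lintegral_prod_mul (f := Fbarf g μ) (g := fun w => Fbarc g μ w * M₂ w.2 B)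
      (measurable_Fbarf hgm).aemeasurable ((measurable_Fbarc hgm).mul mk).aemeasurable]
    have e2 : ∀ w, Fbarc g μ w * M₂ w.2 B = (Fc g μ w - Fmin g μ w) * M₂ w.2 B /
        ∫⁻ w, (Fc g μ w - Fmin g μ w) ∂μ := fun w => by
      rw [Fbarc, div_eq_mul_inv, div_eq_mul_inv]; ring
    simp_rw [e2, Fbarf, div_eq_mul_inv]
    have q1 : Measurable fun w => Ff g μ w - Fmin g μ w := mf.sub mm
    have q2 : Measurable fun w => (Fc g μ w - Fmin g μ w) * M₂ w.2 B := (mc.sub mm).mul mk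
    have q3 : Measurable fun w : X × X => (g w.2 : ℝ≥0∞) * M₂ w.2 B :=
      (hgm.coe_nnreal_ennreal.comp measurable_snd).mul mk
    rw [lintegral_mul_const _ q1, lintegral_mul_const _ q2]
    simp_rw [← div_eq_mul_inv]
    have := residual_identity mc mf mk (fun _ => prob_le_one) ic1 if1
    simp_rw [min_comm (Fc g μ _)] at this
    rw [mul_comm (_ / _)]
    refine this.trans ?_
    simp_rw [Fc, ENNReal.div_eq_inv_mul, mul_assoc]
    rw [lintegral_const_mul _ q3]

end coupling

section measurability

/-- The empirical measure as a kernel. -/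
def empKernel (N : ℕ) (S : Type*) [MeasurableSpace S] : Kernel (Fin N → S) S :=
  ⟨empirical, measurable_empirical fun i => measurable_pi_apply i⟩

lemma empKernel_apply {N : ℕ} (u : Fin N → S) : empKernel N S u = empirical u := rfl

instance {N : ℕ} : IsFiniteKernel (empKernel N S) := by
  refine ⟨⟨1, ENNReal.one_lt_top, fun u => ?_⟩⟩
  rw [empKernel_apply]
  rcases Nat.eq_zero_or_pos N with rfl | hN
  · simp [empirical]
  · have := isProbabilityMeasure_empirical hN u
    simp

lemma measurable_PhiM_empirical {g : X → ℝ≥0} (hg : Measurable g)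
    (K : Kernel (X × X) (X × X)) (N : ℕ) :
    Measurable fun u : Fin N → X × X => PhiM g K (empirical u) := by
  let E := empKernel N (X × X)
  have i1 : ∀ {f : (Fin N → X × X) × (X × X) → ℝ≥0∞}, Measurable f →
      Measurable fun u => ∫⁻ w, f (u, w) ∂(empirical u) := fun hf =>
    Measurable.lintegral_kernel_prod_right' (κ := E) hf
  have i2 : ∀ {f : (Fin N → X × X) × ((X × X) × (X × X)) → ℝ≥0∞}, Measurable f →
      Measurable fun u => ∫⁻ w, f (u, w) ∂((empirical u).prod (empirical u)) := fun {f} hf => by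
    have := Measurable.lintegral_kernel_prod_right' (κ := E ×ₖ E) hf
    simp_rw [Kernel.prod_apply] at this
    exact this
  have jf : Measurable fun p : (Fin N → X × X) × (X × X) => Ff g (empirical p.1) p.2 := by
    have := i1 (f := fun p => (g p.2.1 : ℝ≥0∞)) (by fun_prop)
    unfold Ff
    exact (by fun_prop : Measurable fun p : (Fin N → X × X) × (X × X) =>
      (g p.2.1 : ℝ≥0∞)).div (this.comp measurable_fst)
  have jc : Measurable fun p : (Fin N → X × X) × (X × X) => Fc g (empirical p.1) p.2 := by
    have := i1 (f := fun p => (g p.2.2 : ℝ≥0∞)) (by fun_prop)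
    unfold Fc
    exact (by fun_prop : Measurable fun p : (Fin N → X × X) × (X × X) =>
      (g p.2.2 : ℝ≥0∞)).div (this.comp measurable_fst)
  have jm : Measurable fun p : (Fin N → X × X) × (X × X) => Fmin g (empirical p.1) p.2 :=
    jf.min jc
  have jbf : Measurable fun p : (Fin N → X × X) × (X × X) => Fbarf g (empirical p.1) p.2 := by
    have := i1 (jf.sub jm)
    unfold Fbarf
    exact (jf.sub jm).div (this.comp measurable_fst)
  have jbc : Measurable fun p : (Fin N → X × X) × (X × X) => Fbarc g (empirical p.1) p.2 := by
    have := i1 (jc.sub jm)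
    unfold Fbarc
    exact (jc.sub jm).div (this.comp measurable_fst)
  refine Measure.measurable_measure.2 fun B hB => ?_
  simp_rw [PhiM_apply hg K hB]
  have mK := Kernel.measurable_coe K hB
  refine (i1 (jm.mul (mK.comp measurable_snd))).add ((measurable_const.sub (i1 jm)).mul ?_)
  refine i2 (f := fun p => Fbarf g (empirical p.1) p.2.1 * Fbarc g (empirical p.1) p.2.2 *
    K (p.2.1.1, p.2.2.2) B) ?_
  refine ((jbf.comp (measurable_fst.prodMk (measurable_fst.comp measurable_snd))).mul
    (jbc.comp (measurable_fst.prodMk (measurable_snd.comp measurable_snd)))).mul (mK.comp ?_)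
  fun_prop

end measurability

end maximal

/-! ### Maximally coupled resampling: weak continuity -/

section weakConvergence

lemma integral_withDensity_bind {T : Type*} [MeasurableSpace T] {μ : Measure S} [SFinite μ]
    {f : S → ℝ≥0∞} (hf : Measurable f) (hft : ∫⁻ x, f x ∂μ ≠ ∞) (κ : Kernel S T)
    [IsMarkovKernel κ] {ψ : T → ℝ} (hψ : BddMeas ψ) :
    ∫ y, ψ y ∂((μ.withDensity f).bind κ) = ∫ x, (f x).toReal * ∫ y, ψ y ∂(κ x) ∂μ := by
  have : IsFiniteMeasure (μ.withDensity f) := isFiniteMeasure_withDensity hft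
  rw [integral_bind_kernel (hψ.integrable _),
    integral_withDensity_eq_integral_toReal_smul hf (ae_lt_top hf hft)]
  rfl

/-- A quotient in which the numerator vanishes to second order where the denominator vanishes to
first order is continuous there. -/
lemma tendsto_inv_mul_of_abs_le_sq {ι : Type*} {l : Filter ι} {r D : ι → ℝ} {r₀ D₀ C : ℝ}
    (hr : Tendsto r l (𝓝 r₀)) (hD : Tendsto D l (𝓝 D₀)) (hDr : ∀ᶠ i in l, |D i| ≤ C * r i ^ 2)
    (hD₀ : |D₀| ≤ C * r₀ ^ 2) :
    Tendsto (fun i => (r i)⁻¹ * D i) l (𝓝 (r₀⁻¹ * D₀)) := by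
  rcases eq_or_ne r₀ 0 with rfl | h0
  · rw [inv_zero, zero_mul]
    refine squeeze_zero_norm' (a := fun i => C * |r i|) ?_ (by simpa using hr.abs.const_mul C)
    filter_upwards [hDr] with i hi
    rcases eq_or_ne (r i) 0 with h | h
    · simp [h]
    · rw [Real.norm_eq_abs, abs_mul, abs_inv]
      have hp := abs_pos.2 h
      rw [inv_mul_le_iff₀ hp]
      rw [← sq_abs] at hi
      linarith
  · exact (hr.inv₀ h0).mul hD

variable {g : X → ℝ≥0} {μ : Measure (X × X)}

/-- The minimum of the two components of the potential, with weights. -/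
def rmin (g : X → ℝ≥0) (α β : ℝ) (w : X × X) : ℝ := min (α * g w.1) (β * g w.2)

lemma toReal_lintegral_fst (hg : Measurable g) :
    (∫⁻ w, (g w.1 : ℝ≥0∞) ∂μ).toReal = ∫ w, (g w.1 : ℝ) ∂μ :=
  toReal_lintegral_coe (X := X × X) (g := fun w => g w.1) (by fun_prop)

lemma toReal_lintegral_snd (hg : Measurable g) :
    (∫⁻ w, (g w.2 : ℝ≥0∞) ∂μ).toReal = ∫ w, (g w.2 : ℝ) ∂μ :=
  toReal_lintegral_coe (X := X × X) (g := fun w => g w.2) (by fun_prop)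

lemma toReal_Ff (hg : Measurable g) (w : X × X) :
    (Ff g μ w).toReal = (∫ w, (g w.1 : ℝ) ∂μ)⁻¹ * g w.1 := by
  rw [Ff, ENNReal.toReal_div, toReal_lintegral_fst hg, ENNReal.coe_toReal, div_eq_inv_mul]

lemma toReal_Fc (hg : Measurable g) (w : X × X) :
    (Fc g μ w).toReal = (∫ w, (g w.2 : ℝ) ∂μ)⁻¹ * g w.2 := by
  rw [Fc, ENNReal.toReal_div, toReal_lintegral_snd hg, ENNReal.coe_toReal, div_eq_inv_mul]

/-- The integral of a test function against maximally coupled resampling. -/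
lemma integral_PhiM [IsProbabilityMeasure μ] (hgm : Measurable g)
    (hg : ∃ C : ℝ≥0, ∀ x, g x ≤ C) (K : Kernel (X × X) (X × X)) [IsMarkovKernel K]
    (h₁ : ∫⁻ w, (g w.1 : ℝ≥0∞) ∂μ ≠ 0) (h₂ : ∫⁻ w, (g w.2 : ℝ≥0∞) ∂μ ≠ 0)
    {ψ : X × X → ℝ} (hψ : BddMeas ψ) {α β : ℝ} (hα : α = (∫ w, (g w.1 : ℝ) ∂μ)⁻¹)
    (hβ : β = (∫ w, (g w.2 : ℝ) ∂μ)⁻¹) :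
    (∫ w, rmin g α β w ∂μ ≤ 1) ∧ (∫ w, (α * g w.1 - rmin g α β w) ∂μ = 1 - ∫ w, rmin g α β w ∂μ) ∧
    (∫ w, (β * g w.2 - rmin g α β w) ∂μ = 1 - ∫ w, rmin g α β w ∂μ) ∧
    ∫ w, ψ w ∂(PhiM g K μ) = ∫ w, rmin g α β w * ∫ y, ψ y ∂(K w) ∂μ +
      (1 - ∫ w, rmin g α β w ∂μ)⁻¹ * ∫ w, (α * g w.1.1 - rmin g α β w.1) *
        (β * g w.2.2 - rmin g α β w.2) * ∫ y, ψ y ∂(K (w.1.1, w.2.2)) ∂(μ.prod μ) := by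
  have mf := measurable_Ff (μ := μ) hgm
  have mc := measurable_Fc (μ := μ) hgm
  have mm := measurable_Fmin (μ := μ) hgm
  have if1 := lintegral_Ff hgm hg h₁
  have ic1 := lintegral_Fc hgm hg h₂
  have ft : ∀ w, Ff g μ w ≠ ∞ := fun w => ENNReal.div_ne_top ENNReal.coe_ne_top h₁
  have ct : ∀ w, Fc g μ w ≠ ∞ := fun w => ENNReal.div_ne_top ENNReal.coe_ne_top h₂
  have mt : ∀ w, Fmin g μ w ≠ ∞ := fun w => ne_top_of_le_ne_top (ft w) (min_le_left _ _)
  have tf : ∀ w, (Ff g μ w).toReal = α * g w.1 := fun w => by rw [toReal_Ff hgm, hα]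
  have tc : ∀ w, (Fc g μ w).toReal = β * g w.2 := fun w => by rw [toReal_Fc hgm, hβ]
  have tm : ∀ w, (Fmin g μ w).toReal = rmin g α β w := fun w => by
    rw [Fmin, ENNReal.toReal_min (ft w) (ct w), tf, tc, rmin]
  have tdf : ∀ w, (Ff g μ w - Fmin g μ w).toReal = α * g w.1 - rmin g α β w := fun w => by
    rw [ENNReal.toReal_sub_of_le (b := Fmin g μ w) (min_le_left _ _) (ft w), tf, tm]
  have tdc : ∀ w, (Fc g μ w - Fmin g μ w).toReal = β * g w.2 - rmin g α β w := fun w => by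
    rw [ENNReal.toReal_sub_of_le (b := Fmin g μ w) (min_le_right _ _) (ct w), tc, tm]
  have hm1 : ∫⁻ w, Fmin g μ w ∂μ ≤ 1 := by
    rw [← if1]
    exact lintegral_mono fun w => min_le_left _ _
  have hmt : ∫⁻ w, Fmin g μ w ∂μ ≠ ∞ := ne_top_of_le_ne_top ENNReal.one_ne_top hm1
  have im : (∫⁻ w, Fmin g μ w ∂μ).toReal = ∫ w, rmin g α β w ∂μ := by
    rw [← integral_toReal mm.aemeasurable (ae_of_all _ fun w => (mt w).lt_top)]
    simp_rw [tm]
  have rf : ∫⁻ w, (Ff g μ w - Fmin g μ w) ∂μ = 1 - ∫⁻ w, Fmin g μ w ∂μ := by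
    rw [lintegral_sub mm hmt (ae_of_all _ fun x => min_le_left _ _), if1]
  have rc : ∫⁻ w, (Fc g μ w - Fmin g μ w) ∂μ = 1 - ∫⁻ w, Fmin g μ w ∂μ := by
    rw [lintegral_sub mm hmt (ae_of_all _ fun x => min_le_right _ _), ic1]
  have tr : (1 - ∫⁻ w, Fmin g μ w ∂μ).toReal = 1 - ∫ w, rmin g α β w ∂μ := by
    rw [ENNReal.toReal_sub_of_le hm1 ENNReal.one_ne_top, im, ENNReal.toReal_one]
  have mdf : Measurable fun w => Ff g μ w - Fmin g μ w := mf.sub mm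
  have mdc : Measurable fun w => Fc g μ w - Fmin g μ w := mc.sub mm
  refine ⟨?_, ?_, ?_, ?_⟩
  · rw [← im]
    exact ENNReal.toReal_le_of_le_ofReal zero_le_one (by simpa using hm1)
  · simp_rw [← tdf]
    rw [integral_toReal mdf.aemeasurable
      (ae_of_all _ fun w => (tsub_le_self.trans_lt (ft w).lt_top)), rf, tr]
  · simp_rw [← tdc]
    rw [integral_toReal mdc.aemeasurable
      (ae_of_all _ fun w => (tsub_le_self.trans_lt (ct w).lt_top)), rc, tr]
  have h1 : Measurable fun w : (X × X) × (X × X) => Fbarf g μ w.1 * Fbarc g μ w.2 :=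
    ((measurable_Fbarf hgm).comp measurable_fst).mul ((measurable_Fbarc hgm).comp measurable_snd)
  have h1t : ∫⁻ w, Fbarf g μ w.1 * Fbarc g μ w.2 ∂(μ.prod μ) ≠ ∞ := by
    rw [lintegral_prod_mul (f := Fbarf g μ) (g := Fbarc g μ) (measurable_Fbarf hgm).aemeasurable
      (measurable_Fbarc hgm).aemeasurable]
    unfold Fbarf Fbarc
    simp_rw [div_eq_mul_inv]
    rw [lintegral_mul_const _ mdf, lintegral_mul_const _ mdc]
    simp_rw [← div_eq_mul_inv]
    exact ENNReal.mul_ne_top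
      (ne_top_of_le_ne_top ENNReal.one_ne_top ENNReal.div_self_le_one)
      (ne_top_of_le_ne_top ENNReal.one_ne_top ENNReal.div_self_le_one)
  have : IsMarkovKernel (barK K) := by unfold barK; infer_instance
  have : IsFiniteMeasure (μ.withDensity (Fmin g μ)) := isFiniteMeasure_withDensity hmt
  have : IsFiniteMeasure ((μ.prod μ).withDensity fun w => Fbarf g μ w.1 * Fbarc g μ w.2) :=
    isFiniteMeasure_withDensity h1t
  have : IsFiniteMeasure ((1 - ∫⁻ u, Fmin g μ u ∂μ) •
      ((μ.prod μ).withDensity (fun w => Fbarf g μ w.1 * Fbarc g μ w.2)).bind (barK K)) :=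
    Measure.smul_finite _ (ne_top_of_le_ne_top ENNReal.one_ne_top tsub_le_self)
  rw [PhiM, integral_add_measure (hψ.integrable _) (hψ.integrable _), integral_smul_measure,
    integral_withDensity_bind mm hmt K hψ, integral_withDensity_bind h1 h1t (barK K) hψ, tr]
  simp_rw [tm]
  congr 1
  have e : ∀ w : (X × X) × (X × X), (Fbarf g μ w.1 * Fbarc g μ w.2).toReal *
      ∫ y, ψ y ∂(barK K w) = ((1 - ∫ w, rmin g α β w ∂μ)⁻¹ * (1 - ∫ w, rmin g α β w ∂μ)⁻¹) *
      ((α * g w.1.1 - rmin g α β w.1) * (β * g w.2.2 - rmin g α β w.2) *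
        ∫ y, ψ y ∂(K (w.1.1, w.2.2))) := fun w => by
    rw [ENNReal.toReal_mul, Fbarf, Fbarc, ENNReal.toReal_div, ENNReal.toReal_div, rf, rc, tr, tdf,
      tdc, barK, Kernel.comap_apply]
    ring
  simp_rw [e]
  rw [integral_const_mul, smul_eq_mul, ← mul_assoc]
  congr 1
  rcases eq_or_ne (1 - ∫ w, rmin g α β w ∂μ) 0 with h | h
  · simp [h]
  · field_simp

section topological
variable {E : Type*} [TopologicalSpace E] [MeasurableSpace E] [OpensMeasurableSpace E]

/-- Weak convergence of the measures and uniform convergence of the integrands. -/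
lemma tendsto_integral_of_tendsto_bcf {ι : Type*} {l : Filter ι} {ν : ι → ProbabilityMeasure E}
    {ν₀ : ProbabilityMeasure E} (hν : Tendsto ν l (𝓝 ν₀)) {h : ι → E →ᵇ ℝ} {h₀ : E →ᵇ ℝ}
    (hh : Tendsto h l (𝓝 h₀)) :
    Tendsto (fun i => ∫ x, h i x ∂(ν i : Measure E)) l (𝓝 (∫ x, h₀ x ∂(ν₀ : Measure E))) := by
  have h1 := ProbabilityMeasure.tendsto_iff_forall_integral_tendsto.1 hν h₀
  have h2 : Tendsto (fun i => ∫ x, (h i - h₀) x ∂(ν i : Measure E)) l (𝓝 0) := by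
    refine squeeze_zero_norm (fun i => ?_) (tendsto_iff_norm_sub_tendsto_zero.1 hh)
    exact BoundedContinuousFunction.norm_integral_le_norm _ _
  have := h2.add h1
  rw [zero_add] at this
  refine this.congr fun i => ?_
  rw [← integral_add (BoundedContinuousFunction.integrable _ _)
    (BoundedContinuousFunction.integrable _ _)]
  simp

end topological

/-- The residual term of a maximal coupling vanishes to second order with the residual mass. -/
lemma abs_integral_residual_le {T : Type*} [MeasurableSpace T] {μ : Measure S} {ν : Measure T}
    [SFinite μ] [SFinite ν] {P : S → ℝ} {Q : T → ℝ} {k : S × T → ℝ} {r C : ℝ}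
    (hPi : Integrable P μ) (hQi : Integrable Q ν) (hP : ∀ x, 0 ≤ P x) (hQ : ∀ x, 0 ≤ Q x)
    (hPr : ∫ x, P x ∂μ = r) (hQr : ∫ x, Q x ∂ν = r) (hk : ∀ x, |k x| ≤ C) :
    |∫ w, P w.1 * Q w.2 * k w ∂(μ.prod ν)| ≤ C * r ^ 2 := by
  have hi : Integrable (fun w : S × T => C * (P w.1 * Q w.2)) (μ.prod ν) :=
    (hPi.mul_prod hQi).const_mul C
  rw [← Real.norm_eq_abs]
  calc _ ≤ ∫ w, C * (P w.1 * Q w.2) ∂(μ.prod ν) := by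
        refine norm_integral_le_of_norm_le hi (ae_of_all _ fun w => ?_)
        rw [Real.norm_eq_abs, abs_mul, abs_of_nonneg (mul_nonneg (hP _) (hQ _)), mul_comm]
        exact mul_le_mul_of_nonneg_right (hk w) (mul_nonneg (hP _) (hQ _))
    _ = C * r ^ 2 := by
        rw [integral_const_mul, integral_prod_mul, hPr, hQr]
        ring

section topological
variable [TopologicalSpace X] [SecondCountableTopology X] [TopologicalSpace.PseudoMetrizableSpace X]
  [BorelSpace X]

/-- Maximally coupled resampling with a continuous potential and a Feller kernel is weakly
continuous. -/
lemma tendsto_integral_PhiM {g : X → ℝ≥0} (hgc : Continuous g) (hg : ∃ C : ℝ≥0, ∀ x, g x ≤ C)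
    (K : Kernel (X × X) (X × X)) [IsMarkovKernel K]
    (hK : ∀ ψ : (X × X) →ᵇ ℝ, Continuous fun u => ∫ w, ψ w ∂(K u))
    {ι : Type*} {l : Filter ι} {ν : ι → ProbabilityMeasure (X × X)}
    {ν₀ : ProbabilityMeasure (X × X)} (hν : Tendsto ν l (𝓝 ν₀))
    (h₁ : ∀ᶠ i in l, ∫⁻ w, (g w.1 : ℝ≥0∞) ∂(ν i : Measure (X × X)) ≠ 0)
    (h₂ : ∀ᶠ i in l, ∫⁻ w, (g w.2 : ℝ≥0∞) ∂(ν i : Measure (X × X)) ≠ 0)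
    (h₁' : ∫⁻ w, (g w.1 : ℝ≥0∞) ∂(ν₀ : Measure (X × X)) ≠ 0)
    (h₂' : ∫⁻ w, (g w.2 : ℝ≥0∞) ∂(ν₀ : Measure (X × X)) ≠ 0) (ψ : (X × X) →ᵇ ℝ) :
    Tendsto (fun i => ∫ w, ψ w ∂(PhiM g K (ν i : Measure (X × X)))) l
      (𝓝 (∫ w, ψ w ∂(PhiM g K (ν₀ : Measure (X × X))))) := by
  have hgm : Measurable g := hgc.measurable
  obtain ⟨C, hC⟩ := id hg
  have hC' : ∀ x, ‖(g x : ℝ)‖ ≤ C := fun x => by simpa using hC x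
  have hψ : BddMeas ψ := ⟨ψ.continuous.measurable, ‖ψ‖, fun w => ψ.norm_coe_le_norm w⟩
  have hk : ∀ u, |∫ w, ψ w ∂(K u)| ≤ ‖ψ‖ := fun u =>
    BoundedContinuousFunction.norm_integral_le_norm (K u) ψ
  -- the integrands of `integral_PhiM` as bounded continuous functions
  let f₁ : (X × X) →ᵇ ℝ := .ofNormedAddCommGroup (fun w => (g w.1 : ℝ)) (by fun_prop) C
    fun w => hC' _
  let f₂ : (X × X) →ᵇ ℝ := .ofNormedAddCommGroup (fun w => (g w.2 : ℝ)) (by fun_prop) C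
    fun w => hC' _
  let k : (X × X) →ᵇ ℝ := .ofNormedAddCommGroup (fun u => ∫ w, ψ w ∂(K u)) (hK ψ) ‖ψ‖ hk
  let mn : ℝ → ℝ → (X × X) →ᵇ ℝ := fun α β => (α • f₁) ⊓ (β • f₂)
  let D : ℝ → ℝ → ((X × X) × (X × X)) →ᵇ ℝ := fun α β =>
    (α • f₁ - mn α β).compContinuous ⟨Prod.fst, continuous_fst⟩ *
      (β • f₂ - mn α β).compContinuous ⟨Prod.snd, continuous_snd⟩ *
      k.compContinuous ⟨fun w => (w.1.1, w.2.2), by fun_prop⟩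
  have hmn : ∀ α β w, mn α β w = rmin g α β w := fun _ _ _ => rfl
  have hD : ∀ α β w, D α β w = (α * g w.1.1 - rmin g α β w.1) * (β * g w.2.2 - rmin g α β w.2) *
      ∫ y, ψ y ∂(K (w.1.1, w.2.2)) := fun _ _ _ => rfl
  let a : ProbabilityMeasure (X × X) → ℝ := fun μ => (∫ w, (g w.1 : ℝ) ∂(μ : Measure (X × X)))⁻¹
  let b : ProbabilityMeasure (X × X) → ℝ := fun μ => (∫ w, (g w.2 : ℝ) ∂(μ : Measure (X × X)))⁻¹
  have hw := ProbabilityMeasure.tendsto_iff_forall_integral_tendsto.1 hν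
  have ha : Tendsto (fun i => a (ν i)) l (𝓝 (a ν₀)) :=
    (hw f₁).inv₀ (integral_coe_pos (X := X × X) (g := fun w => g w.1) (by fun_prop)
      ⟨C, fun w => hC _⟩ h₁').ne'
  have hb : Tendsto (fun i => b (ν i)) l (𝓝 (b ν₀)) :=
    (hw f₂).inv₀ (integral_coe_pos (X := X × X) (g := fun w => g w.2) (by fun_prop)
      ⟨C, fun w => hC _⟩ h₂').ne'
  have tmn : Tendsto (fun i => mn (a (ν i)) (b (ν i))) l (𝓝 (mn (a ν₀) (b ν₀))) :=
    (ha.smul_const f₁).inf_nhds (hb.smul_const f₂)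
  have tD : Tendsto (fun i => D (a (ν i)) (b (ν i))) l (𝓝 (D (a ν₀) (b ν₀))) := by
    have t1 := (ha.smul_const f₁).sub tmn
    have t2 := (hb.smul_const f₂).sub tmn
    have t1' := ((BoundedContinuousFunction.continuous_compContinuous
      (⟨Prod.fst, continuous_fst⟩ : C((X × X) × (X × X), X × X))).tendsto _).comp t1
    have t2' := ((BoundedContinuousFunction.continuous_compContinuous
      (⟨Prod.snd, continuous_snd⟩ : C((X × X) × (X × X), X × X))).tendsto _).comp t2
    exact (t1'.mul t2').mul_const _
  have hνν : Tendsto (fun i => (ν i).prod (ν i)) l (𝓝 (ν₀.prod ν₀)) :=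
    (ProbabilityMeasure.continuous_prod.tendsto (ν₀, ν₀)).comp (hν.prodMk_nhds hν)
  -- the residual term is of second order in the residual mass
  have key : ∀ μ : ProbabilityMeasure (X × X),
      ∫⁻ w, (g w.1 : ℝ≥0∞) ∂(μ : Measure (X × X)) ≠ 0 →
      ∫⁻ w, (g w.2 : ℝ≥0∞) ∂(μ : Measure (X × X)) ≠ 0 →
      ∫ w, ψ w ∂(PhiM g K (μ : Measure (X × X))) =
        ∫ w, (mn (a μ) (b μ) * k) w ∂(μ : Measure (X × X)) +
        (1 - ∫ w, mn (a μ) (b μ) w ∂(μ : Measure (X × X)))⁻¹ *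
          ∫ w, D (a μ) (b μ) w ∂((μ.prod μ : ProbabilityMeasure _) : Measure _) ∧
      |∫ w, D (a μ) (b μ) w ∂((μ.prod μ : ProbabilityMeasure _) : Measure _)| ≤
        ‖ψ‖ * (1 - ∫ w, mn (a μ) (b μ) w ∂(μ : Measure (X × X))) ^ 2 := by
    intro μ hμ₁ hμ₂
    obtain ⟨-, e1, e2, e3⟩ := integral_PhiM (μ := (μ : Measure (X × X))) hgm hg K hμ₁ hμ₂ hψ
      (α := a μ) (β := b μ) rfl rfl
    refine ⟨e3, ?_⟩
    exact abs_integral_residual_le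
      ((a μ • f₁ - mn (a μ) (b μ)).integrable (μ : Measure (X × X)))
      ((b μ • f₂ - mn (a μ) (b μ)).integrable (μ : Measure (X × X)))
      (fun w => sub_nonneg.2 (min_le_left _ _)) (fun w => sub_nonneg.2 (min_le_right _ _))
      e1 e2 (k := fun w => ∫ y, ψ y ∂(K (w.1.1, w.2.2))) (fun w => hk _)
  have t1 := tendsto_integral_of_tendsto_bcf hν (tmn.mul_const k)
  have t2 := tendsto_integral_of_tendsto_bcf hν tmn
  have t3 := tendsto_integral_of_tendsto_bcf hνν tD
  rw [(key ν₀ h₁' h₂').1]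
  refine (t1.add (tendsto_inv_mul_of_abs_le_sq (C := ‖ψ‖) (t2.const_sub 1) t3 ?_
    (key ν₀ h₁' h₂').2)).congr' ?_
  · filter_upwards [h₁, h₂] with i i1 i2
    exact (key (ν i) i1 i2).2
  · filter_upwards [h₁, h₂] with i i1 i2
    exact ((key (ν i) i1 i2).1).symm

end topological

end weakConvergence

/-! ### Maximally coupled resampling: the central limit theorem -/

section maximalCLT
variable {G : ℕ → X → ℝ≥0} {ηf ηc : Measure X} [IsProbabilityMeasure ηf] [IsProbabilityMeasure ηc]
  {Mf Mc : ℕ → Kernel X X} [∀ n, IsMarkovKernel (Mf n)] [∀ n, IsMarkovKernel (Mc n)]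
  {η₀ : Measure (X × X)} {K : ℕ → Kernel (X × X) (X × X)}

lemma IsCoupling.lintegral_ne_zero {μ : Measure (X × X)} {μ₁ μ₂ : Measure X}
    (h : IsCoupling μ μ₁ μ₂) {g : X → ℝ≥0} (hg : Measurable g)
    (h₁ : ∫⁻ x, (g x : ℝ≥0∞) ∂μ₁ ≠ 0) (h₂ : ∫⁻ x, (g x : ℝ≥0∞) ∂μ₂ ≠ 0) :
    ∫⁻ w, (g w.1 : ℝ≥0∞) ∂μ ≠ 0 ∧ ∫⁻ w, (g w.2 : ℝ≥0∞) ∂μ ≠ 0 := by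
  have hm : Measurable fun x => (g x : ℝ≥0∞) := by fun_prop
  rw [← h.1, lintegral_map hm measurable_fst] at h₁
  rw [← h.2, lintegral_map hm measurable_snd] at h₂
  exact ⟨h₁, h₂⟩

lemma isCoupling_empirical {N : ℕ} (u : Fin N → X × X) :
    IsCoupling (empirical u) (empirical fun i => (u i).1) (empirical fun i => (u i).2) :=
  ⟨map_empirical u measurable_fst, map_empirical u measurable_snd⟩

/-- The limit of maximally coupled resampling couples the predictors, and the particle system fits
the standing assumptions. -/
lemma isCoupledFilter_limM (hGm : ∀ n, Measurable (G n)) (hGb : ∀ n, ∃ C : ℝ≥0, ∀ x, G n x ≤ C)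
    (hf : ∀ n, 0 < gam G ηf Mf n Set.univ) (hc : ∀ n, 0 < gam G ηc Mc n Set.univ)
    (hη₀ : IsCoupling η₀ ηf ηc)
    (hK : ∀ n, 1 ≤ n → ∀ u : X × X, IsCoupling (K n u) (Mf n u.1) (Mc n u.2)) :
    IsCoupledFilter G ηf ηc Mf Mc (limM G η₀ K)
      (fun _ p u => PhiM (G p) (K (p + 1)) (empirical u)) where
  measurable_potential := hGm
  bounded_potential := hGb
  isProb_f := inferInstance
  isProb_c := inferInstance
  isMarkov_f := inferInstance
  isMarkov_c := inferInstance
  pos_f := hf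
  pos_c := hc
  isCoupling n := by
    induction n with
    | zero => rwa [limM, eta_zero, eta_zero]
    | succ n ih =>
      have := isProbabilityMeasure_eta hGb hf n
      have := ih.isProbabilityMeasure
      have hp := ih.lintegral_ne_zero (hGm n) (lintegral_eta_ne_zero hGb hf n)
        (lintegral_eta_ne_zero hGb hc n)
      rw [limM, eta_succ hGb hf, eta_succ hGb hc, ← ih.1, ← ih.2]
      exact isCoupling_PhiM (hGm n) (hGb n) (hK (n + 1) (by omega)) hp.1 hp.2
  measurable_rule N p := measurable_PhiM_empirical (hGm p) (K (p + 1)) N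
  isCoupling_rule N p u hu := by
    have hu' := (survives_iff (hGm p) u).1 hu
    have he := isCoupling_empirical u
    have hp := he.lintegral_ne_zero (hGm p) hu'.1 hu'.2
    rw [← he.1, ← he.2]
    exact isCoupling_PhiM (hGm p) (hGb p) (hK (p + 1) (by omega)) hp.1 hp.2

end maximalCLT

section weakLLN
variable {G : ℕ → X → ℝ≥0} {ηf ηc : Measure X} {Mf Mc : ℕ → Kernel X X}
  {η₀ : Measure (X × X)} {K : ℕ → Kernel (X × X) (X × X)}
  {R : ∀ N : ℕ, ℕ → Kernel (Fin N → X × X) (Fin N → X × X)}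
  [TopologicalSpace X] [SecondCountableTopology X] [TopologicalSpace.PseudoMetrizableSpace X]
  [BorelSpace X] [∀ n, IsMarkovKernel (K n)] [∀ N n, IsMarkovKernel (R N n)]

/-- Weak convergence of the empirical measures carries over to the next sampling law. -/
lemma tendsto_integral_PhiM_empirical
    (h : IsCoupledFilter G ηf ηc Mf Mc (limM G η₀ K)
      (fun _ p u => PhiM (G p) (K (p + 1)) (empirical u)))
    {n : ℕ} (hG : Continuous (G n))
    (hK : ∀ ψ : (X × X) →ᵇ ℝ, Continuous fun u => ∫ w, ψ w ∂(K (n + 1) u))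
    (hw : ∀ ψ : (X × X) →ᵇ ℝ, Tendsto (fun z : Σ N : ℕ, Fin N → X × X =>
      ∫ v, ψ v ∂(empirical z.2))
      (whp fun N => lastLaw G (limM G η₀ K 0)
        (fun p u => PhiM (G p) (K (p + 1)) (empirical u)) (R N) n)
      (𝓝 (∫ v, ψ v ∂(limM G η₀ K n)))) (ψ : (X × X) →ᵇ ℝ) :
    Tendsto (fun z : Σ N : ℕ, Fin N → X × X =>
        ∫ v, ψ v ∂(PhiM (G n) (K (n + 1)) (empirical z.2)))
      (whp fun N => lastLaw G (limM G η₀ K 0)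
        (fun p u => PhiM (G p) (K (p + 1)) (empirical u)) (R N) n)
      (𝓝 (∫ v, ψ v ∂(limM G η₀ K (n + 1)))) := by
  have := h.isProb_lim n
  have hs := h.eventually_survives_lastLaw (R := R) n
  let ν₀ : ProbabilityMeasure (X × X) := ⟨limM G η₀ K n, inferInstance⟩
  -- the value for `N = 0` is immaterial
  let ν : (Σ N : ℕ, Fin N → X × X) → ProbabilityMeasure (X × X) := fun z =>
    if hN : 0 < z.1 then ⟨empirical z.2, isProbabilityMeasure_empirical hN z.2⟩ else ν₀
  have hν : ∀ z : Σ N : ℕ, Fin N → X × X, 0 < z.1 → (ν z : Measure (X × X)) = empirical z.2 :=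
    fun z hz => by
      have : ν z = ⟨empirical z.2, isProbabilityMeasure_empirical hz z.2⟩ := dif_pos hz
      rw [this]
      rfl
  have hpos : ∀ z : Σ N : ℕ, Fin N → X × X, Survives (G n) z.2 →
      ∫⁻ w, (G n w.1 : ℝ≥0∞) ∂(ν z : Measure (X × X)) ≠ 0 ∧
      ∫⁻ w, (G n w.2 : ℝ≥0∞) ∂(ν z : Measure (X × X)) ≠ 0 := fun z hz => by
    rw [hν z hz.pos]
    have hz' := (survives_iff hG.measurable z.2).1 hz
    exact (isCoupling_empirical z.2).lintegral_ne_zero hG.measurable hz'.1 hz'.2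
  have hp₀ := (h.isCoupling n).lintegral_ne_zero hG.measurable
    (h.isMarginal_fst.lintegral_eta_ne_zero h.bounded_potential n)
    (h.isMarginal_snd.lintegral_eta_ne_zero h.bounded_potential n)
  have key := tendsto_integral_PhiM hG (h.bounded_potential n) (K (n + 1)) hK (ν := ν) (ν₀ := ν₀)
    (l := whp fun N => lastLaw G (limM G η₀ K 0)
        (fun p u => PhiM (G p) (K (p + 1)) (empirical u)) (R N) n) ?_
    (hs.mono fun z hz => (hpos z hz).1) (hs.mono fun z hz => (hpos z hz).2) hp₀.1 hp₀.2 ψ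
  · refine key.congr' ?_
    filter_upwards [hs] with z hz
    rw [hν z hz.pos]
  · refine ProbabilityMeasure.tendsto_iff_forall_integral_tendsto.2 fun f => (hw f).congr' ?_
    filter_upwards [hs] with z hz
    rw [hν z hz.pos]

/-- The empirical measures of the pairs converge weakly. -/
lemma tendsto_integral_empirical_limM
    (h : IsCoupledFilter G ηf ηc Mf Mc (limM G η₀ K)
      (fun _ p u => PhiM (G p) (K (p + 1)) (empirical u)))
    (hG : ∀ n, Continuous (G n))
    (hK : ∀ n, 1 ≤ n → ∀ ψ : (X × X) →ᵇ ℝ, Continuous fun u => ∫ w, ψ w ∂(K n u)) (n : ℕ) :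
    ∀ ψ : (X × X) →ᵇ ℝ, Tendsto (fun z : Σ N : ℕ, Fin N → X × X => ∫ v, ψ v ∂(empirical z.2))
      (whp fun N => lastLaw G (limM G η₀ K 0)
        (fun p u => PhiM (G p) (K (p + 1)) (empirical u)) (R N) n)
      (𝓝 (∫ v, ψ v ∂(limM G η₀ K n))) := by
  have hr : Tendsto (fun N : ℕ => (1 : ℝ) ^ 2 / N) atTop (𝓝 0) := by
    simpa using tendsto_inv_atTop_nhds_zero_nat (𝕜 := ℝ)
  have hψ : ∀ ψ : (X × X) →ᵇ ℝ, BddMeas ψ := fun ψ =>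
    ⟨ψ.continuous.measurable, ‖ψ‖, fun w => ψ.norm_coe_le_norm w⟩
  induction n with
  | zero =>
    intro ψ
    have := (h.tendsto_empirical_zero (R := R) (hψ ψ) (r := fun _ => 1) hr).add_const
      (∫ v, ψ v ∂(limM G η₀ K 0))
    simpa using this
  | succ n ih =>
    intro ψ
    have t := tendsto_integral_PhiM_empirical h (hG n) (hK (n + 1) (by omega)) ih ψ
    have := (h.tendsto_empirical_succ (R := R) (hψ ψ) (r := fun _ => 1) hr
      (h.eventually_survives_lastLaw n) (c := ∫ v, ψ v ∂(limM G η₀ K (n + 1))) (by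
        simpa using t.sub_const (∫ v, ψ v ∂(limM G η₀ K (n + 1))))).add_const
      (∫ v, ψ v ∂(limM G η₀ K (n + 1)))
    simpa using this

end weakLLN

section feller

/-- The marginal transitions of a Feller coupling are Feller, and so preserve the bounded continuous
functions. -/
lemma continuous_backStep [TopologicalSpace X] [BorelSpace X] {g : X → ℝ≥0} (hg : Continuous g)
    {M : Kernel X X} {L : X → Measure (X × X)} {pr : X × X → X} (hpr : Continuous pr)
    (hL : ∀ ψ : (X × X) →ᵇ ℝ, Continuous fun x => ∫ w, ψ w ∂(L x))
    (hLM : ∀ (φ : X → ℝ), Continuous φ → ∀ x, ∫ w, φ (pr w) ∂(L x) = ∫ y, φ y ∂(M x))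
    (μ : Measure X) {φ : X → ℝ} (hφ : Continuous φ) {C : ℝ} (hC : ∀ x, |φ x| ≤ C) :
    Continuous (backStep g M μ φ) := by
  have h := hL (.ofNormedAddCommGroup (fun w => φ (pr w)) (hφ.comp hpr) C fun w => hC _)
  simp only [BoundedContinuousFunction.coe_ofNormedAddCommGroup] at h
  simp_rw [hLM φ hφ] at h
  unfold backStep
  fun_prop

end feller

/-- The central limit theorem for maximally coupled resampling. -/
theorem errorCLT_lawM [TopologicalSpace X] [SecondCountableTopology X]
    [TopologicalSpace.PseudoMetrizableSpace X] [BorelSpace X]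
    (G : ℕ → X → ℝ≥0) (hG : ∀ n, Continuous (G n))
    (hGb : ∀ n, ∃ C : ℝ≥0, ∀ x, G n x ≤ C)
    (ηf ηc : Measure X) [IsProbabilityMeasure ηf] [IsProbabilityMeasure ηc]
    (Mf Mc : ℕ → Kernel X X) [∀ n, IsMarkovKernel (Mf n)] [∀ n, IsMarkovKernel (Mc n)]
    (hf : ∀ n, 0 < gam G ηf Mf n Set.univ) (hc : ∀ n, 0 < gam G ηc Mc n Set.univ)
    (η₀ : Measure (X × X)) (hη₀ : IsCoupling η₀ ηf ηc)
    (K : ℕ → Kernel (X × X) (X × X)) [∀ n, IsMarkovKernel (K n)]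
    (hK : ∀ n, 1 ≤ n → ∀ u : X × X, IsCoupling (K n u) (Mf n u.1) (Mc n u.2))
    (hKc : ∀ n, 1 ≤ n → ∀ ψ : (X × X) →ᵇ ℝ, Continuous fun u => ∫ w, ψ w ∂(K n u))
    (R : ∀ N : ℕ, ℕ → Kernel (Fin N → X × X) (Fin N → X × X)) [∀ N n, IsMarkovKernel (R N n)]
    {φ : X → ℝ} (hφc : Continuous φ) (hφb : ∃ C : ℝ, ∀ x, |φ x| ≤ C) (n : ℕ) :
    (∫ u, (φ u.1 - φ u.2) ∂(limM G η₀ K n) =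
        ∫ x, φ x ∂(eta G ηf Mf n) - ∫ x, φ x ∂(eta G ηc Mc n)) ∧
      ErrorCLT n (fun N => lawM G η₀ K N (R N) n) (limM G η₀ K n) φ
        (asympVar G ηf ηc Mf Mc (limM G η₀ K) n φ) := by
  have hGm : ∀ n, Measurable (G n) := fun n => (hG n).measurable
  have hφ : BddMeas φ := ⟨hφc.measurable, hφb⟩
  have h := isCoupledFilter_limM hGm hGb hf hc hη₀ hK
  have := h.isProb_eta_f n
  obtain ⟨x₀⟩ := h.nonempty
  refine ⟨IsCoupledFilter.integral_sub_coupling (h.isCoupling n) hφ hφ, ?_⟩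
  refine h.errorCLT (R := R) hφ fun t => h.tendsto_charFun_werr
    (F := fun φ => Continuous φ ∧ ∃ C : ℝ, ∀ x, |φ x| ≤ C)
    (fun φ hφ => ⟨hφ.1.measurable, hφ.2⟩) (fun n φ hφ => ?_) (fun n φ hφ => ?_)
    (fun n φ₁ φ₂ h₁ h₂ => ?_) n ⟨hφc, hφb⟩ ⟨hφc, hφb⟩ t
  · obtain ⟨C, hC⟩ := hφ.2
    have hb : BddMeas φ := ⟨hφ.1.measurable, hφ.2⟩
    refine ⟨continuous_backStep (hG n) (L := fun x => K (n + 1) (x, x₀)) continuous_fst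
      (fun ψ => (hKc (n + 1) (by omega) ψ).comp (by fun_prop : Continuous fun x => (x, x₀)))
      (fun φ hφ x => ?_) _ hφ.1 hC, (hb.backStep (hGm n) (hGb n)).2⟩
    rw [(hK (n + 1) (by omega) (x, x₀)).integral_fst hφ.measurable]
  · obtain ⟨C, hC⟩ := hφ.2
    have hb : BddMeas φ := ⟨hφ.1.measurable, hφ.2⟩
    refine ⟨continuous_backStep (hG n) (L := fun x => K (n + 1) (x₀, x)) continuous_snd
      (fun ψ => (hKc (n + 1) (by omega) ψ).comp (by fun_prop : Continuous fun x => (x₀, x)))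
      (fun φ hφ x => ?_) _ hφ.1 hC, (hb.backStep (hGm n) (hGb n)).2⟩
    rw [(hK (n + 1) (by omega) (x₀, x)).integral_snd hφ.measurable]
  · obtain ⟨C₁, hC₁⟩ := h₁.2
    obtain ⟨C₂, hC₂⟩ := h₂.2
    have c₁ := h₁.1
    have c₂ := h₂.1
    let ψ : (X × X) →ᵇ ℝ := .ofNormedAddCommGroup (fun v => φ₁ v.1 * φ₂ v.2) (by fun_prop)
      (C₁ * C₂) fun v => by
        rw [norm_mul]
        exact mul_le_mul (hC₁ _) (hC₂ _) (norm_nonneg _) ((abs_nonneg _).trans (hC₁ v.1))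
    exact tendsto_integral_PhiM_empirical h (hG n) (hKc (n + 1) (by omega))
      (tendsto_integral_empirical_limM h hG hKc n) ψ

/-! ### Maximal couplings of densities -/

section maxCoupling

section basic
variable {ν : Measure X} {a b : X → ℝ≥0∞}

lemma lintegral_min_le_one (ha1 : ∫⁻ x, a x ∂ν = 1) : ∫⁻ x, min (a x) (b x) ∂ν ≤ 1 := by
  rw [← ha1]
  exact lintegral_mono fun x => min_le_left _ _

lemma lintegral_sub_min (ha : Measurable a) (hb : Measurable b) (ha1 : ∫⁻ x, a x ∂ν = 1) :
    ∫⁻ x, (a x - min (a x) (b x)) ∂ν = 1 - ∫⁻ x, min (a x) (b x) ∂ν := by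
  rw [lintegral_sub (ha.min hb)
    (ne_top_of_le_ne_top ENNReal.one_ne_top (lintegral_min_le_one ha1))
    (ae_of_all _ fun x => min_le_left _ _), ha1]

/-- The common part and the residual of a density add up to it, also if the residual vanishes. -/
lemma withDensity_min_add (ha : Measurable a) (hb : Measurable b) (ha1 : ∫⁻ x, a x ∂ν = 1) :
    ν.withDensity (fun x => min (a x) (b x)) + (1 - ∫⁻ x, min (a x) (b x) ∂ν)⁻¹ •
      ((1 - ∫⁻ x, min (a x) (b x) ∂ν) • ν.withDensity (fun x => a x - min (a x) (b x))) =
    ν.withDensity a := by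
  have hadd : ν.withDensity (fun x => min (a x) (b x)) +
      ν.withDensity (fun x => a x - min (a x) (b x)) = ν.withDensity a := by
    rw [← withDensity_add_left (ha.min hb)]
    congr 1
    ext x
    exact add_tsub_cancel_of_le (min_le_left _ _)
  have hr : (ν.withDensity (fun x => a x - min (a x) (b x))) Set.univ =
      1 - ∫⁻ x, min (a x) (b x) ∂ν := by
    rw [withDensity_apply _ MeasurableSet.univ, Measure.restrict_univ, lintegral_sub_min ha hb ha1]
  set r := 1 - ∫⁻ x, min (a x) (b x) ∂ν with hrdef
  rcases eq_or_ne r 0 with h | h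
  · rw [h, Measure.measure_univ_eq_zero] at hr
    rw [← hadd, hr]
    simp
  · rw [smul_smul, ENNReal.inv_mul_cancel h (ne_top_of_le_ne_top ENNReal.one_ne_top tsub_le_self),
      one_smul, hadd]

variable [SigmaFinite ν]

/-- A maximal coupling is a coupling. -/
lemma isCoupling_maxCoupling (ha : Measurable a) (hb : Measurable b) (ha1 : ∫⁻ x, a x ∂ν = 1)
    (hb1 : ∫⁻ x, b x ∂ν = 1) :
    IsCoupling (maxCoupling ν a b) (ν.withDensity a) (ν.withDensity b) := by
  have hd : Measurable fun x : X => (x, x) := by fun_prop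
  have ua : (ν.withDensity (fun x => a x - min (a x) (b x))) Set.univ =
      1 - ∫⁻ x, min (a x) (b x) ∂ν := by
    rw [withDensity_apply _ MeasurableSet.univ, Measure.restrict_univ, lintegral_sub_min ha hb ha1]
  have hba : ∀ x, min (b x) (a x) = min (a x) (b x) := fun x => min_comm _ _
  have rb := lintegral_sub_min hb ha hb1
  have wb := withDensity_min_add hb ha hb1
  simp_rw [hba] at rb wb
  have ub : (ν.withDensity (fun x => b x - min (a x) (b x))) Set.univ =
      1 - ∫⁻ x, min (a x) (b x) ∂ν := by
    rw [withDensity_apply _ MeasurableSet.univ, Measure.restrict_univ, rb]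
  constructor
  · rw [maxCoupling, Measure.map_add _ _ measurable_fst, Measure.map_map measurable_fst hd,
      Measure.map_smul, Measure.map_fst_prod, ub]
    exact (congrArg₂ _ Measure.map_id rfl).trans (withDensity_min_add ha hb ha1)
  · rw [maxCoupling, Measure.map_add _ _ measurable_snd, Measure.map_map measurable_snd hd,
      Measure.map_smul, Measure.map_snd_prod, ua]
    exact (congrArg₂ _ Measure.map_id rfl).trans wb

/-- The integral of a product against a maximal coupling, in terms of real-valued densities. -/
lemma integral_maxCoupling (ha : Measurable a) (hb : Measurable b) (ha1 : ∫⁻ x, a x ∂ν = 1)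
    (hb1 : ∫⁻ x, b x ∂ν = 1) {φ₁ φ₂ : X → ℝ} (h₁ : BddMeas φ₁) (h₂ : BddMeas φ₂) :
    ∫ w, φ₁ w.1 * φ₂ w.2 ∂(maxCoupling ν a b) =
      ∫ x, min (a x).toReal (b x).toReal * (φ₁ x * φ₂ x) ∂ν +
      (1 - ∫ x, min (a x).toReal (b x).toReal ∂ν)⁻¹ *
        ((∫ x, ((a x).toReal - min (a x).toReal (b x).toReal) * φ₁ x ∂ν) *
          ∫ x, ((b x).toReal - min (a x).toReal (b x).toReal) * φ₂ x ∂ν) := by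
  have hd : Measurable fun x : X => (x, x) := by fun_prop
  have hm := ha.min hb
  have hm1 : ∫⁻ x, min (a x) (b x) ∂ν ≤ 1 := lintegral_min_le_one ha1
  have hmt : ∫⁻ x, min (a x) (b x) ∂ν ≠ ∞ := ne_top_of_le_ne_top ENNReal.one_ne_top hm1
  have hr : 1 - ∫⁻ x, min (a x) (b x) ∂ν ≠ ∞ :=
    ne_top_of_le_ne_top ENNReal.one_ne_top tsub_le_self
  have rb := lintegral_sub_min hb ha hb1
  have hba : ∀ x, min (b x) (a x) = min (a x) (b x) := fun x => min_comm _ _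
  simp_rw [hba] at rb
  have ra := lintegral_sub_min ha hb ha1
  have hta : ∀ᵐ x ∂ν, a x < ∞ := ae_lt_top ha (by simp [ha1])
  have htb : ∀ᵐ x ∂ν, b x < ∞ := ae_lt_top hb (by simp [hb1])
  have em : ∀ᵐ x ∂ν, (min (a x) (b x)).toReal = min (a x).toReal (b x).toReal := by
    filter_upwards [hta, htb] with x h1 h2
    exact ENNReal.toReal_min h1.ne h2.ne
  have ea : ∀ᵐ x ∂ν, (a x - min (a x) (b x)).toReal =
      (a x).toReal - min (a x).toReal (b x).toReal := by
    filter_upwards [hta, em] with x h1 h2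
    rw [ENNReal.toReal_sub_of_le (min_le_left _ _) h1.ne, h2]
  have eb : ∀ᵐ x ∂ν, (b x - min (a x) (b x)).toReal =
      (b x).toReal - min (a x).toReal (b x).toReal := by
    filter_upwards [htb, em] with x h1 h2
    rw [ENNReal.toReal_sub_of_le (min_le_right _ _) h1.ne, h2]
  have f1 : IsFiniteMeasure (ν.withDensity fun x => min (a x) (b x)) :=
    isFiniteMeasure_withDensity hmt
  have f2 : IsFiniteMeasure (ν.withDensity fun x => a x - min (a x) (b x)) :=
    isFiniteMeasure_withDensity (by rw [ra]; exact hr)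
  have f3 : IsFiniteMeasure (ν.withDensity fun x => b x - min (a x) (b x)) :=
    isFiniteMeasure_withDensity (by rw [rb]; exact hr)
  have hH : BddMeas fun w : X × X => φ₁ w.1 * φ₂ w.2 :=
    (h₁.comp measurable_fst).mul (h₂.comp measurable_snd)
  have m1 : ∫ x, min (a x).toReal (b x).toReal ∂ν = (∫⁻ x, min (a x) (b x) ∂ν).toReal := by
    rw [← integral_toReal hm.aemeasurable (ae_lt_top hm hmt)]
    exact integral_congr_ae (em.mono fun x hx => hx.symm)
  -- if the residual mass is zero, the infinite weight sits in front of the zero measure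
  have hint : Integrable (fun w : X × X => φ₁ w.1 * φ₂ w.2) ((1 - ∫⁻ x, min (a x) (b x) ∂ν)⁻¹ •
      (ν.withDensity (fun x => a x - min (a x) (b x))).prod
        (ν.withDensity (fun x => b x - min (a x) (b x)))) := by
    rcases eq_or_ne (1 - ∫⁻ x, min (a x) (b x) ∂ν) 0 with h | h
    · have : ν.withDensity (fun x => a x - min (a x) (b x)) = 0 := by
        rw [← Measure.measure_univ_eq_zero, withDensity_apply _ MeasurableSet.univ,
          Measure.restrict_univ, ra, h]
      rw [this]
      simp
    · exact (hH.integrable _).smul_measure (ENNReal.inv_ne_top.2 h)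
  have pa : Measurable fun x => a x - min (a x) (b x) := ha.sub hm
  have pb : Measurable fun x => b x - min (a x) (b x) := hb.sub hm
  rw [maxCoupling, integral_add_measure (hH.integrable _) hint, integral_smul_measure,
    integral_map hd.aemeasurable hH.1.aestronglyMeasurable, integral_prod_mul,
    integral_withDensity_eq_integral_toReal_smul hm (ae_lt_top hm hmt),
    integral_withDensity_eq_integral_toReal_smul pa
      (ae_lt_top pa (by rw [ra]; exact hr)),
    integral_withDensity_eq_integral_toReal_smul pb
      (ae_lt_top pb (by rw [rb]; exact hr)),
    ENNReal.toReal_inv, ENNReal.toReal_sub_of_le hm1 ENNReal.one_ne_top, ENNReal.toReal_one, m1,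
    smul_eq_mul]
  refine congrArg₂ (· + ·) ?_ (congrArg₂ (· * ·) rfl (congrArg₂ (· * ·) ?_ ?_))
  · exact integral_congr_ae (em.mono fun x hx => by simp only [smul_eq_mul, hx])
  · exact integral_congr_ae (ea.mono fun x hx => by simp only [smul_eq_mul, hx])
  · exact integral_congr_ae (eb.mono fun x hx => by simp only [smul_eq_mul, hx])

end basic

section measurability

lemma measurable_maxCoupling {T : Type*} [MeasurableSpace T] {ν : Measure X} [SigmaFinite ν]
    {A B : T → X → ℝ≥0∞} (hA : Measurable (Function.uncurry A))
    (hB : Measurable (Function.uncurry B)) :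
    Measurable fun t => maxCoupling ν (A t) (B t) := by
  have hM : Measurable fun p : T × X => min (A p.1 p.2) (B p.1 p.2) := hA.min hB
  have hP : Measurable fun p : T × X => A p.1 p.2 - min (A p.1 p.2) (B p.1 p.2) := hA.sub hM
  have hQ : Measurable fun p : T × X => B p.1 p.2 - min (A p.1 p.2) (B p.1 p.2) := hB.sub hM
  have hd : Measurable fun x : X => (x, x) := by fun_prop
  refine Measure.measurable_measure.2 fun s hs => ?_
  have e : ∀ t, maxCoupling ν (A t) (B t) s =
      ∫⁻ x in (fun x => (x, x)) ⁻¹' s, min (A t x) (B t x) ∂ν +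
      (1 - ∫⁻ x, min (A t x) (B t x) ∂ν)⁻¹ * ∫⁻ w in s, (A t w.1 - min (A t w.1) (B t w.1)) *
        (B t w.2 - min (A t w.2) (B t w.2)) ∂(ν.prod ν) := fun t => by
    have hPt : Measurable fun x => A t x - min (A t x) (B t x) := hP.comp measurable_prodMk_left
    have hQt : Measurable fun x => B t x - min (A t x) (B t x) := hQ.comp measurable_prodMk_left
    rw [maxCoupling, Measure.add_apply, Measure.smul_apply, Measure.map_apply hd hs,
      withDensity_apply _ (hd hs), prod_withDensity hPt hQt, withDensity_apply _ hs]
    rfl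
  simp_rw [e]
  refine (hM.lintegral_prod_right').add
    ((measurable_const.sub hM.lintegral_prod_right').inv.mul ?_)
  refine Measurable.lintegral_prod_right' (f := fun p : T × (X × X) =>
    (A p.1 p.2.1 - min (A p.1 p.2.1) (B p.1 p.2.1)) *
        (B p.1 p.2.2 - min (A p.1 p.2.2) (B p.1 p.2.2))) ?_
  exact (hP.comp (measurable_fst.prodMk (measurable_fst.comp measurable_snd))).mul
    (hQ.comp (measurable_fst.prodMk (measurable_snd.comp measurable_snd)))

variable {g : X → ℝ≥0} {m : X → X → ℝ≥0}

lemma measurable_Fdens (hg : Measurable g) (hm : Measurable (Function.uncurry m)) (μ : Measure X)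
    [SFinite μ] : Measurable (Fdens g m μ) := by
  unfold Fdens
  refine Measurable.div_const ?_ _
  exact Measurable.lintegral_prod_left' (f := fun p : X × X => (g p.1 : ℝ≥0∞) * m p.1 p.2)
    (by have := hm.coe_nnreal_ennreal; exact (by fun_prop :
      Measurable fun p : X × X => (g p.1 : ℝ≥0∞)).mul this)

lemma measurable_Fdens_empirical (hg : Measurable g) (hm : Measurable (Function.uncurry m))
    {N : ℕ} {pr : X × X → X} (hpr : Measurable pr) :
    Measurable (Function.uncurry fun u : Fin N → X × X =>
      Fdens g m (empirical fun i => pr (u i))) := by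
  have h1 : Measurable fun x => (g x : ℝ≥0∞) := by fun_prop
  have h2 : ∀ x, Measurable fun z => (g z : ℝ≥0∞) * m z x := fun x =>
    h1.mul (hm.of_uncurry_right (y := x)).coe_nnreal_ennreal
  have e : (Function.uncurry fun u : Fin N → X × X => Fdens g m (empirical fun i => pr (u i))) =
      fun p => ((N : ℝ≥0∞)⁻¹ * ∑ i, (g (pr (p.1 i)) : ℝ≥0∞) * m (pr (p.1 i)) p.2) /
        ((N : ℝ≥0∞)⁻¹ * ∑ i, (g (pr (p.1 i)) : ℝ≥0∞)) := by
    ext p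
    rw [Function.uncurry, Fdens, lintegral_empirical _ (h2 _), lintegral_empirical _ h1]
  rw [e]
  have h3 : ∀ i : Fin N, Measurable fun p : (Fin N → X × X) × X => pr (p.1 i) := fun i => by
    fun_prop
  refine ((Finset.measurable_sum _ fun i _ => ?_).const_mul _).div
    ((Finset.measurable_sum _ fun i _ => h1.comp (h3 i)).const_mul _)
  exact (h1.comp (h3 i)).mul (hm.comp ((h3 i).prodMk measurable_snd)).coe_nnreal_ennreal

/-- The Feynman-Kac transition of a kernel with a transition density has a density. -/
lemma PhiS_eq_withDensity {ν : Measure X} [SigmaFinite ν] (hg : Measurable g)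
    (hm : Measurable (Function.uncurry m)) {M : Kernel X X}
    (hM : ∀ x, M x = ν.withDensity fun y => (m x y : ℝ≥0∞)) (μ : Measure X) [SFinite μ] :
    PhiS g M μ = ν.withDensity (Fdens g m μ) := by
  have hj : Measurable fun p : X × X => (g p.1 : ℝ≥0∞) * m p.1 p.2 :=
    (by fun_prop : Measurable fun p : X × X => (g p.1 : ℝ≥0∞)).mul hm.coe_nnreal_ennreal
  ext B hB
  rw [PhiS_apply hg M μ hB, withDensity_apply _ hB]
  simp_rw [hM, withDensity_apply _ hB, Fdens, div_eq_mul_inv]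
  have h1 : Measurable fun x => ∫⁻ z, (g z : ℝ≥0∞) * m z x ∂μ :=
    Measurable.lintegral_prod_left' hj
  rw [lintegral_mul_const _ h1, mul_comm, lintegral_lintegral_swap (by
    exact (hj.comp measurable_swap).aemeasurable)]
  congr 1
  refine lintegral_congr fun x => ?_
  rw [lintegral_const_mul _ hm.of_uncurry_left.coe_nnreal_ennreal]

lemma lintegral_Fdens {ν : Measure X} [SigmaFinite ν] (hg : Measurable g)
    (hgb : ∃ C : ℝ≥0, ∀ x, g x ≤ C)
    (hm : Measurable (Function.uncurry m)) {M : Kernel X X} [IsMarkovKernel M]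
    (hM : ∀ x, M x = ν.withDensity fun y => (m x y : ℝ≥0∞)) {μ : Measure X} [IsFiniteMeasure μ]
    (hμ : ∫⁻ x, (g x : ℝ≥0∞) ∂μ ≠ 0) : ∫⁻ x, Fdens g m μ x ∂ν = 1 := by
  have h := isProbabilityMeasure_PhiS (M := M) hgb hμ
  rw [PhiS_eq_withDensity hg hm hM] at h
  rw [← Measure.restrict_univ (μ := ν), ← withDensity_apply _ MeasurableSet.univ, h.measure_univ]

lemma isCoupling_PhiC {ν : Measure X} [SigmaFinite ν] (hg : Measurable g)
    (hgb : ∃ C : ℝ≥0, ∀ x, g x ≤ C) {m₁ m₂ : X → X → ℝ≥0}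
    (hm₁ : Measurable (Function.uncurry m₁)) (hm₂ : Measurable (Function.uncurry m₂))
    {M₁ M₂ : Kernel X X} [IsMarkovKernel M₁] [IsMarkovKernel M₂]
    (hM₁ : ∀ x, M₁ x = ν.withDensity fun y => (m₁ x y : ℝ≥0∞))
    (hM₂ : ∀ x, M₂ x = ν.withDensity fun y => (m₂ x y : ℝ≥0∞))
    {μ₁ μ₂ : Measure X} [IsFiniteMeasure μ₁] [IsFiniteMeasure μ₂]
    (h₁ : ∫⁻ x, (g x : ℝ≥0∞) ∂μ₁ ≠ 0) (h₂ : ∫⁻ x, (g x : ℝ≥0∞) ∂μ₂ ≠ 0) :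
    IsCoupling (PhiC ν g m₁ m₂ μ₁ μ₂) (PhiS g M₁ μ₁) (PhiS g M₂ μ₂) := by
  rw [PhiS_eq_withDensity hg hm₁ hM₁, PhiS_eq_withDensity hg hm₂ hM₂]
  exact isCoupling_maxCoupling (measurable_Fdens hg hm₁ μ₁) (measurable_Fdens hg hm₂ μ₂)
    (lintegral_Fdens hg hgb hm₁ hM₁ h₁) (lintegral_Fdens hg hgb hm₂ hM₂ h₂)

end measurability

end maxCoupling

/-! ### Continuity of the maximal coupling in the densities -/

section scheffe

variable {ι : Type*} {l : Filter ι} {ν : Measure X}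

lemma tendsto_integral_mul_of_tendsto_L1 {f : ι → X → ℝ} {f₀ : X → ℝ}
    (hf : ∀ᶠ i in l, Integrable (f i) ν) (hf₀ : Integrable f₀ ν)
    (h : Tendsto (fun i => ∫ x, |f i x - f₀ x| ∂ν) l (𝓝 0)) {φ : X → ℝ} (hφ : BddMeas φ) :
    Tendsto (fun i => ∫ x, f i x * φ x ∂ν) l (𝓝 (∫ x, f₀ x * φ x ∂ν)) := by
  obtain ⟨hm, C, hC⟩ := hφ
  have hint : ∀ {u : X → ℝ}, Integrable u ν → Integrable (fun x => u x * φ x) ν := fun hu =>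
    hu.mul_bdd hm.aestronglyMeasurable (ae_of_all _ hC)
  rw [tendsto_iff_norm_sub_tendsto_zero]
  refine squeeze_zero' (Eventually.of_forall fun _ => norm_nonneg _) (g := fun i =>
    C * ∫ x, |f i x - f₀ x| ∂ν) ?_ (by simpa using h.const_mul C)
  filter_upwards [hf] with i hi
  rw [← integral_sub (hint hi) (hint hf₀), ← integral_const_mul]
  refine norm_integral_le_of_norm_le ((hi.sub hf₀).abs.const_mul C) (ae_of_all _ fun x => ?_)
  rw [← sub_mul, norm_mul, mul_comm]
  exact mul_le_mul_of_nonneg_right (hC x) (norm_nonneg _)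

lemma integral_abs_le_add {f g h : X → ℝ} (hf : Integrable f ν) (hg : Integrable g ν)
    (hh : Integrable h ν) (H : ∀ x, |f x| ≤ |g x| + |h x|) :
    ∫ x, |f x| ∂ν ≤ ∫ x, |g x| ∂ν + ∫ x, |h x| ∂ν := by
  rw [← integral_add hg.abs hh.abs]
  exact integral_mono hf.abs (hg.abs.add hh.abs) H

lemma integrable_toReal_of_lintegral_eq_one {a : X → ℝ≥0∞} (ha : Measurable a)
    (ha1 : ∫⁻ x, a x ∂ν = 1) : Integrable (fun x => (a x).toReal) ν :=
  integrable_toReal_of_lintegral_ne_top ha.aemeasurable (by simp [ha1])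

lemma integral_toReal_eq_one {a : X → ℝ≥0∞} (ha : Measurable a)
    (ha1 : ∫⁻ x, a x ∂ν = 1) : ∫ x, (a x).toReal ∂ν = 1 := by
  rw [integral_toReal ha.aemeasurable (ae_lt_top ha (by simp [ha1])), ha1, ENNReal.toReal_one]

/-- The maximal coupling depends continuously, on products of test functions, on the two densities
in `L¹`. -/
lemma tendsto_integral_maxCoupling [SigmaFinite ν] {a b : ι → X → ℝ≥0∞} {a₀ b₀ : X → ℝ≥0∞}
    (ha : ∀ᶠ i in l, Measurable (a i) ∧ ∫⁻ x, a i x ∂ν = 1)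
    (hb : ∀ᶠ i in l, Measurable (b i) ∧ ∫⁻ x, b i x ∂ν = 1)
    (ha₀ : Measurable a₀) (ha₀1 : ∫⁻ x, a₀ x ∂ν = 1)
    (hb₀ : Measurable b₀) (hb₀1 : ∫⁻ x, b₀ x ∂ν = 1)
    (hat : Tendsto (fun i => ∫ x, |(a i x).toReal - (a₀ x).toReal| ∂ν) l (𝓝 0))
    (hbt : Tendsto (fun i => ∫ x, |(b i x).toReal - (b₀ x).toReal| ∂ν) l (𝓝 0))
    {φ₁ φ₂ : X → ℝ} (h₁ : BddMeas φ₁) (h₂ : BddMeas φ₂) :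
    Tendsto (fun i => ∫ w, φ₁ w.1 * φ₂ w.2 ∂(maxCoupling ν (a i) (b i))) l
      (𝓝 (∫ w, φ₁ w.1 * φ₂ w.2 ∂(maxCoupling ν a₀ b₀))) := by
  obtain ⟨C₁, hC₁⟩ := h₁.2
  obtain ⟨C₂, hC₂⟩ := h₂.2
  have hia : ∀ᶠ i in l, Integrable (fun x => (a i x).toReal) ν :=
    ha.mono fun i hi => integrable_toReal_of_lintegral_eq_one hi.1 hi.2
  have hib : ∀ᶠ i in l, Integrable (fun x => (b i x).toReal) ν :=
    hb.mono fun i hi => integrable_toReal_of_lintegral_eq_one hi.1 hi.2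
  have hia₀ := integrable_toReal_of_lintegral_eq_one ha₀ ha₀1
  have hib₀ := integrable_toReal_of_lintegral_eq_one hb₀ hb₀1
  have him : ∀ᶠ i in l, Integrable (fun x => min (a i x).toReal (b i x).toReal) ν := by
    filter_upwards [hia, hib] with i h1 h2 using h1.inf h2
  have him₀ : Integrable (fun x => min (a₀ x).toReal (b₀ x).toReal) ν := hia₀.inf hib₀
  have hmt : Tendsto (fun i => ∫ x, |min (a i x).toReal (b i x).toReal -
      min (a₀ x).toReal (b₀ x).toReal| ∂ν) l (𝓝 0) := by
    refine squeeze_zero' (Eventually.of_forall fun _ => integral_nonneg fun _ => abs_nonneg _)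
      (g := fun i => ∫ x, |(a i x).toReal - (a₀ x).toReal| ∂ν +
        ∫ x, |(b i x).toReal - (b₀ x).toReal| ∂ν) ?_ (by simpa using hat.add hbt)
    filter_upwards [hia, hib, him] with i h1 h2 h3
    refine integral_abs_le_add (h3.sub him₀) (h1.sub hia₀) (h2.sub hib₀) fun x => ?_
    exact (abs_min_sub_min_le_max _ _ _ _).trans
      (max_le_add_of_nonneg (abs_nonneg _) (abs_nonneg _))
  have hsub : ∀ {c : ι → X → ℝ≥0∞} {c₀ : X → ℝ≥0∞},
      (∀ᶠ i in l, Integrable (fun x => (c i x).toReal) ν) →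
      Integrable (fun x => (c₀ x).toReal) ν →
      Tendsto (fun i => ∫ x, |(c i x).toReal - (c₀ x).toReal| ∂ν) l (𝓝 0) →
      Tendsto (fun i => ∫ x, |((c i x).toReal - min (a i x).toReal (b i x).toReal) -
        ((c₀ x).toReal - min (a₀ x).toReal (b₀ x).toReal)| ∂ν) l (𝓝 0) := by
    intro c c₀ hc hc₀ hct
    refine squeeze_zero' (Eventually.of_forall fun _ => integral_nonneg fun _ => abs_nonneg _)
      (g := fun i => ∫ x, |(c i x).toReal - (c₀ x).toReal| ∂ν +
        ∫ x, |min (a i x).toReal (b i x).toReal - min (a₀ x).toReal (b₀ x).toReal| ∂ν) ?_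
      (by simpa using hct.add hmt)
    filter_upwards [hc, him] with i h1 h2
    refine integral_abs_le_add ((h1.sub h2).sub (hc₀.sub him₀)) (h1.sub hc₀) (h2.sub him₀)
      fun x => ?_
    rw [sub_sub_sub_comm]
    exact abs_sub _ _
  have t1 := tendsto_integral_mul_of_tendsto_L1 him him₀ hmt (h₁.mul h₂)
  have t2 := tendsto_integral_mul_of_tendsto_L1 him him₀ hmt (BddMeas.const 1)
  simp only [mul_one] at t2
  have t3 := tendsto_integral_mul_of_tendsto_L1
    (by filter_upwards [hia, him] with i h h' using h.sub h') (hia₀.sub him₀)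
    (hsub hia hia₀ hat) h₁
  have t4 := tendsto_integral_mul_of_tendsto_L1
    (by filter_upwards [hib, him] with i h h' using h.sub h') (hib₀.sub him₀)
    (hsub hib hib₀ hbt) h₂
  -- the residual term is of second order in the residual mass
  have hbound : ∀ {u v : X → ℝ≥0∞}, Measurable u → ∫⁻ x, u x ∂ν = 1 → Measurable v →
      ∫⁻ x, v x ∂ν = 1 →
      |(∫ x, ((u x).toReal - min (u x).toReal (v x).toReal) * φ₁ x ∂ν) *
        ∫ x, ((v x).toReal - min (u x).toReal (v x).toReal) * φ₂ x ∂ν| ≤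
      C₁ * C₂ * (1 - ∫ x, min (u x).toReal (v x).toReal ∂ν) ^ 2 := by
    intro u v hu hu1 hv hv1
    have iu := integrable_toReal_of_lintegral_eq_one hu hu1
    have iv := integrable_toReal_of_lintegral_eq_one hv hv1
    have im : Integrable (fun x => min (u x).toReal (v x).toReal) ν := iu.inf iv
    have := abs_integral_residual_le (μ := ν) (ν := ν)
      (P := fun x => (u x).toReal - min (u x).toReal (v x).toReal)
      (Q := fun x => (v x).toReal - min (u x).toReal (v x).toReal)
      (k := fun w => φ₁ w.1 * φ₂ w.2) (C := C₁ * C₂)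
      (r := 1 - ∫ x, min (u x).toReal (v x).toReal ∂ν) (iu.sub im) (iv.sub im)
      (fun x => sub_nonneg.2 (min_le_left _ _)) (fun x => sub_nonneg.2 (min_le_right _ _))
      (by rw [integral_sub iu im, integral_toReal_eq_one hu hu1])
      (by rw [integral_sub iv im, integral_toReal_eq_one hv hv1])
      (fun w => by
        rw [abs_mul]
        exact mul_le_mul (hC₁ _) (hC₂ _) (abs_nonneg _) ((abs_nonneg _).trans (hC₁ w.1)))
    rw [← integral_prod_mul]
    refine le_of_eq_of_le (congrArg _ (integral_congr_ae (ae_of_all _ fun w => ?_))) this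
    ring
  rw [integral_maxCoupling ha₀ hb₀ ha₀1 hb₀1 h₁ h₂]
  refine (t1.add (tendsto_inv_mul_of_abs_le_sq (C := C₁ * C₂) (t2.const_sub 1) (t3.mul t4) ?_
    (hbound ha₀ ha₀1 hb₀ hb₀1))).congr' ?_
  · filter_upwards [ha, hb] with i h h'
    exact hbound h.1 h.2 h'.1 h'.2
  · filter_upwards [ha, hb] with i h h'
    exact (integral_maxCoupling h.1 h'.1 h.2 h'.2 h₁ h₂).symm

/-- The `L¹` distance of two probability densities is twice the mass of the positive part of their
difference. -/
lemma integral_abs_sub_density {a b : X → ℝ≥0∞} (ha : Measurable a) (hb : Measurable b)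
    (ha1 : ∫⁻ x, a x ∂ν = 1) (hb1 : ∫⁻ x, b x ∂ν = 1) :
    ∫ x, |(a x).toReal - (b x).toReal| ∂ν = 2 * (∫⁻ x, (b x - a x) ∂ν).toReal := by
  have ia := integrable_toReal_of_lintegral_eq_one ha ha1
  have ib := integrable_toReal_of_lintegral_eq_one hb hb1
  have hd : Measurable fun x => b x - a x := hb.sub ha
  have hdt : ∫⁻ x, (b x - a x) ∂ν ≠ ∞ := by
    refine ne_top_of_le_ne_top ENNReal.one_ne_top ?_
    rw [← hb1]
    exact lintegral_mono fun x => tsub_le_self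
  have id := integrable_toReal_of_lintegral_ne_top hd.aemeasurable hdt
  have e : ∀ᵐ x ∂ν, |(a x).toReal - (b x).toReal| =
      ((a x).toReal - (b x).toReal) + 2 * (b x - a x).toReal := by
    filter_upwards [ae_lt_top ha (by simp [ha1]), ae_lt_top hb (by simp [hb1])] with x h1 h2
    rcases le_total (a x) (b x) with h | h
    · rw [ENNReal.toReal_sub_of_le h h2.ne, abs_of_nonpos
        (sub_nonpos.2 (ENNReal.toReal_mono h2.ne h))]
      ring
    · rw [tsub_eq_zero_of_le h, abs_of_nonneg (sub_nonneg.2 (ENNReal.toReal_mono h1.ne h))]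
      simp
  have iab : Integrable (fun x => (a x).toReal - (b x).toReal) ν := ia.sub ib
  rw [integral_congr_ae e, integral_add iab (id.const_mul 2), integral_sub ia ib,
    integral_toReal_eq_one ha ha1, integral_toReal_eq_one hb hb1, integral_const_mul,
    integral_toReal hd.aemeasurable (ae_lt_top hd hdt)]
  ring

/-- Scheffé's lemma with high probability: random probability densities that converge pointwise to
a probability density, with high probability, converge in `L¹`. -/
lemma tendsto_L1_of_tendsto_whp [SigmaFinite ν] {Ω : ℕ → Type*} [∀ N, MeasurableSpace (Ω N)]
    {P : ∀ N, Measure (Ω N)} [∀ N, IsProbabilityMeasure (P N)]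
    {a : (Σ N, Ω N) → X → ℝ≥0∞} {a₀ : X → ℝ≥0∞}
    (ham : ∀ N, Measurable (Function.uncurry fun ω => a ⟨N, ω⟩))
    (ha1 : ∀ᶠ z in whp P, ∫⁻ x, a z x ∂ν = 1) (ha₀ : Measurable a₀) (ha₀t : ∀ x, a₀ x ≠ ∞)
    (ha₀1 : ∫⁻ x, a₀ x ∂ν = 1) (h : ∀ x, Tendsto (fun z => a z x) (whp P) (𝓝 (a₀ x))) :
    Tendsto (fun z => ∫ x, |(a z x).toReal - (a₀ x).toReal| ∂ν) (whp P) (𝓝 0) := by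
  have hm : ∀ N, Measurable (Function.uncurry fun (ω : Ω N) x => a₀ x - a ⟨N, ω⟩ x) := fun N =>
    (ha₀.comp measurable_snd).sub (ham N)
  have hx : ∀ x, Tendsto (fun N => ∫⁻ ω, (a₀ x - a ⟨N, ω⟩ x) ∂(P N)) atTop (𝓝 0) := fun x => by
    refine tendsto_lintegral_of_tendsto_whp (f := fun z => a₀ x - a z x) (C := (a₀ x).toNNReal)
      (fun z => ?_) ?_
    · rw [ENNReal.coe_toNNReal (ha₀t x)]
      exact tsub_le_self
    · have := ENNReal.Tendsto.sub (tendsto_const_nhds (x := a₀ x)) (h x) (Or.inl (ha₀t x))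
      rwa [tsub_self] at this
  have hE : Tendsto (fun N => ∫⁻ ω, ∫⁻ x, (a₀ x - a ⟨N, ω⟩ x) ∂ν ∂(P N)) atTop (𝓝 0) := by
    have : ∀ N, ∫⁻ ω, ∫⁻ x, (a₀ x - a ⟨N, ω⟩ x) ∂ν ∂(P N) =
        ∫⁻ x, ∫⁻ ω, (a₀ x - a ⟨N, ω⟩ x) ∂(P N) ∂ν := fun N =>
      lintegral_lintegral_swap (hm N).aemeasurable
    simp_rw [this]
    rw [← lintegral_zero (μ := ν)]
    refine tendsto_lintegral_of_dominated_convergence a₀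
      (fun N => (hm N).lintegral_prod_left') (fun N => ae_of_all _ fun x => ?_)
      (by simp [ha₀1]) (ae_of_all _ hx)
    calc _ ≤ ∫⁻ _, a₀ x ∂(P N) := lintegral_mono fun ω => tsub_le_self
      _ = a₀ x := by simp
  have hz := tendsto_whp_of_tendsto_lintegral (f := fun z => ∫⁻ x, (a₀ x - a z x) ∂ν)
    (fun N => (hm N).lintegral_prod_right') hE
  have hz' := ((ENNReal.tendsto_toReal ENNReal.zero_ne_top).comp hz).const_mul 2
  rw [ENNReal.toReal_zero, mul_zero] at hz'
  refine hz'.congr' ?_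
  filter_upwards [ha1] with z h1
  obtain ⟨N, ω⟩ := z
  exact (integral_abs_sub_density ((ham N).comp measurable_prodMk_left) ha₀ h1 ha₀1).symm

end scheffe

/-! ### Maximal coupling: the central limit theorem -/

section maximalCouplingCLT

section density

lemma bounded_mul_density {T : Type*} {g : T → ℝ≥0} {m : T → T → ℝ≥0}
    (hg : ∃ C : ℝ≥0, ∀ x, g x ≤ C) (hm : ∃ C : ℝ≥0, ∀ x y, m x y ≤ C) (x : T) :
    ∃ C : ℝ≥0, ∀ z, g z * m z x ≤ C := by
  obtain ⟨C, hC⟩ := hg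
  obtain ⟨D, hD⟩ := hm
  exact ⟨C * D, fun z => mul_le_mul' (hC z) (hD z x)⟩

variable {g : X → ℝ≥0} {m : X → X → ℝ≥0} {μ : Measure X}

lemma Fdens_ne_top [IsFiniteMeasure μ] (hg : ∃ C : ℝ≥0, ∀ x, g x ≤ C)
    (hm : ∃ C : ℝ≥0, ∀ x y, m x y ≤ C) (hμ : ∫⁻ x, (g x : ℝ≥0∞) ∂μ ≠ 0) (x : X) :
    Fdens g m μ x ≠ ∞ := by
  have := lintegral_coe_ne_top (μ := μ) (bounded_mul_density hg hm x)
  simp_rw [ENNReal.coe_mul] at this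
  exact ENNReal.div_ne_top this hμ

lemma toReal_Fdens (hg : Measurable g) (hm : Measurable (Function.uncurry m)) (x : X) :
    (Fdens g m μ x).toReal = (∫ z, ((g z * m z x : ℝ≥0) : ℝ) ∂μ) / ∫ z, (g z : ℝ) ∂μ := by
  have hq : Measurable fun z => g z * m z x := hg.mul (hm.of_uncurry_right (y := x))
  rw [Fdens, ENNReal.toReal_div, toReal_lintegral_coe hg, ← toReal_lintegral_coe hq]
  simp_rw [ENNReal.coe_mul]

end density

namespace IsCoupledFilter
variable {G : ℕ → X → ℝ≥0} {ηf ηc : Measure X} {Mf Mc : ℕ → Kernel X X}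
  {η : ℕ → Measure (X × X)} {Ψ : ∀ N : ℕ, ℕ → (Fin N → X × X) → Measure (X × X)}
  {R : ∀ N : ℕ, ℕ → Kernel (Fin N → X × X) (Fin N → X × X)}
  {ηs : Measure X} {M : ℕ → Kernel X X} {pr : X × X → X}

/-- The density of one marginal of the sampling law converges pointwise to the density of the
predictor, as it is a ratio of empirical means of bounded functions. -/
lemma tendsto_Fdens [∀ N n, IsMarkovKernel (R N n)] (h : IsCoupledFilter G ηf ηc Mf Mc η Ψ)
    (hm : IsMarginal G ηs M η Ψ pr) {n : ℕ} (hl : MarginalLLN G ηs M η Ψ R pr n)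
    {m : X → X → ℝ≥0} (hmm : Measurable (Function.uncurry m))
    (hmb : ∃ C : ℝ≥0, ∀ x y, m x y ≤ C) (x : X) :
    Tendsto (fun z : Σ N : ℕ, Fin N → X × X => Fdens (G n) m (empirical fun i => pr (z.2 i)) x)
      (whp fun N => lastLaw G (η 0) (Ψ N) (R N) n) (𝓝 (Fdens (G n) m (eta G ηs M n) x)) := by
  have hGm := h.measurable_potential
  have hGb := h.bounded_potential
  have hGn := hGm n
  have := hm.isProb_eta hGb n
  have hs := h.eventually_survives_lastLaw (R := R) n
  have hq : Measurable fun z => G n z * m z x := hGn.mul (hmm.of_uncurry_right (y := x))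
  obtain ⟨C, hC⟩ := hGb n
  obtain ⟨D, hD⟩ := bounded_mul_density (hGb n) hmb x
  have t1 := tendsto_of_rate (hl (fun z => ((G n z * m z x : ℝ≥0) : ℝ)) (BddMeas.of_nnreal hq hD))
  have t2 := tendsto_of_rate (hl (fun z => (G n z : ℝ)) (BddMeas.of_nnreal hGn hC))
  have t3 := t1.div t2 (hm.integral_pos hGm hGb n).ne'
  rw [← toReal_Fdens hGn hmm] at t3
  have t4 := ENNReal.tendsto_ofReal t3
  rw [ENNReal.ofReal_toReal (Fdens_ne_top (hGb n) hmb (hm.lintegral_eta_ne_zero hGb n) x)] at t4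
  refine t4.congr' ?_
  filter_upwards [hs] with z hz
  have := isProbabilityMeasure_empirical hz.pos fun i => pr (z.2 i)
  rw [Pi.div_apply, integral_comp_empirical (φ := fun z => ((G n z * m z x : ℝ≥0) : ℝ)) z.2
      hm.measurable hq.coe_nnreal_real,
    integral_comp_empirical (φ := fun z => (G n z : ℝ)) z.2 hm.measurable (by fun_prop),
    ← toReal_Fdens hGn hmm,
    ENNReal.ofReal_toReal (Fdens_ne_top (hGb n) hmb (hm.lintegral_ne_zero _ n _ hz) x)]

/-- The density of one marginal of the sampling law converges in `L¹`. -/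
lemma tendsto_L1_Fdens [∀ N n, IsMarkovKernel (R N n)] (h : IsCoupledFilter G ηf ηc Mf Mc η Ψ)
    (hm : IsMarginal G ηs M η Ψ pr) {n : ℕ} (hl : MarginalLLN G ηs M η Ψ R pr n)
    {ν : Measure X} [SigmaFinite ν] {m : X → X → ℝ≥0} (hmm : Measurable (Function.uncurry m))
    (hmb : ∃ C : ℝ≥0, ∀ x y, m x y ≤ C)
    (hM : ∀ x, M (n + 1) x = ν.withDensity fun y => (m x y : ℝ≥0∞)) :
    Tendsto (fun z : Σ N : ℕ, Fin N → X × X =>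
        ∫ x, |(Fdens (G n) m (empirical fun i => pr (z.2 i)) x).toReal -
          (Fdens (G n) m (eta G ηs M n) x).toReal| ∂ν)
      (whp fun N => lastLaw G (η 0) (Ψ N) (R N) n) (𝓝 0) := by
  have hGb := h.bounded_potential
  have hGn := h.measurable_potential n
  have := hm.isMarkov
  have := hm.isProb_eta hGb n
  have := fun N => h.isProb_lastLaw (R := R) N n
  refine tendsto_L1_of_tendsto_whp (Ω := fun N => Fin N → X × X)
    (a := fun z => Fdens (G n) m (empirical fun i => pr (z.2 i)))
    (fun N => measurable_Fdens_empirical hGn hmm hm.measurable) ?_ (measurable_Fdens hGn hmm _)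
    (Fdens_ne_top (hGb n) hmb (hm.lintegral_eta_ne_zero hGb n))
    (lintegral_Fdens hGn (hGb n) hmm hM (hm.lintegral_eta_ne_zero hGb n))
    (h.tendsto_Fdens hm hl hmm hmb)
  filter_upwards [h.eventually_survives_lastLaw (R := R) n] with z hz
  have := isProbabilityMeasure_empirical hz.pos fun i => pr (z.2 i)
  exact lintegral_Fdens hGn (hGb n) hmm hM (hm.lintegral_ne_zero _ n _ hz)

end IsCoupledFilter

variable {G : ℕ → X → ℝ≥0} {ηf ηc : Measure X} [IsProbabilityMeasure ηf] [IsProbabilityMeasure ηc]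
  {Mf Mc : ℕ → Kernel X X} [∀ n, IsMarkovKernel (Mf n)] [∀ n, IsMarkovKernel (Mc n)]
  {ν : Measure X} [SigmaFinite ν] {df dc : X → ℝ≥0} {mf mc : ℕ → X → X → ℝ≥0}

/-- The limit of the maximal coupling filter couples the predictors, and the particle system fits
the standing assumptions. -/
lemma isCoupledFilter_limC (hGm : ∀ n, Measurable (G n)) (hGb : ∀ n, ∃ C : ℝ≥0, ∀ x, G n x ≤ C)
    (hf : ∀ n, 0 < gam G ηf Mf n Set.univ) (hc : ∀ n, 0 < gam G ηc Mc n Set.univ)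
    (hdf : Measurable df) (hdc : Measurable dc)
    (hηf : ηf = ν.withDensity fun x => (df x : ℝ≥0∞))
    (hηc : ηc = ν.withDensity fun x => (dc x : ℝ≥0∞))
    (hmf : ∀ n, 1 ≤ n → Measurable (Function.uncurry (mf n)))
    (hmc : ∀ n, 1 ≤ n → Measurable (Function.uncurry (mc n)))
    (hMf : ∀ n, 1 ≤ n → ∀ x, Mf n x = ν.withDensity fun y => (mf n x y : ℝ≥0∞))
    (hMc : ∀ n, 1 ≤ n → ∀ x, Mc n x = ν.withDensity fun y => (mc n x y : ℝ≥0∞)) :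
    IsCoupledFilter G ηf ηc Mf Mc (limC ν G ηf ηc Mf Mc df dc mf mc)
      (fun _ p u => PhiC ν (G p) (mf (p + 1)) (mc (p + 1))
        (empirical (fun i => (u i).1)) (empirical (fun i => (u i).2))) where
  measurable_potential := hGm
  bounded_potential := hGb
  isProb_f := inferInstance
  isProb_c := inferInstance
  isMarkov_f := inferInstance
  isMarkov_c := inferInstance
  pos_f := hf
  pos_c := hc
  isCoupling n := by
    cases n with
    | zero =>
      have h1 : ∀ {d : X → ℝ≥0} {ηs : Measure X} [IsProbabilityMeasure ηs],
          ηs = ν.withDensity (fun x => (d x : ℝ≥0∞)) → ∫⁻ x, (d x : ℝ≥0∞) ∂ν = 1 := by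
        intro d ηs hp hd
        rw [← Measure.restrict_univ (μ := ν), ← withDensity_apply _ MeasurableSet.univ, ← hd,
          measure_univ]
      have := isCoupling_maxCoupling hdf.coe_nnreal_ennreal hdc.coe_nnreal_ennreal (h1 hηf) (h1 hηc)
      rwa [limC, eta_zero, eta_zero, hηf, hηc]
    | succ n =>
      have := isProbabilityMeasure_eta hGb hf n
      have := isProbabilityMeasure_eta hGb hc n
      rw [limC, eta_succ hGb hf, eta_succ hGb hc]
      exact isCoupling_PhiC (hGm n) (hGb n) (hmf _ (by omega)) (hmc _ (by omega))
        (hMf _ (by omega)) (hMc _ (by omega))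
        (lintegral_eta_ne_zero hGb hf n) (lintegral_eta_ne_zero hGb hc n)
  measurable_rule N p := measurable_maxCoupling
    (measurable_Fdens_empirical (hGm p) (hmf _ (by omega)) measurable_fst)
    (measurable_Fdens_empirical (hGm p) (hmc _ (by omega)) measurable_snd)
  isCoupling_rule N p u hu := by
    have hu' := (survives_iff (hGm p) u).1 hu
    exact isCoupling_PhiC (hGm p) (hGb p) (hmf _ (by omega)) (hmc _ (by omega))
      (hMf _ (by omega)) (hMc _ (by omega)) hu'.1 hu'.2

/-- The central limit theorem for the maximal coupling filter. -/
theorem errorCLT_lawC (hGm : ∀ n, Measurable (G n)) (hGb : ∀ n, ∃ C : ℝ≥0, ∀ x, G n x ≤ C)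
    (hf : ∀ n, 0 < gam G ηf Mf n Set.univ) (hc : ∀ n, 0 < gam G ηc Mc n Set.univ)
    (hdf : Measurable df) (hdc : Measurable dc)
    (hηf : ηf = ν.withDensity fun x => (df x : ℝ≥0∞))
    (hηc : ηc = ν.withDensity fun x => (dc x : ℝ≥0∞))
    (hmf : ∀ n, 1 ≤ n → Measurable (Function.uncurry (mf n)))
    (hmc : ∀ n, 1 ≤ n → Measurable (Function.uncurry (mc n)))
    (hMf : ∀ n, 1 ≤ n → ∀ x, Mf n x = ν.withDensity fun y => (mf n x y : ℝ≥0∞))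
    (hMc : ∀ n, 1 ≤ n → ∀ x, Mc n x = ν.withDensity fun y => (mc n x y : ℝ≥0∞))
    (hbf : ∀ n, 1 ≤ n → ∃ C : ℝ≥0, ∀ x y, mf n x y ≤ C)
    (hbc : ∀ n, 1 ≤ n → ∃ C : ℝ≥0, ∀ x y, mc n x y ≤ C)
    (R : ∀ N : ℕ, ℕ → Kernel (Fin N → X × X) (Fin N → X × X)) [∀ N n, IsMarkovKernel (R N n)]
    {φ : X → ℝ} (hφ : BddMeas φ) (n : ℕ) :
    (∫ u, (φ u.1 - φ u.2) ∂(limC ν G ηf ηc Mf Mc df dc mf mc n) =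
        ∫ x, φ x ∂(eta G ηf Mf n) - ∫ x, φ x ∂(eta G ηc Mc n)) ∧
      ErrorCLT n (fun N => lawC ν G df dc mf mc N (R N) n)
        (limC ν G ηf ηc Mf Mc df dc mf mc n) φ
        (asympVar G ηf ηc Mf Mc (limC ν G ηf ηc Mf Mc df dc mf mc) n φ) := by
  have h := isCoupledFilter_limC hGm hGb hf hc hdf hdc hηf hηc hmf hmc hMf hMc
  have := h.isProb_eta_f n
  refine ⟨IsCoupledFilter.integral_sub_coupling (h.isCoupling n) hφ hφ, ?_⟩
  refine h.errorCLT (R := R) hφ fun t => h.tendsto_charFun_werr (F := BddMeas) (fun _ => id)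
    (fun n φ hφ => hφ.backStep (hGm n) (hGb n)) (fun n φ hφ => hφ.backStep (hGm n) (hGb n))
    (fun n φ₁ φ₂ h₁ h₂ => ?_) n hφ hφ t
  have := h.isProb_eta_f n
  have := h.isProb_eta_c n
  have hn : 1 ≤ n + 1 := by omega
  have hs := h.eventually_survives_lastLaw (R := R) n
  have hl := h.marginalLLN (R := R) n
  refine tendsto_integral_maxCoupling ?_ ?_ (measurable_Fdens (hGm n) (hmf _ hn) _)
    (lintegral_Fdens (hGm n) (hGb n) (hmf _ hn) (hMf _ hn) (lintegral_eta_ne_zero hGb hf n))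
    (measurable_Fdens (hGm n) (hmc _ hn) _)
    (lintegral_Fdens (hGm n) (hGb n) (hmc _ hn) (hMc _ hn) (lintegral_eta_ne_zero hGb hc n))
    (h.tendsto_L1_Fdens h.isMarginal_fst hl.1 (hmf _ hn) (hbf _ hn) (hMf _ hn))
    (h.tendsto_L1_Fdens h.isMarginal_snd hl.2 (hmc _ hn) (hbc _ hn) (hMc _ hn)) h₁ h₂
  · filter_upwards [hs] with z hz
    exact ⟨measurable_Fdens (hGm n) (hmf _ hn) _, lintegral_Fdens (hGm n) (hGb n) (hmf _ hn)
      (hMf _ hn) ((survives_iff (hGm n) z.2).1 hz).1⟩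
  · filter_upwards [hs] with z hz
    exact ⟨measurable_Fdens (hGm n) (hmc _ hn) _, lintegral_Fdens (hGm n) (hGb n) (hmc _ hn)
      (hMc _ hn) ((survives_iff (hGm n) z.2).1 hz).2⟩

end maximalCouplingCLT

end CoupledPF

end

theorem theorem4p1 {X : Type*} [MeasurableSpace X]
    -- the two Feynman-Kac models, with common potentials
    (G : ℕ → X → ℝ≥0) (hGm : ∀ n, Measurable (G n)) (hGb : ∀ n, ∃ C : ℝ≥0, ∀ x, G n x ≤ C)
    (ηf ηc : Measure X) [IsProbabilityMeasure ηf] [IsProbabilityMeasure ηc]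
    (Mf Mc : ℕ → Kernel X X) [∀ n, IsMarkovKernel (Mf n)] [∀ n, IsMarkovKernel (Mc n)]
    (hf : ∀ n, 0 < CoupledPF.gam G ηf Mf n Set.univ)
    (hc : ∀ n, 0 < CoupledPF.gam G ηc Mc n Set.univ)
    -- the initial coupling and the coupled Markov kernels
    (η₀ : Measure (X × X)) (hη₀ : CoupledPF.IsCoupling η₀ ηf ηc)
    (K : ℕ → Kernel (X × X) (X × X)) [∀ n, IsMarkovKernel (K n)]
    (hK : ∀ n, 1 ≤ n → ∀ u : X × X, CoupledPF.IsCoupling (K n u) (Mf n u.1) (Mc n u.2))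
    -- an arbitrary rule for continuing after extinction
    (R : ∀ N : ℕ, ℕ → Kernel (Fin N → X × X) (Fin N → X × X))
    [∀ N n, IsMarkovKernel (R N n)] :
    -- independent pair resampling
    (∀ φ : X → ℝ, Measurable φ → (∃ C : ℝ, ∀ x, |φ x| ≤ C) → ∀ n : ℕ,
      (∫ u, (φ u.1 - φ u.2) ∂(CoupledPF.limI G ηf ηc Mf Mc η₀ K n) =
        ∫ x, φ x ∂(CoupledPF.eta G ηf Mf n) - ∫ x, φ x ∂(CoupledPF.eta G ηc Mc n)) ∧
      CoupledPF.ErrorCLT n (fun N => CoupledPF.lawI G η₀ K N (R N) n)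
        (CoupledPF.limI G ηf ηc Mf Mc η₀ K n) φ
        (CoupledPF.asympVar G ηf ηc Mf Mc (CoupledPF.limI G ηf ηc Mf Mc η₀ K) n φ)) ∧
    -- maximally coupled resampling
    (∀ [TopologicalSpace X] [BorelSpace X] [TopologicalSpace.MetrizableSpace (X × X)]
        [LocallyCompactSpace (X × X)] [TopologicalSpace.SeparableSpace (X × X)],
      (∀ n, Continuous (G n)) →
      (∀ n, 1 ≤ n → ∀ ψ : (X × X) →ᵇ ℝ, Continuous (fun u => ∫ w, ψ w ∂(K n u))) →
      ∀ φ : X → ℝ, Continuous φ → (∃ C : ℝ, ∀ x, |φ x| ≤ C) → ∀ n : ℕ,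
      (∫ u, (φ u.1 - φ u.2) ∂(CoupledPF.limM G η₀ K n) =
        ∫ x, φ x ∂(CoupledPF.eta G ηf Mf n) - ∫ x, φ x ∂(CoupledPF.eta G ηc Mc n)) ∧
      CoupledPF.ErrorCLT n (fun N => CoupledPF.lawM G η₀ K N (R N) n)
        (CoupledPF.limM G η₀ K n) φ
        (CoupledPF.asympVar G ηf ηc Mf Mc (CoupledPF.limM G η₀ K) n φ)) ∧
    -- maximal coupling
    (∀ (ν : Measure X) [SigmaFinite ν] (df dc : X → ℝ≥0) (mf mc : ℕ → X → X → ℝ≥0),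
      Measurable df → Measurable dc →
      ηf = ν.withDensity (fun x => (df x : ℝ≥0∞)) →
      ηc = ν.withDensity (fun x => (dc x : ℝ≥0∞)) →
      (∀ n, 1 ≤ n → Measurable (Function.uncurry (mf n))) →
      (∀ n, 1 ≤ n → Measurable (Function.uncurry (mc n))) →
      (∀ n, 1 ≤ n → ∀ x, Mf n x = ν.withDensity (fun y => (mf n x y : ℝ≥0∞))) →
      (∀ n, 1 ≤ n → ∀ x, Mc n x = ν.withDensity (fun y => (mc n x y : ℝ≥0∞))) →
      (∀ n, 1 ≤ n → ∃ C : ℝ≥0, ∀ x y, mf n x y ≤ C) →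
      (∀ n, 1 ≤ n → ∃ C : ℝ≥0, ∀ x y, mc n x y ≤ C) →
      ∀ φ : X → ℝ, Measurable φ → (∃ C : ℝ, ∀ x, |φ x| ≤ C) → ∀ n : ℕ,
      (∫ u, (φ u.1 - φ u.2) ∂(CoupledPF.limC ν G ηf ηc Mf Mc df dc mf mc n) =
        ∫ x, φ x ∂(CoupledPF.eta G ηf Mf n) - ∫ x, φ x ∂(CoupledPF.eta G ηc Mc n)) ∧
      CoupledPF.ErrorCLT n (fun N => CoupledPF.lawC ν G df dc mf mc N (R N) n)
        (CoupledPF.limC ν G ηf ηc Mf Mc df dc mf mc n) φ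
        (CoupledPF.asympVar G ηf ηc Mf Mc
          (CoupledPF.limC ν G ηf ηc Mf Mc df dc mf mc) n φ)) := by
  refine ⟨fun φ hφm hφb n => ?_, ?_, ?_⟩
  · exact CoupledPF.errorCLT_lawI G hGm hGb ηf ηc Mf Mc hf hc η₀ hη₀ K hK R ⟨hφm, hφb⟩ n
  · intro _ _ _ _ _ hG hKc φ hφc hφb n
    -- `X` embeds into `X × X`, so it is metrizable and second countable
    obtain ⟨x₀⟩ := ηf.nonempty_of_neZero
    have : SecondCountableTopology (X × X) :=
      let := TopologicalSpace.metrizableSpaceMetric (X × X)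
      UniformSpace.secondCountable_of_separable _
    have he := isEmbedding_prodMkLeft (X := X) x₀
    have := he.secondCountableTopology
    have := he.metrizableSpace
    exact CoupledPF.errorCLT_lawM G hG hGb ηf ηc Mf Mc hf hc η₀ hη₀ K hK hKc R hφc hφb n
  · intro ν _ df dc mf mc hdf hdc hηf hηc hmf hmc hMf hMc hbf hbc φ hφm hφb n
    exact CoupledPF.errorCLT_lawC hGm hGb hf hc hdf hdc hηf hηc hmf hmc hMf hMc hbf hbc R
      ⟨hφm, hφb⟩ n
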